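/- Let $\vartheta:\mathbf R\to\mathbf R$ be the Riemann–Siegel theta function, i.e. the real analytic function with $\vartheta(0)=0$ and $\Gamma(\tfrac14+\tfrac{it}{2})=|\Gamma(\tfrac14+\tfrac{it}{2})|\,e^{i(\vartheta(t)+\frac t2\log\pi)}$ for all real $t$. There is a unique real analytic function $\kappa:\mathbf R\to\mathbf R$ such that $\kappa(0)=-\tfrac12$ and $$e^{2\pi i\kappa(t)}=1+2\vartheta'(t)\,\frac{\zeta(\frac12+it)}{\zeta'(\frac12+it)}$$ for all real $t$ with $\zeta'(\tfrac12+it)\neq0$; there is a unique $a_\vartheta>0$ with $\vartheta'(a_\vartheta)=0$; and the real numbers $t>0$ with $\zeta(\tfrac12+it)=0$ form, listed in increasing order without repetition, a unique infinite sequence $\xi_1<\xi_2<\cdots$. With these notations: (a) $\kappa(a_\vartheta)=0$, $\kappa(-a_\vartheta)=-1$, and for every integer $n\ge1$, $\kappa(\xi_n)=n$ and $\kappa(-\xi_n)=-n-1$. For real $t$, $\kappa(t)$ is an integer only if $t=\pm a_\vartheta$ or $t=\pm\xi_n$ for some $n\ge1$. (b) For every integer $n\ge1$, $\xi_n$ is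 the unique real solution $t$ of $\kappa(t)=n$. (c) Assume the Riemann hypothesis and that all zeros of $\zeta$ in the upper half-plane are simple. Let $\rho_n=\beta_n+i\gamma_n$ ($n\ge1$) be the infinite sequence of all zeros of $\zeta$ in the upper half-plane, each occurring as often as its multiplicity, with $0<\gamma_1\le\gamma_2\le\cdots$. Then for every $n\ge1$, $\gamma_n$ is the unique real solution $t$ of $\kappa(t)=n$. -/

import Mathlib

/-- The Riemann–Siegel theta function: the phase `ϑ(t)`, with `ϑ(0) = 0`, obtained by continuous
variation of `arg Γ(1/4 + i t/2) - (t/2) log π` from `t = 0`. The derivative of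
`arg Γ(1/4 + i t/2)` is `(1/2) Re (Γ'/Γ)(1/4 + i t/2)`. -/
noncomputable def rsTheta (t : ℝ) : ℝ :=
  -(t / 2) * Real.log Real.pi +
    (1 / 2) * ∫ x in (0 : ℝ)..t, (Complex.digamma (1 / 4 + Complex.I * ((x : ℂ) / 2))).re

/-- The point `1/2 + i t` of the critical line. -/
noncomputable def critPt (t : ℝ) : ℂ := 1 / 2 + Complex.I * (t : ℂ)

/-- `κ : ℝ → ℝ` is real analytic, `κ(0) = -1/2`, and
`exp (2 π i κ(t)) = 1 + 2 ϑ'(t) ζ(1/2 + i t) / ζ'(1/2 + i t)`.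
The equation is required wherever its right side is a genuine quotient. At the remaining
(isolated) `t` it is understood by analytic continuation, so `κ` is determined there too. -/
def IsKappa (κ : ℝ → ℝ) : Prop :=
  (∀ t : ℝ, AnalyticAt ℝ κ t) ∧
  κ 0 = -(1 / 2) ∧
  ∀ t : ℝ, deriv riemannZeta (critPt t) ≠ 0 →
    Complex.exp (2 * Real.pi * Complex.I * (κ t : ℂ)) =
      1 + 2 * ((deriv rsTheta t : ℝ) : ℂ) * (riemannZeta (critPt t) / deriv riemannZeta (critPt t))

/-- `a` is a positive critical point of `ϑ`. -/
def IsThetaCritical (a : ℝ) : Prop := 0 < a ∧ deriv rsTheta a = 0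

/-- `ξ₁ < ξ₂ < ⋯` lists, without repetition, all `t > 0` with `ζ(1/2 + i t) = 0`. -/
def IsCriticalLineOrdinates (ξ : ℕ+ → ℝ) : Prop :=
  StrictMono ξ ∧ Set.range ξ = {t : ℝ | 0 < t ∧ riemannZeta (critPt t) = 0}

/-- `ρ₁, ρ₂, …` lists all zeros of `ζ` in the upper half-plane in order of non-decreasing ordinate,
every zero appearing exactly as often as its multiplicity (and other points not at all). -/
def IsUpperZeros (ρ : ℕ+ → ℂ) : Prop :=
  (∀ n, 0 < (ρ n).im) ∧ Monotone (fun n => (ρ n).im) ∧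
  ∀ z : ℂ, 0 < z.im → {n : ℕ+ | ρ n = z}.encard = analyticOrderAt riemannZeta z

/-- All zeros of `ζ` in the upper half-plane are simple. -/
def SimpleUpperZeros : Prop :=
  ∀ z : ℂ, 0 < z.im → riemannZeta z = 0 → analyticOrderAt riemannZeta z = 1

open Complex in
/-- The defining relation of `ϑ`:
`Γ(1/4 + i t/2) = |Γ(1/4 + i t/2)| exp (i (ϑ(t) + (t/2) log π))`. -/
theorem Gamma_eq_norm_mul_exp_rsTheta (t : ℝ) :
    Gamma (1 / 4 + I * ((t : ℂ) / 2)) =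
      (‖Gamma (1 / 4 + I * ((t : ℂ) / 2))‖ : ℂ) *
        exp (I * ((rsTheta t : ℂ) + (t : ℂ) / 2 * (Real.log Real.pi : ℂ))) := by
  have hre : ∀ x : ℝ, 0 < (1 / 4 + I * ((x : ℂ) / 2)).re := by
    intro x; simp
  have hne : ∀ x : ℝ, Gamma (1 / 4 + I * ((x : ℂ) / 2)) ≠ 0 := fun x =>
    Gamma_ne_zero_of_re_pos (hre x)
  have hopen : IsOpen {s : ℂ | 0 < s.re} := isOpen_lt continuous_const continuous_re
  have hdiff : DifferentiableOn ℂ Gamma {s : ℂ | 0 < s.re} := by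
    intro s hs
    refine (differentiableAt_Gamma s fun m h => ?_).differentiableWithinAt
    have hs' : 0 < s.re := hs
    rw [h] at hs'
    simp at hs'
    have : (0 : ℝ) ≤ m := m.cast_nonneg
    linarith
  have hcd : ContinuousOn digamma {s : ℂ | 0 < s.re} := by
    have h1 : ContinuousOn (deriv Gamma) {s : ℂ | 0 < s.re} := (hdiff.deriv hopen).continuousOn
    exact h1.div hdiff.continuousOn fun s hs => Gamma_ne_zero_of_re_pos hs
  have hpath : Continuous fun x : ℝ => (1 / 4 + I * ((x : ℂ) / 2) : ℂ) := by fun_prop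
  have hcont : Continuous fun x : ℝ => digamma (1 / 4 + I * ((x : ℂ) / 2)) :=
    hcd.comp_continuous hpath hre
  set D : ℝ → ℂ := fun x => digamma (1 / 4 + I * ((x : ℂ) / 2)) with hD
  set J : ℝ → ℂ := fun x => ∫ y in (0 : ℝ)..x, D y with hJ
  have hJd : ∀ x, HasDerivAt J (D x) x := fun x =>
    intervalIntegral.integral_hasDerivAt_right (hcont.intervalIntegrable _ _)
      (hcont.stronglyMeasurableAtFilter _ _) hcont.continuousAt
  have hGd : ∀ x : ℝ, HasDerivAt (fun x : ℝ => Gamma (1 / 4 + I * ((x : ℂ) / 2)))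
      (deriv Gamma (1 / 4 + I * ((x : ℂ) / 2)) * (I / 2)) x := by
    intro x
    have h1 : HasDerivAt (fun x : ℝ => (1 / 4 + I * ((x : ℂ) / 2) : ℂ)) (I / 2) x := by
      have := ((((hasDerivAt_id x).ofReal_comp).div_const 2).const_mul I).const_add (1 / 4 : ℂ)
      simpa [div_eq_mul_inv] using this
    have h2 := (hdiff.differentiableAt (hopen.mem_nhds (hre x))).hasDerivAt
    exact h2.comp x h1
  have hconst : ∀ x : ℝ, Gamma (1 / 4 + I * ((x : ℂ) / 2)) * exp (-(I / 2 * J x)) =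
      Gamma (1 / 4) := by
    have hder : ∀ x : ℝ, HasDerivAt
        (fun x : ℝ => Gamma (1 / 4 + I * ((x : ℂ) / 2)) * exp (-(I / 2 * J x))) 0 x := by
      intro x
      have hE : HasDerivAt (fun x : ℝ => exp (-(I / 2 * J x)))
          (exp (-(I / 2 * J x)) * -(I / 2 * D x)) x :=
        (((hJd x).const_mul (I / 2)).neg).cexp
      refine ((hGd x).mul hE).congr_deriv ?_
      have hDx : D x * Gamma (1 / 4 + I * ((x : ℂ) / 2)) =
          deriv Gamma (1 / 4 + I * ((x : ℂ) / 2)) := by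
        simp only [hD, digamma_def, logDeriv_apply]
        exact div_mul_cancel₀ _ (hne x)
      rw [← hDx]
      ring
    intro x
    have := is_const_of_deriv_eq_zero (fun x => (hder x).differentiableAt)
      (fun x => (hder x).deriv) x 0
    rw [this]
    simp [hJ]
  have hG : Gamma (1 / 4 + I * ((t : ℂ) / 2)) = Gamma (1 / 4) * exp (I / 2 * J t) := by
    rw [← hconst t, mul_assoc, ← exp_add]
    simp
  have hquarter : Gamma (1 / 4) = ((Real.Gamma (1 / 4) : ℝ) : ℂ) := by
    rw [← Complex.Gamma_ofReal]; norm_num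
  have hpos : 0 < Real.Gamma (1 / 4) := Real.Gamma_pos_of_pos (by norm_num)
  have hJre : (J t).re = ∫ y in (0 : ℝ)..t, (D y).re :=
    (reCLM.intervalIntegral_comp_comm (hcont.intervalIntegrable 0 t)).symm
  have hth : ((rsTheta t : ℂ) + (t : ℂ) / 2 * (Real.log Real.pi : ℂ)) =
      (((J t).re / 2 : ℝ) : ℂ) := by
    rw [hJre, rsTheta]
    push_cast
    ring
  have hsplit : I / 2 * J t = ((-((J t).im / 2) : ℝ) : ℂ) + I * (((J t).re / 2 : ℝ) : ℂ) := by
    apply Complex.ext <;> simp <;> ring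
  rw [hth, hG, hquarter, hsplit, exp_add, norm_mul, norm_mul, norm_exp, norm_exp]
  have : (I * (((J t).re / 2 : ℝ) : ℂ)).re = 0 := by simp
  rw [this, norm_real, Real.norm_of_nonneg hpos.le, Real.exp_zero, ofReal_re]
  push_cast
  ring

/-! On the critical line the completed zeta function `Gammaℝ s * ζ s` is a real function Ξ(t)
(`critXi`). Differentiating it logarithmically gives Re(ζ'/ζ)(1/2 + it) = -ϑ'(t), in the
division-free form `deriv_zeta_mul_conj_re`. Hence |ζ' + 2ϑ'ζ| = |ζ'|, so the right side of the
relation for κ is a phase on the unit circle (`norm_kappaPhase`). It extends analytically over the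
zeros of ζ', because on the line these are zeros of ζ (`zeta_eq_zero_of_deriv_eq_zero`) and ζ/ζ' is
analytic at every zero of ζ. A logarithm of this phase is κ, unique once κ(0) is fixed, and
conjugation symmetry gives κ(-t) = -κ(t) - 1.

The phase equals 1, that is, κ is an integer, exactly where ϑ'ζ/ζ' = 0: at ±a and at the zeros of ζ.
At a and at every positive ordinate the imaginary part 2ϑ' Im(ζ/ζ') of the phase passes from
negative to positive, so κ crosses the integer upwards. At an ordinate this holds because ζ/ζ' has
slope i/m along the line (m the multiplicity) and ϑ' > 0 beyond a. At a itself ϑ' changes sign, and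
Im(ζ/ζ') > 0 is needed. Since no integer is taken between consecutive crossing points, κ rises by
exactly 1 from each to the next, starting from κ(0) = -1/2 and κ(a) = 0.

Two inputs are substantial. The first is numerical: a lies in (6.236, 6.344), Ξ < 0 on [-6.344,
6.344], and Im(ζ' conj ζ) < 0 at a (`IsThetaCritical.deriv_zeta_mul_conj_im_neg`). It rests on
telescoping bounds for the digamma function and on comparison bounds for the cosine integral of the
theta kernel. The second is Hardy's theorem, that the critical line carries infinitely many zeros
(`exists_critXi_eq_zero_gt`). It comes from the behaviour of the theta function at the cusps -1 and
-2.

Under the Riemann hypothesis and simplicity the ordinates of all upper zeros are again an increasing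
enumeration of the zeros on the line, so the last statement is an instance of the unconditional one.
-/

/-! ### The digamma function: its series and explicit bounds on the line Re s = 1/4. -/

open Filter Topology in
-- The series is integrated termwise in an increment z. By Euler's limit formula for Γ the
-- integrated sum exponentiates to e^{γz} Γ(s+z)/Γ(s) near z = 0. Comparing derivatives at z = 0
-- returns the series.
theorem hasSum_digamma {s : ℂ} (hs : 0 < s.re) :
    HasSum (fun j : ℕ => 1 / ((j : ℂ) + 1) - 1 / (s + j))
      (Complex.digamma s + Real.eulerMascheroniConstant) := by
  set δ : ℝ := s.re / 2 with hδ
  have hδ0 : 0 < δ := by positivity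
  have hre : ∀ z ∈ Metric.ball (0 : ℂ) δ, ∀ j : ℕ, δ + j ≤ (s + z + j).re := by
    intro z hz j
    have h1 : |z.re| ≤ ‖z‖ := Complex.abs_re_le_norm z
    have h2 : ‖z‖ < δ := by simpa using hz
    have := neg_abs_le z.re
    simp only [Complex.add_re, Complex.natCast_re]
    linarith
  have hpos : ∀ z ∈ Metric.ball (0 : ℂ) δ, ∀ j : ℕ, 0 < (s + z + j).re := fun z hz j =>
    lt_of_lt_of_le (by positivity) (hre z hz j)
  have hne : ∀ z ∈ Metric.ball (0 : ℂ) δ, ∀ j : ℕ, s + z + j ≠ 0 := fun z hz j h => by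
    have := hpos z hz j
    rw [h] at this
    simp at this
  have hn1 : ∀ j : ℕ, (j : ℂ) + 1 ≠ 0 := fun j => by exact_mod_cast j.succ_ne_zero
  have h0 : (0 : ℂ) ∈ Metric.ball (0 : ℂ) δ := by simpa using hδ0
  set g : ℕ → ℂ → ℂ := fun j z =>
    z / ((j : ℂ) + 1) - (Complex.log (s + z + j) - Complex.log (s + j)) with hg
  set g' : ℕ → ℂ → ℂ := fun j z => 1 / ((j : ℂ) + 1) - 1 / (s + z + j) with hg'
  have hder : ∀ j z, z ∈ Metric.ball (0 : ℂ) δ → HasDerivAt (g j) (g' j z) z := by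
    intro j z hz
    have h1 : HasDerivAt (fun z : ℂ => s + z + j) 1 z :=
      ((hasDerivAt_id z).const_add s).add_const (j : ℂ)
    have h2 := h1.clog (Or.inl (hpos z hz j))
    exact ((hasDerivAt_id z).div_const ((j : ℂ) + 1)).sub (h2.sub_const _)
  set M : ℝ := (‖s‖ + δ + 1) / min δ 1 with hM
  have hm0 : 0 < min δ 1 := lt_min hδ0 one_pos
  have hu : Summable (fun j : ℕ => M * (1 / ((j : ℝ) + 1) ^ 2)) := by
    have := (summable_nat_add_iff 1).2 (Real.summable_one_div_nat_pow.2 (one_lt_two))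
    exact (by simpa using this : Summable fun j : ℕ => 1 / ((j : ℝ) + 1) ^ 2).mul_left M
  have hbound : ∀ j z, z ∈ Metric.ball (0 : ℂ) δ → ‖g' j z‖ ≤ M * (1 / ((j : ℝ) + 1) ^ 2) := by
    intro j z hz
    have e : g' j z = (s + z - 1) / (((j : ℂ) + 1) * (s + z + j)) := by
      simp only [hg']
      rw [div_sub_div _ _ (hn1 j) (hne z hz j)]
      ring
    have hz' : ‖z‖ < δ := by simpa using hz
    have hnum : ‖s + z - 1‖ ≤ ‖s‖ + δ + 1 := by
      calc ‖s + z - 1‖ ≤ ‖s + z‖ + ‖(1 : ℂ)‖ := norm_sub_le _ _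
        _ ≤ ‖s‖ + ‖z‖ + 1 := by rw [norm_one]; gcongr; exact norm_add_le _ _
        _ ≤ _ := by linarith
    have hd1 : ‖(j : ℂ) + 1‖ = (j : ℝ) + 1 := by
      have : (j : ℂ) + 1 = ((j + 1 : ℕ) : ℂ) := by push_cast; ring
      rw [this, Complex.norm_natCast]; push_cast; ring
    have hd2 : min δ 1 * ((j : ℝ) + 1) ≤ ‖s + z + j‖ := by
      have h1 := hre z hz j
      have h2 := (le_abs_self _).trans (Complex.abs_re_le_norm (s + z + j))
      have h3 : min δ 1 ≤ δ := min_le_left _ _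
      have h4 : min δ 1 * (j : ℝ) ≤ 1 * j := by gcongr; exact min_le_right _ _
      linarith
    rw [e, norm_div, norm_mul, hd1, hM, div_mul_div_comm, mul_one]
    refine div_le_div₀ (by positivity) hnum (by positivity) ?_
    calc min δ 1 * ((j : ℝ) + 1) ^ 2 = ((j : ℝ) + 1) * (min δ 1 * (j + 1)) := by ring
      _ ≤ _ := by gcongr
  have hg0 : ∀ j, g j 0 = 0 := by intro j; simp [hg]
  have hsum0 : Summable (fun j => g j 0) := by simp [hg0, summable_zero]
  have hpre : IsPreconnected (Metric.ball (0 : ℂ) δ) := (convex_ball _ _).isPreconnected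
  have hsum : ∀ z ∈ Metric.ball (0 : ℂ) δ, Summable (fun j => g j z) := fun z hz =>
    summable_of_summable_hasDerivAt_of_isPreconnected hu Metric.isOpen_ball hpre hder hbound h0
      hsum0 hz
  have hF := hasDerivAt_tsum_of_isPreconnected hu Metric.isOpen_ball hpre hder hbound h0 hsum0 h0
  have hsumd : Summable (fun j => g' j 0) := Summable.of_norm_bounded hu fun j => hbound j 0 h0
  have hGs : Complex.Gamma s ≠ 0 := Complex.Gamma_ne_zero_of_re_pos hs
  have hkey : ∀ z ∈ Metric.ball (0 : ℂ) δ, Complex.exp (∑' j, g j z) =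
      Complex.exp (z * Real.eulerMascheroniConstant) * Complex.Gamma (s + z) / Complex.Gamma s := by
    intro z hz
    have hfin : ∀ n : ℕ, n ≠ 0 → Complex.exp (∑ j ∈ Finset.range (n + 1), g j z) =
        Complex.exp (z * (((harmonic n : ℝ) - Real.log n : ℝ) : ℂ)) *
          Complex.exp (z / ((n : ℂ) + 1)) *
          (Complex.GammaSeq (s + z) n / Complex.GammaSeq s n) := by
      intro n hn
      have hn0 : (n : ℂ) ≠ 0 := by exact_mod_cast hn
      have hprod : ∏ j ∈ Finset.range (n + 1), Complex.exp (g j z) =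
          Complex.exp (∑ j ∈ Finset.range (n + 1), z / ((j : ℂ) + 1)) *
          ((∏ j ∈ Finset.range (n + 1), (s + j)) / ∏ j ∈ Finset.range (n + 1), (s + z + j)) := by
        rw [Complex.exp_sum, ← Finset.prod_div_distrib, ← Finset.prod_mul_distrib]
        refine Finset.prod_congr rfl fun j _ => ?_
        have hs0 : s + j ≠ 0 := by simpa using hne 0 h0 j
        simp only [hg]
        rw [Complex.exp_sub, Complex.exp_sub, Complex.exp_log (hne z hz j), Complex.exp_log hs0]
        field_simp
      -- `GammaSeq` at n has n + 1 factors, one more than the terms of the n-th harmonic number,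
      -- hence the extra z/(n+1), which tends to 0.
      have hharm : ∑ j ∈ Finset.range (n + 1), z / ((j : ℂ) + 1) =
          z * (((harmonic n : ℝ) - Real.log n : ℝ) : ℂ) + z / ((n : ℂ) + 1) +
            z * Complex.log n := by
        rw [Finset.sum_range_succ]
        have : ∑ j ∈ Finset.range n, z / ((j : ℂ) + 1) = z * ((harmonic n : ℝ) : ℂ) := by
          simp only [harmonic, div_eq_mul_inv]
          push_cast
          rw [Finset.mul_sum]
        rw [this, ← Complex.natCast_log]
        push_cast
        ring
      have hfac : (n.factorial : ℂ) ≠ 0 := by exact_mod_cast n.factorial_ne_zero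
      have hp1 : ∏ j ∈ Finset.range (n + 1), (s + (j : ℂ)) ≠ 0 :=
        Finset.prod_ne_zero_iff.2 fun j _ => by simpa using hne 0 h0 j
      have hp2 : ∏ j ∈ Finset.range (n + 1), (s + z + (j : ℂ)) ≠ 0 :=
        Finset.prod_ne_zero_iff.2 fun j _ => hne z hz j
      rw [Complex.exp_sum, hprod, hharm, Complex.exp_add, Complex.exp_add, Complex.GammaSeq,
        Complex.GammaSeq, Complex.cpow_add _ _ hn0, Complex.cpow_def_of_ne_zero hn0 z,
        mul_comm (Complex.log _) z]
      have hcp : (n : ℂ) ^ s ≠ 0 := by simp [Complex.cpow_eq_zero_iff, hn0]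
      field_simp
    have hlim1 : Tendsto (fun n : ℕ => Complex.exp (∑ j ∈ Finset.range (n + 1), g j z)) atTop
        (𝓝 (Complex.exp (∑' j, g j z))) :=
      (Complex.continuous_exp.tendsto _).comp
        (((hsum z hz).hasSum.tendsto_sum_nat).comp (tendsto_add_atTop_nat 1))
    have hlim2 : Tendsto (fun n : ℕ => Complex.exp (z * (((harmonic n : ℝ) - Real.log n : ℝ) : ℂ)) *
          Complex.exp (z / ((n : ℂ) + 1)) *
          (Complex.GammaSeq (s + z) n / Complex.GammaSeq s n)) atTop
        (𝓝 (Complex.exp (z * Real.eulerMascheroniConstant) * Complex.exp 0 *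
          (Complex.Gamma (s + z) / Complex.Gamma s))) := by
      refine Tendsto.mul (Tendsto.mul ?_ ?_) ?_
      · refine (Complex.continuous_exp.tendsto _).comp (Tendsto.const_mul z ?_)
        exact (Complex.continuous_ofReal.tendsto _).comp Real.tendsto_harmonic_sub_log
      · refine (Complex.continuous_exp.tendsto _).comp ?_
        have := (tendsto_one_div_add_atTop_nhds_zero_nat (𝕜 := ℂ)).const_mul z
        simpa [div_eq_mul_inv] using this
      · exact (Complex.GammaSeq_tendsto_Gamma _).div (Complex.GammaSeq_tendsto_Gamma _) hGs
    have := tendsto_nhds_unique_of_eventuallyEq hlim1 hlim2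
      ((eventually_ne_atTop 0).mono fun n hn => hfin n hn)
    rw [this, Complex.exp_zero, mul_one, mul_div_assoc]
  have hL := hF.cexp
  have hGd : HasDerivAt (fun z => Complex.Gamma (s + z)) (deriv Complex.Gamma s) 0 := by
    have : HasDerivAt Complex.Gamma (deriv Complex.Gamma (s + 0)) (s + 0) := by
      refine (Complex.differentiableAt_Gamma _ fun m h => ?_).hasDerivAt
      have : 0 < (s + 0).re := by simpa using hs
      rw [h] at this
      simp at this
      have h' : (0 : ℝ) ≤ m := m.cast_nonneg
      linarith
    simpa using this.comp_const_add s 0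
  have hE : HasDerivAt (fun z : ℂ => Complex.exp (z * Real.eulerMascheroniConstant))
      (Real.eulerMascheroniConstant : ℂ) 0 := by
    simpa using ((hasDerivAt_id (0 : ℂ)).mul_const (Real.eulerMascheroniConstant : ℂ)).cexp
  have hR := (hE.mul hGd).div_const (Complex.Gamma s)
  have hev : (fun z => Complex.exp (∑' j, g j z)) =ᶠ[𝓝 0]
      (fun z => Complex.exp (z * Real.eulerMascheroniConstant) * Complex.Gamma (s + z) /
        Complex.Gamma s) := by
    filter_upwards [Metric.ball_mem_nhds (0 : ℂ) hδ0] with z hz using hkey z hz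
  have huniq := hL.unique (hR.congr_of_eventuallyEq hev)
  have hval : ∑' j, g' j 0 = Complex.digamma s + Real.eulerMascheroniConstant := by
    simp only [hg0, tsum_zero, Complex.exp_zero, one_mul, zero_mul, add_zero] at huniq
    rw [huniq, Complex.digamma_def, logDeriv_apply]
    field_simp
    ring
  have := hsumd.hasSum
  rw [hval] at this
  simpa [hg'] using this

theorem le_artanh_log {x : ℝ} (h0 : 0 ≤ x) (h1 : x < 1) :
    x ≤ (Real.log (1 + x) - Real.log (1 - x)) / 2 := by
  have h := Real.hasSum_log_sub_log_of_abs_lt_one (x := x) (by rw [abs_of_nonneg h0]; exact h1)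
  have := le_hasSum h 0 fun j _ => by positivity
  simp at this
  linarith

theorem artanh_log_le {x : ℝ} (h0 : 0 ≤ x) (h1 : x < 1) :
    (Real.log (1 + x) - Real.log (1 - x)) / 2 ≤ x + x ^ 3 / (3 * (1 - x ^ 2)) := by
  have h := Real.hasSum_log_sub_log_of_abs_lt_one (x := x) (by rw [abs_of_nonneg h0]; exact h1)
  have h2 : x ^ 2 < 1 := by nlinarith
  have hg := ((hasSum_geometric_of_lt_one (sq_nonneg x) h2).mul_left (x ^ 3 / 3)).mul_left 2
  have hs := (hasSum_nat_add_iff' 1).2 h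
  have := hasSum_le (fun k => ?_) hs hg
  · simp at this
    have e : x ^ 3 / 3 * (1 - x ^ 2)⁻¹ = x ^ 3 / (3 * (1 - x ^ 2)) := by
      rw [← div_eq_mul_inv, div_div]
    linarith
  · have e : x ^ (2 * (k + 1) + 1) = x ^ 3 * (x ^ 2) ^ k := by ring
    rw [e]
    have h3 : (1 : ℝ) / (2 * ((k + 1 : ℕ) : ℝ) + 1) ≤ 1 / 3 := by
      apply one_div_le_one_div_of_le (by norm_num)
      push_cast
      have : (0 : ℝ) ≤ k := k.cast_nonneg
      linarith
    calc 2 * (1 / (2 * ((k + 1 : ℕ) : ℝ) + 1)) * (x ^ 3 * (x ^ 2) ^ k)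
        ≤ 2 * (1 / 3) * (x ^ 3 * (x ^ 2) ^ k) := by gcongr
      _ = _ := by ring

/-- The real part of the digamma function on the line `re s = 1/4`. -/
theorem hasSum_digamma_re (y : ℝ) :
    HasSum (fun j : ℕ => 1 / ((j : ℝ) + 1) - (1 / 4 + j) / ((1 / 4 + j) ^ 2 + y ^ 2))
      ((Complex.digamma (1 / 4 + Complex.I * y)).re + Real.eulerMascheroniConstant) := by
  have h := Complex.hasSum_re (hasSum_digamma (s := 1 / 4 + Complex.I * y) (by simp))
  simp only [Complex.add_re, Complex.ofReal_re] at h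
  convert h using 2 with j
  rw [Complex.sub_re]
  congr 1
  · have : (1 : ℂ) / ((j : ℂ) + 1) = ((1 / ((j : ℝ) + 1) : ℝ) : ℂ) := by push_cast; rfl
    rw [this, Complex.ofReal_re]
  · rw [one_div (1 / 4 + Complex.I * (y : ℂ) + j), Complex.inv_re, Complex.normSq_apply]
    simp [sq]

theorem hasSum_digamma_im (y : ℝ) :
    HasSum (fun j : ℕ => y / ((1 / 4 + j) ^ 2 + y ^ 2))
      (Complex.digamma (1 / 4 + Complex.I * y)).im := by
  have h := Complex.hasSum_im (hasSum_digamma (s := 1 / 4 + Complex.I * y) (by simp))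
  simp only [Complex.add_im, Complex.ofReal_im, add_zero] at h
  convert h using 2 with j
  rw [Complex.sub_im]
  have h1 : ((1 : ℂ) / ((j : ℂ) + 1)).im = 0 := by
    have : (1 : ℂ) / ((j : ℂ) + 1) = ((1 / ((j : ℝ) + 1) : ℝ) : ℂ) := by push_cast; rfl
    rw [this, Complex.ofReal_im]
  rw [h1, one_div (1 / 4 + Complex.I * (y : ℂ) + j), Complex.inv_im, Complex.normSq_apply]
  simp [sq, neg_div]

open Filter Topology in
theorem tendsto_half_log_sub_log (q : ℝ) :
    Tendsto (fun N : ℕ => Real.log ((1 / 4 + N) ^ 2 - (1 / 4 + N) + q) / 2 - Real.log N) atTop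
      (𝓝 0) := by
  have h1 : Tendsto (fun N : ℕ => ((1 / 4 + (N : ℝ)) ^ 2 - (1 / 4 + N) + q) / (N : ℝ) ^ 2) atTop
      (𝓝 1) := by
    have hi : Tendsto (fun N : ℕ => ((N : ℝ))⁻¹) atTop (𝓝 0) := tendsto_inv_atTop_nhds_zero_nat
    have h2 : Tendsto (fun N : ℕ => 1 + (-1 / 2) * ((N : ℝ))⁻¹ + (-3 / 16 + q) * (((N : ℝ))⁻¹) ^ 2)
        atTop (𝓝 (1 + (-1 / 2) * 0 + (-3 / 16 + q) * 0 ^ 2)) :=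
      (tendsto_const_nhds.add (hi.const_mul _)).add ((hi.pow 2).const_mul _)
    simp only [mul_zero, add_zero, ne_eq, OfNat.ofNat_ne_zero, not_false_eq_true, zero_pow] at h2
    refine h2.congr' ?_
    filter_upwards [eventually_ne_atTop 0] with N hN
    have : (N : ℝ) ≠ 0 := by exact_mod_cast hN
    field_simp
    ring
  have h3 : Tendsto (fun N : ℕ => Real.log (((1 / 4 + (N : ℝ)) ^ 2 - (1 / 4 + N) + q) /
      (N : ℝ) ^ 2) / 2) atTop (𝓝 0) := by
    have := ((Real.continuousAt_log one_ne_zero).tendsto.comp h1).div_const 2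
    simpa using this
  refine h3.congr' ?_
  filter_upwards [eventually_ne_atTop 0, h1.eventually (lt_mem_nhds (zero_lt_one))] with N hN hp
  have hN' : (N : ℝ) ^ 2 ≠ 0 := by positivity
  rw [Real.log_div (fun h => by rw [h, zero_div] at hp; exact lt_irrefl _ hp) hN', Real.log_pow]
  push_cast
  ring

open Filter Topology in
theorem tendsto_sum_sub_log (y : ℝ) :
    Tendsto (fun N : ℕ => Real.log N -
      ∑ j ∈ Finset.range N, (1 / 4 + (j : ℝ)) / ((1 / 4 + j) ^ 2 + y ^ 2)) atTop
      (𝓝 (Complex.digamma (1 / 4 + Complex.I * y)).re) := by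
  have h := (hasSum_digamma_re y).tendsto_sum_nat.sub Real.tendsto_harmonic_sub_log
  rw [add_sub_cancel_right] at h
  refine h.congr fun N => ?_
  rw [Finset.sum_sub_distrib]
  have : ((harmonic N : ℚ) : ℝ) = ∑ j ∈ Finset.range N, 1 / ((j : ℝ) + 1) := by
    simp [harmonic]
  rw [this]
  ring

/-- With P(x) = x² - x + q and w = x/(x² + q), one has 1 + w = P(x+1)/(x² + q) and 1 - w = P(x)/(x²
+ q). So artanh w is a telescoping difference of log P / 2. -/
theorem quadratic_log_sub {x q : ℝ} (hx : 0 < x) (hq : 1 / 4 < q) :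
    0 < x / (x ^ 2 + q) ∧ x / (x ^ 2 + q) < 1 ∧
    (Real.log (1 + x / (x ^ 2 + q)) - Real.log (1 - x / (x ^ 2 + q))) / 2 =
      Real.log ((x + 1) ^ 2 - (x + 1) + q) / 2 - Real.log (x ^ 2 - x + q) / 2 := by
  have h1 : 0 < x ^ 2 + q := by positivity
  have h2 : 0 < x ^ 2 - x + q := by nlinarith [sq_nonneg (x - 1 / 2)]
  have h3 : x / (x ^ 2 + q) < 1 := by rw [div_lt_one h1]; linarith
  refine ⟨by positivity, h3, ?_⟩
  have e1 : 1 + x / (x ^ 2 + q) = ((x + 1) ^ 2 - (x + 1) + q) / (x ^ 2 + q) := by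
    field_simp; ring
  have e2 : 1 - x / (x ^ 2 + q) = (x ^ 2 - x + q) / (x ^ 2 + q) := by
    field_simp; ring
  have h4 : 0 < (x + 1) ^ 2 - (x + 1) + q := by nlinarith
  rw [e1, e2, Real.log_div h4.ne' h1.ne', Real.log_div h2.ne' h1.ne']
  ring

open Filter Topology in
-- Take q = y² in `quadratic_log_sub`: each term of the sum is w ≤ artanh w, and the sum telescopes
-- down to P(1/4) = y² - 3/16.
theorem log_le_digamma_re {y : ℝ} (hy : 1 / 4 < y ^ 2) :
    Real.log (y ^ 2 - 3 / 16) / 2 ≤ (Complex.digamma (1 / 4 + Complex.I * y)).re := by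
  have h := (tendsto_sum_sub_log y).add (tendsto_half_log_sub_log (y ^ 2))
  rw [add_zero] at h
  refine ge_of_tendsto' h fun N => ?_
  have hs : ∑ j ∈ Finset.range N, (1 / 4 + (j : ℝ)) / ((1 / 4 + j) ^ 2 + y ^ 2) ≤
      ∑ j ∈ Finset.range N, (Real.log ((1 / 4 + ((j + 1 : ℕ) : ℝ)) ^ 2 -
        (1 / 4 + ((j + 1 : ℕ) : ℝ)) + y ^ 2) / 2 -
        Real.log ((1 / 4 + (j : ℝ)) ^ 2 - (1 / 4 + j) + y ^ 2) / 2) := by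
    refine Finset.sum_le_sum fun j _ => ?_
    obtain ⟨h0, h1, h2⟩ := quadratic_log_sub (x := 1 / 4 + (j : ℝ)) (by positivity) hy
    refine (le_artanh_log h0.le h1).trans (le_of_eq ?_)
    rw [h2]
    push_cast
    ring_nf
  rw [Finset.sum_range_sub (fun j : ℕ => Real.log ((1 / 4 + (j : ℝ)) ^ 2 - (1 / 4 + j) + y ^ 2) / 2)]
    at hs
  have e : Real.log ((1 / 4 + ((0 : ℕ) : ℝ)) ^ 2 - (1 / 4 + ((0 : ℕ) : ℝ)) + y ^ 2) =
      Real.log (y ^ 2 - 3 / 16) := by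
    congr 1; push_cast; ring
  rw [e] at hs
  linarith

open Filter Topology in
-- Here q = y² + 1/3: the shift by 1/3 lowers w just enough to absorb the cubic error of artanh, so
-- artanh w is at most the term with y². The telescoped value is P(1/4) = y² + 7/48.
theorem digamma_re_le_log {y : ℝ} (hy : 1 / 3 ≤ y ^ 2) :
    (Complex.digamma (1 / 4 + Complex.I * y)).re ≤ Real.log (y ^ 2 + 7 / 48) / 2 := by
  have h := (tendsto_sum_sub_log y).add (tendsto_half_log_sub_log (y ^ 2 + 1 / 3))
  rw [add_zero] at h
  refine le_of_tendsto' h fun N => ?_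
  have hs : ∑ j ∈ Finset.range N, (Real.log ((1 / 4 + ((j + 1 : ℕ) : ℝ)) ^ 2 -
        (1 / 4 + ((j + 1 : ℕ) : ℝ)) + (y ^ 2 + 1 / 3)) / 2 -
        Real.log ((1 / 4 + (j : ℝ)) ^ 2 - (1 / 4 + j) + (y ^ 2 + 1 / 3)) / 2) ≤
      ∑ j ∈ Finset.range N, (1 / 4 + (j : ℝ)) / ((1 / 4 + j) ^ 2 + y ^ 2) := by
    refine Finset.sum_le_sum fun j _ => ?_
    have hx : 0 < 1 / 4 + (j : ℝ) := by positivity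
    set x := 1 / 4 + (j : ℝ)
    obtain ⟨h0, h1, h2⟩ := quadratic_log_sub hx (show 1 / 4 < y ^ 2 + 1 / 3 by linarith)
    have h3 := artanh_log_le h0.le h1
    rw [h2] at h3
    have e : (1 / 4 + ((j + 1 : ℕ) : ℝ)) = x + 1 := by simp only [x]; push_cast; ring
    rw [e]
    refine h3.trans ?_
    have hA : 0 < x ^ 2 + y ^ 2 := by positivity
    have hB : 0 < x ^ 2 + (y ^ 2 + 1 / 3) := by positivity
    have hC : 0 < (x ^ 2 + (y ^ 2 + 1 / 3)) ^ 2 - x ^ 2 := by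
      nlinarith [sq_nonneg (x - 1 / 2), sq_nonneg (x + 1 / 2)]
    have e1 : (x / (x ^ 2 + (y ^ 2 + 1 / 3))) ^ 3 / (3 * (1 - (x / (x ^ 2 + (y ^ 2 + 1 / 3))) ^ 2)) =
        x ^ 3 / (3 * (x ^ 2 + (y ^ 2 + 1 / 3)) * ((x ^ 2 + (y ^ 2 + 1 / 3)) ^ 2 - x ^ 2)) := by
      field_simp
    have e2 : x / (x ^ 2 + y ^ 2) - x / (x ^ 2 + (y ^ 2 + 1 / 3)) =
        x / (3 * (x ^ 2 + (y ^ 2 + 1 / 3)) * (x ^ 2 + y ^ 2)) := by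
      field_simp; ring
    rw [e1]
    have : x ^ 3 / (3 * (x ^ 2 + (y ^ 2 + 1 / 3)) * ((x ^ 2 + (y ^ 2 + 1 / 3)) ^ 2 - x ^ 2)) ≤
        x / (3 * (x ^ 2 + (y ^ 2 + 1 / 3)) * (x ^ 2 + y ^ 2)) := by
      rw [div_le_div_iff₀ (by positivity) (by positivity)]
      have hk : x ^ 2 * (x ^ 2 + y ^ 2) ≤ (x ^ 2 + (y ^ 2 + 1 / 3)) ^ 2 - x ^ 2 := by
        nlinarith [mul_nonneg (sq_nonneg x) (sub_nonneg.2 hy), sq_nonneg (y ^ 2 + 1 / 3)]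
      calc _ = x * (3 * (x ^ 2 + (y ^ 2 + 1 / 3))) * (x ^ 2 * (x ^ 2 + y ^ 2)) := by ring
        _ ≤ x * (3 * (x ^ 2 + (y ^ 2 + 1 / 3))) * ((x ^ 2 + (y ^ 2 + 1 / 3)) ^ 2 - x ^ 2) := by
          gcongr
        _ = _ := by ring
    linarith
  rw [Finset.sum_range_sub
    (fun j : ℕ => Real.log ((1 / 4 + (j : ℝ)) ^ 2 - (1 / 4 + j) + (y ^ 2 + 1 / 3)) / 2)] at hs
  have e : Real.log ((1 / 4 + ((0 : ℕ) : ℝ)) ^ 2 - (1 / 4 + ((0 : ℕ) : ℝ)) + (y ^ 2 + 1 / 3)) =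
      Real.log (y ^ 2 + 7 / 48) := by
    congr 1; push_cast; ring
  rw [e] at hs
  linarith

theorem digamma_re_strictMono {y z : ℝ} (hy : 0 ≤ y) (hyz : y < z) :
    (Complex.digamma (1 / 4 + Complex.I * y)).re < (Complex.digamma (1 / 4 + Complex.I * z)).re := by
  have hsq : y ^ 2 < z ^ 2 := by gcongr
  have key : ∀ j : ℕ, (1 / 4 + (j : ℝ)) / ((1 / 4 + j) ^ 2 + z ^ 2) <
      (1 / 4 + (j : ℝ)) / ((1 / 4 + j) ^ 2 + y ^ 2) := fun j => by gcongr
  have := hasSum_lt (fun j => sub_le_sub_left (key j).le _) (sub_lt_sub_left (key 0) _)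
    (hasSum_digamma_re y) (hasSum_digamma_re z)
  linarith

theorem div_one_add_sq_le_arctan {z : ℝ} (hz : 0 ≤ z) : z / (1 + z ^ 2) ≤ Real.arctan z := by
  have h1 : Real.sin (Real.arctan z) ≤ Real.arctan z := Real.sin_le (Real.arctan_nonneg.2 hz)
  have h2 : 1 ≤ Real.sqrt (1 + z ^ 2) := Real.one_le_sqrt.2 (by nlinarith)
  rw [Real.sin_arctan] at h1
  refine le_trans ?_ h1
  gcongr
  exact Real.sqrt_le_iff.2 ⟨by positivity, by nlinarith [sq_nonneg z]⟩

theorem arctan_le_self_of_nonneg {z : ℝ} (hz : 0 ≤ z) : Real.arctan z ≤ z := by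
  have := Real.le_tan (Real.arctan_nonneg.2 hz) (Real.arctan_lt_pi_div_two z)
  rwa [Real.tan_arctan] at this

open Filter Topology in
-- The choice r² = y² + 1/4 makes arctan((j + 3/4)/r) - arctan((j - 1/4)/r) equal to arctan(r/((j +
-- 1/4)² + y²)). So arctan z ≤ z bounds a telescoping sum by the series for Im ψ.
theorem arctan_le_digamma_im {y r : ℝ} (hy : 0 < y) (hr : 0 < r) (hyr : r ^ 2 = y ^ 2 + 1 / 4) :
    y / r * (Real.pi / 2 + Real.arctan (1 / (4 * r))) ≤
      (Complex.digamma (1 / 4 + Complex.I * y)).im := by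
  have hlim : Tendsto (fun N : ℕ => y / r * (Real.arctan ((N - 1 / 4) / r) -
      Real.arctan (-1 / 4 / r))) atTop
      (𝓝 (y / r * (Real.pi / 2 - Real.arctan (-1 / 4 / r)))) := by
    refine ((Tendsto.sub ?_ tendsto_const_nhds)).const_mul _
    refine (tendsto_nhds_of_tendsto_nhdsWithin Real.tendsto_arctan_atTop).comp ?_
    exact (tendsto_atTop_add_const_right _ (-(1 / 4)) tendsto_natCast_atTop_atTop).atTop_div_const hr
  have e : Real.arctan (-1 / 4 / r) = -Real.arctan (1 / (4 * r)) := by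
    rw [← Real.arctan_neg]; congr 1; field_simp
  rw [e] at hlim
  simp only [sub_neg_eq_add] at hlim
  refine le_of_tendsto_of_tendsto' hlim (hasSum_digamma_im y).tendsto_sum_nat fun N => ?_
  have hs : ∑ j ∈ Finset.range N, y / r * (Real.arctan ((((j + 1 : ℕ) : ℝ) - 1 / 4) / r) -
      Real.arctan (((j : ℝ) - 1 / 4) / r)) ≤
      ∑ j ∈ Finset.range N, y / ((1 / 4 + (j : ℝ)) ^ 2 + y ^ 2) := by
    refine Finset.sum_le_sum fun j _ => ?_
    set b := ((j : ℝ) - 1 / 4) / r with hb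
    set a := (((j + 1 : ℕ) : ℝ) - 1 / 4) / r with ha
    have hD : 0 < (1 / 4 + (j : ℝ)) ^ 2 + y ^ 2 := by positivity
    have hab : 1 + a * b = ((1 / 4 + (j : ℝ)) ^ 2 + y ^ 2) / r ^ 2 := by
      have : y ^ 2 = r ^ 2 - 1 / 4 := by linarith
      rw [this, ha, hb]; push_cast; field_simp; ring
    have hpos : 0 < 1 + a * b := by rw [hab]; positivity
    have h1 : Real.arctan a - Real.arctan b = Real.arctan ((a + -b) / (1 - a * -b)) := by
      rw [← Real.arctan_add (by linarith), Real.arctan_neg]; ring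
    have h2 : (a + -b) / (1 - a * -b) = r / ((1 / 4 + (j : ℝ)) ^ 2 + y ^ 2) := by
      have h3 : a + -b = 1 / r := by rw [ha, hb]; push_cast; field_simp; ring
      have h4 : 1 - a * -b = 1 + a * b := by ring
      rw [h3, h4, hab]; field_simp
    rw [h1, h2]
    calc y / r * Real.arctan (r / ((1 / 4 + (j : ℝ)) ^ 2 + y ^ 2))
        ≤ y / r * (r / ((1 / 4 + (j : ℝ)) ^ 2 + y ^ 2)) := by
          gcongr
          exact arctan_le_self_of_nonneg (by positivity)
      _ = _ := by field_simp
  rw [← Finset.mul_sum, Finset.sum_range_sub (fun j : ℕ => Real.arctan (((j : ℝ) - 1 / 4) / r))] at hs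
  refine le_trans (le_of_eq ?_) hs
  rw [show ((0 : ℕ) : ℝ) - 1 / 4 = -1 / 4 by norm_num, e, sub_neg_eq_add]

/-! ### The derivative of ϑ and its positive zero. -/

theorem analyticAt_digamma {s : ℂ} (hs : 0 < s.re) : AnalyticAt ℂ Complex.digamma s := by
  have hopen : IsOpen {s : ℂ | 0 < s.re} := isOpen_lt continuous_const Complex.continuous_re
  have hG : AnalyticAt ℂ Complex.Gamma s := by
    refine DifferentiableOn.analyticAt (s := {s : ℂ | 0 < s.re}) (fun z hz => ?_) (hopen.mem_nhds hs)
    refine (Complex.differentiableAt_Gamma z fun m h => ?_).differentiableWithinAt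
    have hz' : 0 < z.re := hz
    rw [h] at hz'
    simp at hz'
    have : (0 : ℝ) ≤ m := m.cast_nonneg
    linarith
  exact hG.deriv.div hG (Complex.Gamma_ne_zero_of_re_pos hs)

theorem analyticAt_digamma_line (t : ℝ) :
    AnalyticAt ℝ (fun x : ℝ => (Complex.digamma (1 / 4 + Complex.I * ((x : ℂ) / 2))).re) t := by
  have h1 : AnalyticAt ℝ (fun x : ℝ => (1 / 4 + Complex.I * ((x : ℂ) / 2) : ℂ)) t := by
    have : AnalyticAt ℝ (fun x : ℝ => (x : ℂ)) t := Complex.ofRealCLM.analyticAt t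
    fun_prop
  have h2 : AnalyticAt ℝ Complex.digamma (1 / 4 + Complex.I * ((t : ℂ) / 2)) :=
    (analyticAt_digamma (by simp)).restrictScalars
  exact (Complex.reCLM.analyticAt _).comp
    (h2.comp (f := fun x : ℝ => (1 / 4 + Complex.I * ((x : ℂ) / 2) : ℂ)) h1)

theorem hasDerivAt_rsTheta (t : ℝ) :
    HasDerivAt rsTheta (-(Real.log Real.pi / 2) +
      (Complex.digamma (1 / 4 + Complex.I * ((t : ℂ) / 2))).re / 2) t := by
  have hc : Continuous (fun x : ℝ => (Complex.digamma (1 / 4 + Complex.I * ((x : ℂ) / 2))).re) :=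
    continuous_iff_continuousAt.2 fun t => (analyticAt_digamma_line t).continuousAt
  have h := intervalIntegral.integral_hasDerivAt_right (hc.intervalIntegrable 0 t)
      (hc.stronglyMeasurableAtFilter _ _) hc.continuousAt
  have h2 := (((hasDerivAt_id t).div_const 2).neg.mul_const (Real.log Real.pi)).add
    (h.const_mul (1 / 2))
  refine (h2.congr_deriv ?_)
  ring

theorem deriv_rsTheta (t : ℝ) :
    deriv rsTheta t = (Complex.digamma (1 / 4 + Complex.I * ((t / 2 : ℝ) : ℂ))).re / 2 -
      Real.log Real.pi / 2 := by
  rw [(hasDerivAt_rsTheta t).deriv]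
  push_cast
  ring

theorem analyticAt_deriv_rsTheta (t : ℝ) : AnalyticAt ℝ (deriv rsTheta) t := by
  have : deriv rsTheta = fun t : ℝ => -(Real.log Real.pi / 2) +
      (Complex.digamma (1 / 4 + Complex.I * ((t : ℂ) / 2))).re / 2 := by
    funext t; exact (hasDerivAt_rsTheta t).deriv
  rw [this]
  exact analyticAt_const.add ((analyticAt_digamma_line t).div analyticAt_const two_ne_zero)

theorem deriv_rsTheta_neg (t : ℝ) : deriv rsTheta (-t) = deriv rsTheta t := by
  rw [deriv_rsTheta, deriv_rsTheta]
  have h1 := hasSum_digamma_re (-t / 2)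
  have h2 := hasSum_digamma_re (t / 2)
  have : (-t / 2) ^ 2 = (t / 2) ^ 2 := by ring
  rw [this] at h1
  have := h1.unique h2
  linarith

theorem deriv_rsTheta_lt {t u : ℝ} (ht : 0 ≤ t) (htu : t < u) :
    deriv rsTheta t < deriv rsTheta u := by
  rw [deriv_rsTheta, deriv_rsTheta]
  have := digamma_re_strictMono (y := t / 2) (z := u / 2) (by linarith) (by linarith)
  linarith

/-- The sign of ϑ'(t) is that of Re ψ - log(π²)/2, so the logarithmic bounds for Re ψ reduce it to
comparing (t/2)² + 7/48, or (t/2)² - 3/16 at the upper end, with π². -/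
theorem deriv_rsTheta_neg_at_lower : deriv rsTheta 6.236 < 0 := by
  rw [deriv_rsTheta]
  have h := digamma_re_le_log (y := (6.236 / 2 : ℝ)) (by norm_num)
  have h2 : Real.log ((6.236 / 2 : ℝ) ^ 2 + 7 / 48) < Real.log (Real.pi ^ 2) := by
    apply Real.log_lt_log (by norm_num)
    nlinarith [Real.pi_gt_d6]
  rw [Real.log_pow] at h2
  push_cast at h2
  linarith

theorem deriv_rsTheta_pos_at_upper : 0 < deriv rsTheta 6.344 := by
  rw [deriv_rsTheta]
  have h := log_le_digamma_re (y := (6.344 / 2 : ℝ)) (by norm_num)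
  have h2 : Real.log (Real.pi ^ 2) < Real.log ((6.344 / 2 : ℝ) ^ 2 - 3 / 16) := by
    apply Real.log_lt_log (by positivity)
    nlinarith [Real.pi_lt_d6, Real.pi_pos]
  rw [Real.log_pow] at h2
  push_cast at h2
  linarith

theorem IsThetaCritical.deriv_neg {a t : ℝ} (ha : IsThetaCritical a) (h : |t| < a) :
    deriv rsTheta t < 0 := by
  have : deriv rsTheta |t| < 0 := ha.2 ▸ deriv_rsTheta_lt (abs_nonneg t) h
  rcases abs_choice t with e | e <;> rw [e] at this
  · exact this
  · rwa [deriv_rsTheta_neg] at this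

theorem IsThetaCritical.deriv_pos {a t : ℝ} (ha : IsThetaCritical a) (h : a < |t|) :
    0 < deriv rsTheta t := by
  have : 0 < deriv rsTheta |t| := ha.2 ▸ deriv_rsTheta_lt ha.1.le h
  rcases abs_choice t with e | e <;> rw [e] at this
  · exact this
  · rwa [deriv_rsTheta_neg] at this

theorem IsThetaCritical.abs_eq {a t : ℝ} (ha : IsThetaCritical a) (h : deriv rsTheta t = 0) :
    |t| = a := by
  rcases lt_trichotomy |t| a with h1 | h1 | h1
  · exact absurd h (ha.deriv_neg h1).ne
  · exact h1
  · exact absurd h (ha.deriv_pos h1).ne'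

theorem IsThetaCritical.bounds {a : ℝ} (ha : IsThetaCritical a) : 6.236 < a ∧ a < 6.344 := by
  constructor
  · by_contra! h
    rcases h.lt_or_eq with h | h
    · have := ha.deriv_pos (t := 6.236) (by rw [abs_of_pos (by norm_num)]; exact h)
      linarith [deriv_rsTheta_neg_at_lower]
    · have := ha.2
      rw [h] at this
      linarith [deriv_rsTheta_neg_at_lower]
  · by_contra! h
    rcases h.lt_or_eq with h | h
    · have := ha.deriv_neg (t := 6.344) (by rw [abs_of_pos (by norm_num)]; exact h)
      linarith [deriv_rsTheta_pos_at_upper]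
    · have := ha.2
      rw [← h] at this
      linarith [deriv_rsTheta_pos_at_upper]

theorem existsUnique_isThetaCritical : ∃! a : ℝ, IsThetaCritical a := by
  have hc : Continuous (deriv rsTheta) :=
    continuous_iff_continuousAt.2 fun t => (analyticAt_deriv_rsTheta t).continuousAt
  obtain ⟨a, ha, h0⟩ := intermediate_value_Icc (show (6.236 : ℝ) ≤ 6.344 by norm_num) hc.continuousOn
    ⟨deriv_rsTheta_neg_at_lower.le, deriv_rsTheta_pos_at_upper.le⟩
  have hpos : 0 < a := lt_of_lt_of_le (by norm_num) ha.1
  refine ⟨a, ⟨hpos, h0⟩, fun b hb => ?_⟩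
  have := IsThetaCritical.abs_eq ⟨hpos, h0⟩ hb.2
  rwa [abs_of_pos hb.1] at this

/-- A lower bound for the logarithmic derivative of `|Γ(1/4 + it/2)|⁻¹` near the critical point of
`ϑ`. -/
theorem digamma_im_lower {t : ℝ} (h1 : 6.236 ≤ t) (h2 : t ≤ 6.344) :
    1.626 ≤ (Complex.digamma (1 / 4 + Complex.I * ((t / 2 : ℝ) : ℂ))).im := by
  set y := t / 2 with hy
  set r := Real.sqrt (y ^ 2 + 1 / 4) with hr
  have hy1 : 3.118 ≤ y := by rw [hy]; norm_num at h1 ⊢; linarith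
  have hy2 : y ≤ 3.172 := by rw [hy]; norm_num at h2 ⊢; linarith
  have hr0 : 0 < r := Real.sqrt_pos.2 (by positivity)
  have hsq : r ^ 2 = y ^ 2 + 1 / 4 := Real.sq_sqrt (by positivity)
  have h := arctan_le_digamma_im (by linarith : 0 < y) hr0 hsq
  refine le_trans ?_ h
  have hyr : 0.9873 ≤ y / r := by
    rw [le_div_iff₀ hr0]
    refine abs_le_of_sq_le_sq' ?_ (by linarith) |>.2
    rw [mul_pow, hsq]
    nlinarith
  have hr2 : r ≤ 3.2113 := by
    refine abs_le_of_sq_le_sq' ?_ (by norm_num) |>.2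
    rw [hsq]; nlinarith
  have hz0 : 0.0778 ≤ 1 / (4 * r) := by
    rw [le_div_iff₀ (by positivity)]; linarith
  have hz : 0.0773 ≤ Real.arctan (1 / (4 * r)) := by
    have h3 := div_one_add_sq_le_arctan (z := (0.0778 : ℝ)) (by norm_num)
    have h4 := Real.arctan_le_arctan_iff.2 hz0
    refine le_trans ?_ (h3.trans h4)
    norm_num
  have hp := Real.pi_gt_d6
  calc (1.626 : ℝ) ≤ 0.9873 * (3.141592 / 2 + 0.0773) := by norm_num
    _ ≤ _ := by gcongr

/-! ### The completed zeta function on the critical line as a real cosine integral. -/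

open HurwitzZeta in
theorem evenKernel_zero_eq_jacobiTheta (x : ℝ) :
    (evenKernel 0 x : ℂ) = jacobiTheta (Complex.I * x) := by
  have := evenKernel_def 0 x
  rw [jacobiTheta_eq_jacobiTheta₂]
  simpa using this

open HurwitzZeta in
theorem hasSum_evenKernel_zero {x : ℝ} (hx : 0 < x) :
    HasSum (fun n : ℕ => Real.exp (-Real.pi * ((n : ℝ) + 1) ^ 2 * x)) ((evenKernel 0 x - 1) / 2) := by
  have h := hasSum_nat_jacobiTheta (τ := Complex.I * x) (by simpa using hx)
  rw [← evenKernel_zero_eq_jacobiTheta] at h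
  rw [← Complex.hasSum_ofReal]
  push_cast
  refine h.congr_fun fun n => ?_
  congr 1
  linear_combination (-(Real.pi * ((n : ℂ) + 1) ^ 2 * x)) * Complex.I_mul_I

open HurwitzZeta in
theorem evenKernel_zero_sub_one_bounds {x : ℝ} (hx : 1 ≤ x) :
    2 * Real.exp (-Real.pi * x) ≤ evenKernel 0 x - 1 ∧
    evenKernel 0 x - 1 ≤ 2 * Real.exp (-Real.pi * x) + 4 * Real.exp (-(4 * Real.pi * x)) := by
  have hx0 : 0 < x := by linarith
  have h := hasSum_evenKernel_zero hx0
  constructor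
  · have := le_hasSum h 0 fun j _ => (Real.exp_pos _).le
    simp at this
    rw [neg_mul]
    linarith
  · have h1 := (hasSum_nat_add_iff' 1).2 h
    -- Since (n + 2)² ≥ 4 + 5n, the terms after the first are dominated by a geometric series with
    -- this ratio, which is at most 1/2.
    set z := Real.exp (-(5 * Real.pi * x)) with hz
    have hz1 : z ≤ 1 / 2 := by
      rw [hz, Real.exp_neg]
      have : 2 ≤ Real.exp (5 * Real.pi * x) := by
        have := Real.add_one_le_exp (5 * Real.pi * x)
        nlinarith [Real.pi_gt_three]
      rw [one_div]
      exact inv_anti₀ (by norm_num) this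
    have hz0 : 0 < z := Real.exp_pos _
    have hg := (hasSum_geometric_of_lt_one hz0.le (by linarith)).mul_left
      (Real.exp (-(4 * Real.pi * x)))
    have := hasSum_le (fun n => ?_) h1 hg
    · simp only [Finset.range_one, Finset.sum_singleton, Nat.cast_zero, zero_add, one_pow,
        mul_one] at this
      have h2 : (1 - z)⁻¹ ≤ 2 := by
        rw [inv_le_comm₀ (by linarith) (by norm_num)]; linarith
      have h3 := mul_le_mul_of_nonneg_left h2 (Real.exp_pos (-(4 * Real.pi * x))).le
      linarith
    · rw [hz, ← Real.exp_nat_mul, ← Real.exp_add]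
      apply Real.exp_le_exp.2
      push_cast
      have hn : (0 : ℝ) ≤ n := n.cast_nonneg
      have hn2 : (n : ℝ) ≤ (n : ℝ) ^ 2 := by
        have : (n : ℕ) ≤ n ^ 2 := Nat.le_self_pow (by norm_num) n
        exact_mod_cast this
      have hp : 0 < Real.pi * x := by positivity
      nlinarith

/-- The kernel `exp (L/4) (θ(exp L) - 1)` whose cosine transform is the entire part of the completed
zeta function on the critical line. -/
noncomputable def critKernel (L : ℝ) : ℝ :=
  Real.exp (L / 4) * (HurwitzZeta.evenKernel 0 (Real.exp L) - 1)

theorem continuous_critKernel : Continuous critKernel := by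
  have h1 : Continuous fun L : ℝ => HurwitzZeta.evenKernel 0 (Real.exp L) :=
    (HurwitzZeta.continuousOn_evenKernel 0).comp_continuous Real.continuous_exp
      fun L => Real.exp_pos L
  unfold critKernel
  fun_prop

theorem critKernel_bounds {L : ℝ} (hL : 0 ≤ L) :
    2 * Real.exp (L / 4 - Real.pi * Real.exp L) ≤ critKernel L ∧
    critKernel L ≤ 2 * Real.exp (L / 4 - Real.pi * Real.exp L) +
      4 * Real.exp (L / 4 - 4 * Real.pi * Real.exp L) := by
  obtain ⟨h1, h2⟩ := evenKernel_zero_sub_one_bounds (Real.one_le_exp hL)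
  have e1 : Real.exp (L / 4 - Real.pi * Real.exp L) =
      Real.exp (L / 4) * Real.exp (-Real.pi * Real.exp L) := by
    rw [← Real.exp_add]; ring_nf
  have e2 : Real.exp (L / 4 - 4 * Real.pi * Real.exp L) =
      Real.exp (L / 4) * Real.exp (-(4 * Real.pi * Real.exp L)) := by
    rw [← Real.exp_add]; ring_nf
  have hp := Real.exp_pos (L / 4)
  rw [critKernel, e1, e2]
  constructor
  · calc _ = Real.exp (L / 4) * (2 * Real.exp (-Real.pi * Real.exp L)) := by ring
      _ ≤ _ := by gcongr
  · calc _ ≤ Real.exp (L / 4) * (2 * Real.exp (-Real.pi * Real.exp L) +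
          4 * Real.exp (-(4 * Real.pi * Real.exp L))) := by gcongr
      _ = _ := by ring

theorem exp_sub_pi_mul_exp_le {L : ℝ} (hL : 0 ≤ L) :
    Real.exp (L / 4 - Real.pi * Real.exp L) ≤ Real.exp (-2 * L) := by
  apply Real.exp_le_exp.2
  have := Real.add_one_le_exp L
  nlinarith [Real.pi_gt_three]

theorem critKernel_nonneg {L : ℝ} (hL : 0 ≤ L) : 0 ≤ critKernel L :=
  le_trans (by positivity) (critKernel_bounds hL).1

theorem critKernel_le {L : ℝ} (hL : 0 ≤ L) : critKernel L ≤ 6 * Real.exp (-2 * L) := by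
  have h1 := (critKernel_bounds hL).2
  have h2 := exp_sub_pi_mul_exp_le hL
  have h3 : Real.exp (L / 4 - 4 * Real.pi * Real.exp L) ≤
      Real.exp (L / 4 - Real.pi * Real.exp L) := by
    apply Real.exp_le_exp.2
    nlinarith [Real.pi_pos, Real.exp_pos L, mul_pos Real.pi_pos (Real.exp_pos L)]
  linarith

open MeasureTheory Set in
theorem integrableOn_Ioi_of_le_exp_neg {f : ℝ → ℝ} (hf : Continuous f) {C : ℝ}
    (h : ∀ L, 0 ≤ L → |f L| ≤ C * Real.exp (-L)) : IntegrableOn f (Ioi 0) := by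
  have hi : IntegrableOn (fun L : ℝ => C * Real.exp (-L)) (Ioi 0) := by
    have := exp_neg_integrableOn_Ioi 0 one_pos
    simp only [neg_mul, one_mul] at this
    exact this.const_mul C
  refine Integrable.mono' hi hf.aestronglyMeasurable ?_
  filter_upwards [ae_restrict_mem measurableSet_Ioi] with L hL using h L (le_of_lt hL)

open MeasureTheory Set HurwitzZeta in
-- In the logarithmic variable the functional equation of the theta kernel is evenness. It carries
-- the values for u > 0, where the argument is below 1, to those for u < 0.
theorem f_modif_exp_neg (u : ℝ) (hu : u ≠ 0) :
    Real.exp (-(1 / 4) * u) • (hurwitzEvenFEPair 0).f_modif (Real.exp (-u)) =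
      ((critKernel |u| : ℝ) : ℂ) := by
  have hgt : ∀ v : ℝ, 0 < v → (hurwitzEvenFEPair 0).f_modif (Real.exp v) =
      ((evenKernel 0 (Real.exp v) - 1 : ℝ) : ℂ) := by
    intro v hv
    have h1 : 1 < Real.exp v := Real.one_lt_exp_iff.2 hv
    rw [WeakFEPair.f_modif, Pi.add_apply, indicator_of_mem (mem_Ioi.2 h1),
      indicator_of_notMem (fun h => lt_asymm h1 h.2)]
    simp [hurwitzEvenFEPair]
  rcases lt_or_gt_of_ne hu with h | h
  · rw [hgt _ (by linarith), abs_of_neg h, critKernel, Complex.real_smul, ← Complex.ofReal_mul]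
    congr 3
    ring
  · have h2 := (hurwitzEvenFEPair 0).hf_modif_FE (Real.exp u) (Real.exp_pos u)
    have hg : (hurwitzEvenFEPair 0).g_modif = (hurwitzEvenFEPair 0).f_modif := by
      change (hurwitzEvenFEPair 0).symm.f_modif = _
      rw [hurwitzEvenFEPair_zero_symm]
    rw [hg, one_div, ← Real.exp_neg, hgt u h] at h2
    rw [h2, abs_of_pos h, critKernel]
    have hk : (hurwitzEvenFEPair 0).k = 1 / 2 := rfl
    have he : (hurwitzEvenFEPair 0).ε = 1 := rfl
    rw [hk, he, one_mul, Complex.real_smul, smul_eq_mul, ← mul_assoc, ← Complex.ofReal_mul,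
      ← Complex.ofReal_mul]
    congr 2
    rw [← Real.exp_mul, ← Real.exp_add]
    congr 1
    ring

open MeasureTheory Set in
theorem integrable_exp_neg_mul_abs {b : ℝ} (hb : 0 < b) :
    Integrable (fun u : ℝ => Real.exp (-(b * |u|))) := by
  have h1 : IntegrableOn (fun u : ℝ => Real.exp (-(b * |u|))) (Ioi 0) := by
    refine (exp_neg_integrableOn_Ioi 0 hb).congr_fun (fun u hu => ?_) measurableSet_Ioi
    simp only [abs_of_pos (mem_Ioi.1 hu), neg_mul]
  have h2 : IntegrableOn (fun u : ℝ => Real.exp (-(b * |u|))) (Iic 0) := by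
    refine (integrableOn_exp_mul_Iic hb 0).congr_fun (fun u hu => ?_) measurableSet_Iic
    simp only [abs_of_nonpos (mem_Iic.1 hu), mul_neg, neg_neg]
  have h3 := h2.union h1
  rwa [Iic_union_Ioi, integrableOn_univ] at h3

open MeasureTheory Set in
theorem integrable_critKernel_abs : Integrable (fun u : ℝ => critKernel |u|) := by
  refine Integrable.mono' ((integrable_exp_neg_mul_abs two_pos).const_mul 6)
    (continuous_critKernel.comp continuous_abs).aestronglyMeasurable
    (Filter.Eventually.of_forall fun u => ?_)
  rw [Real.norm_of_nonneg (critKernel_nonneg (abs_nonneg u)), ← neg_mul]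
  exact critKernel_le (abs_nonneg u)

open MeasureTheory Set HurwitzZeta in
-- The Mellin transform at s/2, with Re(s/2) = 1/4, is a Fourier transform in the logarithmic
-- variable, and evenness of the kernel folds it into a cosine integral.
theorem completedRiemannZeta₀_critPt (t : ℝ) :
    completedRiemannZeta₀ (critPt t) =
      ((∫ L in Ioi (0 : ℝ), Real.cos (t / 2 * L) * critKernel L : ℝ) : ℂ) := by
  have h0 : completedRiemannZeta₀ (critPt t) =
      mellin (hurwitzEvenFEPair 0).f_modif (critPt t / 2) / 2 := rfl
  have hre : (critPt t / 2).re = 1 / 4 := by simp [critPt]; norm_num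
  have him : (critPt t / 2).im = t / 2 := by simp [critPt]
  rw [h0, mellin_eq_fourier, hre, him, Real.fourier_eq']
  have h1 : ∀ᵐ u : ℝ, Complex.exp ((↑(-2 * Real.pi * inner ℝ u (t / 2 / (2 * Real.pi)))) * Complex.I) •
      (Real.exp (-(1 / 4) * u) • (hurwitzEvenFEPair 0).f_modif (Real.exp (-u))) =
      Complex.exp (((-(t / 2 * u) : ℝ) : ℂ) * Complex.I) * ((critKernel |u| : ℝ) : ℂ) := by
    filter_upwards [compl_mem_ae_iff.2 (measure_singleton (0 : ℝ))] with u hu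
    rw [f_modif_exp_neg u hu, smul_eq_mul]
    congr 4
    simp
    field_simp
  rw [integral_congr_ae h1]
  have hint : Integrable (fun u : ℝ => Complex.exp (((-(t / 2 * u) : ℝ) : ℂ) * Complex.I) *
      ((critKernel |u| : ℝ) : ℂ)) := by
    refine Integrable.bdd_mul (c := 1) integrable_critKernel_abs.ofReal ?_ ?_
    · exact Continuous.aestronglyMeasurable (by fun_prop)
    · exact Filter.Eventually.of_forall fun u => by rw [Complex.norm_exp_ofReal_mul_I]
  have hint2 := hint.comp_neg
  have hneg := integral_neg_eq_self (fun u : ℝ => Complex.exp (((-(t / 2 * u) : ℝ) : ℂ) * Complex.I) *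
      ((critKernel |u| : ℝ) : ℂ)) volume
  have hadd := integral_add hint hint2
  rw [hneg, ← two_mul] at hadd
  have hcos : ∀ u : ℝ, Complex.exp (((-(t / 2 * u) : ℝ) : ℂ) * Complex.I) * ((critKernel |u| : ℝ) : ℂ) +
      Complex.exp (((-(t / 2 * (-u)) : ℝ) : ℂ) * Complex.I) * ((critKernel |(-u)| : ℝ) : ℂ) =
      ((2 * (Real.cos (t / 2 * |u|) * critKernel |u|) : ℝ) : ℂ) := by
    intro u
    have hc : Real.cos (t / 2 * |u|) = Real.cos (t / 2 * u) := by
      rcases abs_choice u with e | e <;> rw [e]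
      rw [mul_neg, Real.cos_neg]
    rw [abs_neg, ← add_mul, hc]
    push_cast
    rw [Complex.cos]
    ring_nf
  simp only [hcos] at hadd
  rw [integral_complex_ofReal, integral_const_mul,
    integral_comp_abs (f := fun u => Real.cos (t / 2 * u) * critKernel u)] at hadd
  push_cast at hadd ⊢
  linear_combination -hadd / 4

/-- The completed zeta function on the critical line, as a real function. -/
noncomputable def critXi (t : ℝ) : ℝ :=
  (∫ L in Set.Ioi (0 : ℝ), Real.cos (t / 2 * L) * critKernel L) - 1 / (1 / 4 + t ^ 2)

theorem completedRiemannZeta_critPt (t : ℝ) :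
    completedRiemannZeta (critPt t) = (critXi t : ℂ) := by
  rw [completedRiemannZeta_eq, completedRiemannZeta₀_critPt, critXi]
  have h1 : critPt t ≠ 0 := fun h => by
    have := congrArg Complex.re h
    simp [critPt] at this
  have h2 : 1 - critPt t ≠ 0 := fun h => by
    have := congrArg Complex.re h
    simp [critPt] at this
    norm_num at this
  have h3 : (1 / 4 + (t : ℂ) ^ 2) = critPt t * (1 - critPt t) := by
    rw [critPt]
    linear_combination ((t : ℂ) ^ 2) * Complex.I_sq
  push_cast
  rw [h3]
  field_simp
  ring

theorem critXi_neg (t : ℝ) : critXi (-t) = critXi t := by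
  simp only [critXi, neg_div, neg_mul, Real.cos_neg, neg_sq]

open MeasureTheory Set in
theorem hasDerivAt_critXi (t : ℝ) :
    HasDerivAt critXi ((∫ L in Ioi (0 : ℝ), -(L / 2 * Real.sin (t / 2 * L)) * critKernel L) +
      2 * t / (1 / 4 + t ^ 2) ^ 2) t := by
  have hb : ∀ L, 0 ≤ L → L * critKernel L ≤ 6 * Real.exp (-L) := by
    intro L hL
    have h1 := critKernel_le hL
    have h2 : L ≤ Real.exp L := by linarith [Real.add_one_le_exp L]
    calc L * critKernel L ≤ Real.exp L * (6 * Real.exp (-2 * L)) := by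
          gcongr; exact critKernel_nonneg hL
      _ = 6 * (Real.exp L * Real.exp (-2 * L)) := by ring
      _ = _ := by rw [← Real.exp_add]; ring_nf
  have key := (hasDerivAt_integral_of_dominated_loc_of_deriv_le (μ := volume.restrict (Ioi (0 : ℝ)))
    (F := fun t L => Real.cos (t / 2 * L) * critKernel L)
    (F' := fun t L => -(L / 2 * Real.sin (t / 2 * L)) * critKernel L) (x₀ := t)
    (s := univ) (bound := fun L => L * critKernel L) Filter.univ_mem ?_ ?_ ?_ ?_ ?_ ?_).2
  · have h2 : HasDerivAt (fun t : ℝ => 1 / (1 / 4 + t ^ 2)) (-(2 * t) / (1 / 4 + t ^ 2) ^ 2) t := by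
      have h3 : HasDerivAt (fun t : ℝ => 1 / 4 + t ^ 2) (2 * t) t := by
        simpa using (hasDerivAt_pow 2 t).const_add (1 / 4 : ℝ)
      have := h3.fun_inv (by positivity)
      simpa only [one_div] using this
    refine (key.sub h2).congr_deriv ?_
    ring
  · refine Filter.Eventually.of_forall fun t => Continuous.aestronglyMeasurable ?_
    have := continuous_critKernel
    fun_prop
  · refine integrableOn_Ioi_of_le_exp_neg (by have := continuous_critKernel; fun_prop) (C := 6) ?_
    intro L hL
    rw [abs_mul, abs_of_nonneg (critKernel_nonneg hL)]
    calc _ ≤ 1 * critKernel L := by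
          gcongr
          · exact critKernel_nonneg hL
          · exact Real.abs_cos_le_one _
      _ ≤ 6 * Real.exp (-2 * L) := by rw [one_mul]; exact critKernel_le hL
      _ ≤ _ := by gcongr; linarith
  · refine Continuous.aestronglyMeasurable ?_
    have := continuous_critKernel
    fun_prop
  · filter_upwards [ae_restrict_mem measurableSet_Ioi] with L hL t _
    have hL0 : 0 ≤ L := le_of_lt hL
    rw [Real.norm_eq_abs, abs_mul, abs_of_nonneg (critKernel_nonneg hL0), abs_neg, abs_mul,
      abs_of_nonneg (by positivity : 0 ≤ L / 2)]
    refine mul_le_mul_of_nonneg_right ?_ (critKernel_nonneg hL0)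
    have := Real.abs_sin_le_one (t / 2 * L)
    nlinarith
  · refine integrableOn_Ioi_of_le_exp_neg (by have := continuous_critKernel; fun_prop) (C := 6) ?_
    intro L hL
    rw [abs_of_nonneg (mul_nonneg hL (critKernel_nonneg hL))]
    exact hb L hL
  · refine Filter.Eventually.of_forall fun L t _ => ?_
    have h1 : HasDerivAt (fun t : ℝ => t / 2 * L) (1 / 2 * L) t :=
      ((hasDerivAt_id t).div_const 2).mul_const L
    refine (h1.cos.mul_const (critKernel L)).congr_deriv ?_
    ring

/-! ### Numerical bounds for Ξ and Ξ' near the critical point of ϑ. -/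

theorem Real.cos_le_quartic {x : ℝ} (hx : 0 ≤ x) :
    Real.cos x ≤ 1 - x ^ 2 / 2 + x ^ 4 / 24 := by
  have hm : MonotoneOn (fun x : ℝ => 1 - x ^ 2 / 2 + x ^ 4 / 24 - Real.cos x) (Set.Ici 0) := by
    refine monotoneOn_of_deriv_nonneg (convex_Ici 0) (by fun_prop) (by fun_prop) fun y hy => ?_
    rw [interior_Ici] at hy
    have h : HasDerivAt (fun x : ℝ => 1 - x ^ 2 / 2 + x ^ 4 / 24 - Real.cos x)
        (-y + y ^ 3 / 6 + Real.sin y) y := by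
      have h1 := ((hasDerivAt_pow 2 y).div_const 2).const_sub 1
      have h2 := (hasDerivAt_pow 4 y).div_const 24
      refine ((h1.add h2).sub (Real.hasDerivAt_cos y)).congr_deriv ?_
      norm_num
      ring
    rw [h.deriv]
    have := Real.sin_gt_sub_cube hy
    linarith
  have := hm Set.self_mem_Ici hx hx
  simp at this
  linarith

theorem Real.sub_cube_le_sin {x : ℝ} (hx : 0 ≤ x) : x - x ^ 3 / 6 ≤ Real.sin x := by
  rcases hx.eq_or_lt with rfl | h
  · simp
  · exact (Real.sin_gt_sub_cube h).le

open MeasureTheory Set Filter Topology in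
/-- A lower bound for a weighted integral by comparison with an exact derivative. -/
theorem le_integral_exp_weight {K ρ ρ' : ℝ → ℝ} (hK : Continuous K)
    (hKb : ∀ L, 0 ≤ L → |K L| ≤ 2 * Real.exp L) (hρ : ∀ L, HasDerivAt ρ (ρ' L) L)
    (hρ' : Continuous ρ') {C : ℝ} (hρb : ∀ L, 0 ≤ L → |ρ L| ≤ C * Real.exp L)
    (h : ∀ L, 0 ≤ L → 0 ≤ Real.exp L * (K L - Real.pi * ρ L) + ρ' L - 3 / 4 * ρ L) :
    Real.exp (-Real.pi) * ρ 0 ≤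
      ∫ L in Ioi (0 : ℝ), Real.exp (L / 4 - Real.pi * Real.exp L) * K L := by
  have hρc : Continuous ρ := continuous_iff_continuousAt.2 fun L => (hρ L).continuousAt
  -- Hypothesis `h` says precisely that -Φ' is at most the integrand. Integrating over (0, ∞) leaves
  -- Φ(0), since Φ vanishes at infinity.
  set Φ : ℝ → ℝ := fun L => Real.exp (-(3 / 4) * L - Real.pi * Real.exp L) * ρ L with hΦ
  set Φ' : ℝ → ℝ := fun L => Real.exp (-(3 / 4) * L - Real.pi * Real.exp L) *
    ((-(3 / 4) - Real.pi * Real.exp L) * ρ L + ρ' L) with hΦ'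
  have hd : ∀ L, HasDerivAt Φ (Φ' L) L := by
    intro L
    have h1 : HasDerivAt (fun L : ℝ => -(3 / 4) * L - Real.pi * Real.exp L)
        (-(3 / 4) * 1 - Real.pi * Real.exp L) L :=
      ((hasDerivAt_id L).const_mul _).sub ((Real.hasDerivAt_exp L).const_mul _)
    refine (h1.exp.mul (hρ L)).congr_deriv ?_
    simp only [hΦ']
    ring
  have hΦ'c : Continuous Φ' := by fun_prop
  have hwc : Continuous fun L => Real.exp (L / 4 - Real.pi * Real.exp L) * K L := by fun_prop
  have hint : IntegrableOn (fun L => Real.exp (L / 4 - Real.pi * Real.exp L) * K L) (Ioi 0) := by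
    refine integrableOn_Ioi_of_le_exp_neg hwc (C := 2) fun L hL => ?_
    rw [abs_mul, abs_of_pos (Real.exp_pos _)]
    calc _ ≤ Real.exp (-2 * L) * (2 * Real.exp L) := by
          exact mul_le_mul (exp_sub_pi_mul_exp_le hL) (hKb L hL) (abs_nonneg _) (Real.exp_pos _).le
      _ = 2 * (Real.exp (-2 * L) * Real.exp L) := by ring
      _ = _ := by rw [← Real.exp_add]; ring_nf
  have hlim := intervalIntegral_tendsto_integral_Ioi (0 : ℝ) hint tendsto_id
  have hΦ0 : Tendsto Φ atTop (𝓝 0) := by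
    have hz : Tendsto (fun L : ℝ => C * Real.exp (-L)) atTop (𝓝 (C * 0)) :=
      (Real.tendsto_exp_neg_atTop_nhds_zero).const_mul C
    rw [mul_zero] at hz
    refine squeeze_zero_norm' ?_ hz
    filter_upwards [eventually_ge_atTop 0] with L hL
    rw [Real.norm_eq_abs, abs_mul, abs_of_pos (Real.exp_pos _)]
    have h1 : Real.exp (-(3 / 4) * L - Real.pi * Real.exp L) ≤ Real.exp (-2 * L) := by
      refine (Real.exp_le_exp.2 ?_).trans (exp_sub_pi_mul_exp_le hL)
      linarith
    calc _ ≤ Real.exp (-2 * L) * (C * Real.exp L) := by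
          gcongr
          exact hρb L hL
      _ = C * (Real.exp (-2 * L) * Real.exp L) := by ring
      _ = _ := by rw [← Real.exp_add]; ring_nf
  have hΦl : Tendsto (fun R => Φ 0 - Φ R) atTop (𝓝 (Φ 0 - 0)) := tendsto_const_nhds.sub hΦ0
  have h00 : Φ 0 - 0 = Real.exp (-Real.pi) * ρ 0 := by simp [hΦ]
  rw [h00] at hΦl
  refine le_of_tendsto_of_tendsto hΦl hlim ?_
  filter_upwards [eventually_ge_atTop 0] with R hR
  have hF := intervalIntegral.integral_eq_sub_of_hasDerivAt (fun L _ => hd L)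
    (hΦ'c.intervalIntegrable 0 R)
  have : ∫ L in (0 : ℝ)..R, -Φ' L ≤
      ∫ L in (0 : ℝ)..R, Real.exp (L / 4 - Real.pi * Real.exp L) * K L := by
    refine intervalIntegral.integral_mono_on hR (hΦ'c.neg.intervalIntegrable 0 R)
      (hwc.intervalIntegrable 0 R) fun L hL => ?_
    have e : Real.exp (L / 4 - Real.pi * Real.exp L) =
        Real.exp (-(3 / 4) * L - Real.pi * Real.exp L) * Real.exp L := by
      rw [← Real.exp_add]; ring_nf
    rw [e]
    simp only [hΦ']
    have := mul_nonneg (Real.exp_pos (-(3 / 4) * L - Real.pi * Real.exp L)).le (h L hL.1)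
    linarith
  rw [intervalIntegral.integral_neg, hF] at this
  simpa using this

open MeasureTheory Set in
/-- The contribution of the terms `n ≥ 2` of the theta series is negligible. -/
theorem abs_integral_critKernel_sub_le {K : ℝ → ℝ} (hK : Continuous K)
    (hKb : ∀ L, 0 ≤ L → |K L| ≤ 2 * Real.exp L) :
    |(∫ L in Ioi (0 : ℝ), critKernel L * K L) -
      2 * ∫ L in Ioi (0 : ℝ), Real.exp (L / 4 - Real.pi * Real.exp L) * K L| ≤
      8 * Real.exp (-12) := by
  have hc := continuous_critKernel
  have hb : ∀ L, 0 ≤ L → |(critKernel L - 2 * Real.exp (L / 4 - Real.pi * Real.exp L)) * K L| ≤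
      8 * Real.exp (-12) * Real.exp (-L) := by
    intro L hL
    obtain ⟨h1, h2⟩ := critKernel_bounds hL
    rw [abs_mul, abs_of_nonneg (by linarith)]
    have h3 : Real.exp (L / 4 - 4 * Real.pi * Real.exp L) ≤ Real.exp (-12 + -2 * L) := by
      apply Real.exp_le_exp.2
      have := Real.add_one_le_exp L
      nlinarith [Real.pi_gt_three]
    calc _ ≤ (4 * Real.exp (-12 + -2 * L)) * (2 * Real.exp L) := by
          gcongr
          · linarith
          · exact hKb L hL
      _ = 8 * (Real.exp (-12 + -2 * L) * Real.exp L) := by ring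
      _ = 8 * (Real.exp (-12) * Real.exp (-L)) := by
          rw [← Real.exp_add, ← Real.exp_add]; ring_nf
      _ = _ := by ring
  have hi1 : IntegrableOn (fun L => critKernel L * K L) (Ioi 0) := by
    refine integrableOn_Ioi_of_le_exp_neg (by fun_prop) (C := 12) fun L hL => ?_
    rw [abs_mul, abs_of_nonneg (critKernel_nonneg hL)]
    calc _ ≤ (6 * Real.exp (-2 * L)) * (2 * Real.exp L) := by
          gcongr
          · exact critKernel_le hL
          · exact hKb L hL
      _ = 12 * (Real.exp (-2 * L) * Real.exp L) := by ring
      _ = _ := by rw [← Real.exp_add]; ring_nf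
  have hi3 : IntegrableOn (fun L => (critKernel L - 2 * Real.exp (L / 4 - Real.pi * Real.exp L)) *
      K L) (Ioi 0) := integrableOn_Ioi_of_le_exp_neg (by fun_prop) hb
  have hi2 : IntegrableOn (fun L => 2 * (Real.exp (L / 4 - Real.pi * Real.exp L) * K L))
      (Ioi 0) := by
    refine (hi1.sub hi3).congr_fun (fun L _ => ?_) measurableSet_Ioi
    simp only [Pi.sub_apply]
    ring
  have e : (∫ L in Ioi (0 : ℝ), critKernel L * K L) -
      2 * ∫ L in Ioi (0 : ℝ), Real.exp (L / 4 - Real.pi * Real.exp L) * K L =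
      ∫ L in Ioi (0 : ℝ), (critKernel L - 2 * Real.exp (L / 4 - Real.pi * Real.exp L)) * K L := by
    rw [← integral_const_mul, ← integral_sub hi1 hi2]
    refine setIntegral_congr_fun measurableSet_Ioi fun L _ => ?_
    ring
  rw [e, ← Real.norm_eq_abs]
  have hi : IntegrableOn (fun L : ℝ => 8 * Real.exp (-12) * Real.exp (-L)) (Ioi 0) := by
    have := exp_neg_integrableOn_Ioi 0 one_pos
    simp only [neg_mul, one_mul] at this
    exact this.const_mul _
  have := norm_integral_le_of_norm_le (f := fun L =>
    (critKernel L - 2 * Real.exp (L / 4 - Real.pi * Real.exp L)) * K L) hi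
    ((ae_restrict_mem measurableSet_Ioi).mono fun L hL => hb L (le_of_lt hL))
  rwa [integral_const_mul, integral_exp_neg_Ioi_zero, mul_one] at this

theorem exp_neg_pi_lt : Real.exp (-Real.pi) < 0.0434 := by
  have h1 : Real.exp (-Real.pi) < Real.exp (-3.14) :=
    Real.exp_lt_exp.2 (by linarith [Real.pi_gt_d2])
  refine h1.trans_le ?_
  have e : Real.exp (-3.14) = (Real.exp (-1)) ^ 3 * (Real.exp (0.14))⁻¹ := by
    rw [← Real.exp_nat_mul, ← Real.exp_neg, ← Real.exp_add]; norm_num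
  have h2 := Real.exp_neg_one_lt_d9
  have h3 : 1.1498 ≤ Real.exp 0.14 := by
    have := Real.quadratic_le_exp_of_nonneg (show (0 : ℝ) ≤ 0.14 by norm_num)
    norm_num at this ⊢
    linarith
  rw [e]
  calc _ ≤ (0.3678794412 : ℝ) ^ 3 * (1.1498)⁻¹ := by gcongr
    _ ≤ _ := by norm_num

theorem exp_neg_twelve_lt : Real.exp (-12) < 0.0000063 := by
  have e : Real.exp (-12) = (Real.exp (-1)) ^ 12 := by
    rw [← Real.exp_nat_mul]; norm_num
  rw [e]
  calc _ ≤ (0.3678794412 : ℝ) ^ 12 := by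
        have := Real.exp_neg_one_lt_d9
        gcongr
    _ < _ := by norm_num

open MeasureTheory Set in
/-- The completed zeta function has no zero on the low part of the critical line. -/
theorem critXi_neg_of_le {t : ℝ} (ht : |t| ≤ 6.344) : critXi t < 0 := by
  have hc := continuous_critKernel
  have h1 : ∫ L in Ioi (0 : ℝ), Real.cos (t / 2 * L) * critKernel L ≤
      ∫ L in Ioi (0 : ℝ), critKernel L := by
    have hi : IntegrableOn critKernel (Ioi 0) := by
      refine integrableOn_Ioi_of_le_exp_neg hc (C := 6) fun L hL => ?_
      rw [abs_of_nonneg (critKernel_nonneg hL)]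
      refine (critKernel_le hL).trans ?_
      gcongr
      linarith
    refine setIntegral_mono_on ?_ hi measurableSet_Ioi fun L hL => ?_
    · refine hi.bdd_mul (c := 1) (Continuous.aestronglyMeasurable (by fun_prop)) ?_
      exact Filter.Eventually.of_forall fun L => by
        rw [Real.norm_eq_abs]; exact Real.abs_cos_le_one _
    · exact mul_le_of_le_one_left (critKernel_nonneg (le_of_lt hL)) (Real.cos_le_one _)
  -- The sign of `K` turns the lower bound into an upper one: the main integral is at most 0.27
  -- e^{-π}. Doubled and with the tail 8 e^{-12} added, this stays below 0.0236, while the pole term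
  -- is at least 0.0246.
  have h2 := le_integral_exp_weight (K := fun _ => -1) (ρ := fun L => -(0.27 + 0.05 * L))
    (ρ' := fun _ => -0.05) continuous_const
    (fun L hL => by
      have := Real.one_le_exp hL
      norm_num
      linarith)
    (fun L => by
      have := (((hasDerivAt_id L).const_mul (0.05 : ℝ)).const_add 0.27).fun_neg
      simpa only [id, mul_one] using this) continuous_const (C := 1)
    (fun L hL => by
      rw [abs_neg, abs_of_nonneg (by positivity)]
      have := Real.add_one_le_exp L
      linarith)
    (fun L hL => by
      have h3 := Real.add_one_le_exp L
      have h4 : (0.27 + 0.05 * L) * 3.14 ≤ Real.pi * (0.27 + 0.05 * L) := by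
        rw [mul_comm]
        gcongr
        exact Real.pi_gt_d2.le
      have h5 : -0.1522 + 0.157 * L ≤ -1 - Real.pi * -(0.27 + 0.05 * L) := by linarith
      have h6 := mul_le_mul_of_nonneg_left h5 (Real.exp_pos L).le
      have h7 : -0.1524 - 0.0001 * L ≤ Real.exp L * (-0.1522 + 0.157 * L) := by
        -- The affine factor is negative only for L < 0.97, where e^L ≤ 1/(1 - L) suffices.
        -- Otherwise the product is nonnegative.
        rcases le_total (-0.1522 + 0.157 * L) 0 with h | h
        · have h8 : L ≤ 0.97 := by linarith
          have h9 : Real.exp L ≤ (1 - L)⁻¹ := by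
            rw [le_inv_comm₀ (Real.exp_pos L) (by linarith), ← Real.exp_neg]
            linarith [Real.add_one_le_exp (-L)]
          have h10 := mul_le_mul_of_nonpos_right h9 h
          refine le_trans ?_ h10
          rw [inv_mul_eq_div, le_div_iff₀ (by linarith)]
          nlinarith
        · nlinarith [mul_nonneg (Real.exp_pos L).le h]
      norm_num at h6 h7 ⊢
      linarith)
  have h3 := abs_integral_critKernel_sub_le (K := fun _ => -1) continuous_const
    (fun L hL => by
      have := Real.one_le_exp hL
      norm_num
      linarith)
  simp only [mul_neg, mul_one, integral_neg, mul_zero, add_zero] at h2 h3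
  have h4 := (abs_le.1 h3).1
  have h5 := exp_neg_pi_lt
  have h6 := exp_neg_twelve_lt
  have h7 : 0.0246 ≤ 1 / (1 / 4 + t ^ 2) := by
    rw [le_div_iff₀ (by positivity)]
    have : t ^ 2 ≤ 6.344 ^ 2 := by rw [← sq_abs]; gcongr
    norm_num at this ⊢
    linarith
  rw [critXi]
  norm_num at h2 h4 h5 h6 h7 h1 ⊢
  linarith

/-- Taylor bounds for sin and cos, with τ then replaced by its worst endpoint in each coefficient:
3.118 in that of L² and 3.172 in that of L⁴. -/
theorem trig_kernel_lower {τ L : ℝ} (h1 : 3.118 ≤ τ) (h2 : τ ≤ 3.172) (hL : 0 ≤ L) :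
    -1.626 + 11.02 * L ^ 2 - 12.18 * L ^ 4 ≤
      L * Real.sin (τ * L) - 1.626 * Real.cos (τ * L) := by
  have hτ : 0 ≤ τ := by linarith
  have hs := Real.sub_cube_le_sin (mul_nonneg hτ hL)
  have hc := Real.cos_le_quartic (mul_nonneg hτ hL)
  have hs' := mul_le_mul_of_nonneg_left hs hL
  have e2 : 11.02 ≤ τ + 0.813 * τ ^ 2 := by
    have : (3.118 : ℝ) ^ 2 ≤ τ ^ 2 := by gcongr
    norm_num at this ⊢
    linarith
  have e4 : τ ^ 3 / 6 + 0.813 * τ ^ 4 / 12 ≤ 12.18 := by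
    have h3 : τ ^ 3 ≤ (3.172 : ℝ) ^ 3 := by gcongr
    have h4 : τ ^ 4 ≤ (3.172 : ℝ) ^ 4 := by gcongr
    norm_num at h3 h4 ⊢
    linarith
  have f2 := mul_le_mul_of_nonneg_right e2 (sq_nonneg L)
  have f4 := mul_le_mul_of_nonneg_right e4 (by positivity : 0 ≤ L ^ 4)
  have g1 : L * (τ * L - (τ * L) ^ 3 / 6) = τ * L ^ 2 - τ ^ 3 / 6 * L ^ 4 := by ring
  have g2 : 1 - (τ * L) ^ 2 / 2 + (τ * L) ^ 4 / 24 = 1 - τ ^ 2 / 2 * L ^ 2 + τ ^ 4 / 24 * L ^ 4 := by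
    ring
  rw [g1] at hs'
  rw [g2] at hc
  linarith

/-- This is the hypothesis of `le_integral_exp_weight` for the quartic minorant of
`trig_kernel_lower` and a quartic ρ. The coefficient 3.88 lies just above 12.18/π, so the L⁴ term
multiplying e^L is nonnegative and can be dropped, which leaves the quadratic `q`. -/
theorem comparison_polynomial_nonneg {L : ℝ} (hL : 0 ≤ L) :
    0 ≤ Real.exp L * (-1.626 + 11.02 * L ^ 2 - 12.18 * L ^ 4 -
      Real.pi * (-0.282 + 0.585 * L + 1.2267 * L ^ 2 - 3.88 * L ^ 4)) +
      (0.585 + 2.4534 * L - 15.52 * L ^ 3) -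
      3 / 4 * (-0.282 + 0.585 * L + 1.2267 * L ^ 2 - 3.88 * L ^ 4) := by
  set q := -0.7401 - 1.8379 * L + 7.166 * L ^ 2 with hq
  have hp1 : 3.1415 ≤ Real.pi := by linarith [Real.pi_gt_d6]
  have hp2 : Real.pi ≤ 3.1416 := by linarith [Real.pi_lt_d6]
  have hqle : q ≤ -1.626 + 11.02 * L ^ 2 - 12.18 * L ^ 4 -
      Real.pi * (-0.282 + 0.585 * L + 1.2267 * L ^ 2 - 3.88 * L ^ 4) := by
    have a1 := mul_le_mul_of_nonneg_right hp2 hL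
    have a2 := mul_le_mul_of_nonneg_right hp2 (sq_nonneg L)
    have a4 := mul_le_mul_of_nonneg_right hp1 (by positivity : 0 ≤ L ^ 4)
    have p4 : 0 ≤ L ^ 4 := by positivity
    have p2 : 0 ≤ L ^ 2 := by positivity
    rw [hq]
    norm_num
    linarith
  have hmain : 0 ≤ Real.exp L * q + (0.585 + 2.4534 * L - 15.52 * L ^ 3) -
      3 / 4 * (-0.282 + 0.585 * L + 1.2267 * L ^ 2 - 3.88 * L ^ 4) := by
    -- The sign of `q`, which changes near L = 0.474, decides whether e^L has to be bounded from
    -- below or from above. The upper bound uses L³/5 in place of L³/6 to absorb the Taylor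
    -- remainder.
    rcases le_total 0 q with h | h
    · have hL1 : 0.47 ≤ L := by
        by_contra! hlt
        nlinarith
      have he : 1 + L + L ^ 2 / 2 + L ^ 3 / 6 ≤ Real.exp L := by
        have := Real.sum_le_exp_of_nonneg hL 4
        simp [Finset.sum_range_succ, Nat.factorial] at this
        linarith
      have h5 := mul_le_mul_of_nonneg_right he h
      have hpoly : 0 ≤ (1 + L + L ^ 2 / 2 + L ^ 3 / 6) * q +
          (0.585 + 2.4534 * L - 15.52 * L ^ 3) -
          3 / 4 * (-0.282 + 0.585 * L + 1.2267 * L ^ 2 - 3.88 * L ^ 4) := by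
        have h6 : 0.47 * L ^ 4 ≤ L ^ 5 := by
          calc 0.47 * L ^ 4 ≤ L * L ^ 4 := by gcongr
            _ = L ^ 5 := by ring
        rw [hq]
        norm_num at h6 ⊢
        nlinarith [sq_nonneg (L ^ 2 - 0.7 * L + 0.08), sq_nonneg (L - 0.55), sq_nonneg (L - 0.1)]
      linarith
    · have hL1 : L ≤ 0.4745 := by
        by_contra! hlt
        nlinarith
      have he : Real.exp L ≤ 1 + L + L ^ 2 / 2 + L ^ 3 / 5 := by
        have := Real.exp_bound' hL (by linarith) (n := 4) (by norm_num)
        simp [Finset.sum_range_succ, Nat.factorial] at this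
        norm_num at this
        have h3 : L ^ 4 ≤ 0.5 * L ^ 3 := by
          calc L ^ 4 = L * L ^ 3 := by ring
            _ ≤ 0.5 * L ^ 3 := by gcongr; linarith
        have h4 : 0 ≤ L ^ 3 := by positivity
        norm_num at h3
        linarith
      have h5 := mul_le_mul_of_nonpos_right he h
      have hpoly : 0 ≤ (1 + L + L ^ 2 / 2 + L ^ 3 / 5) * q +
          (0.585 + 2.4534 * L - 15.52 * L ^ 3) -
          3 / 4 * (-0.282 + 0.585 * L + 1.2267 * L ^ 2 - 3.88 * L ^ 4) := by
        rw [hq]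
        norm_num
        nlinarith [mul_nonneg hL (sq_nonneg (L ^ 2 - 0.2)), sq_nonneg (L ^ 2 - 0.7 * L + 0.08),
          sq_nonneg (L - 0.45), sq_nonneg (L - 0.1)]
      linarith
  have := mul_le_mul_of_nonneg_left hqle (Real.exp_pos L).le
  linarith

open MeasureTheory Set in
/-- Near the critical point of `ϑ`, the completed zeta function grows so slowly that `|ζ(1/2+it)|` is
increasing there. -/
theorem critXi_add_deriv_neg {t L' : ℝ} (h1 : 6.236 ≤ t) (h2 : t ≤ 6.344)
    (hL' : HasDerivAt critXi L' t) : 0.813 * critXi t + L' < 0 := by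
  rw [hL'.unique (hasDerivAt_critXi t)]
  have hcq := continuous_critKernel
  set τ := t / 2 with hτ
  have hτ1 : 3.118 ≤ τ := by rw [hτ]; norm_num at h1 ⊢; linarith
  have hτ2 : τ ≤ 3.172 := by rw [hτ]; norm_num at h2 ⊢; linarith
  -- As 1.626 = 2 · 0.813, the integral part of 0.813 Ξ + Ξ' is -1/2 times the integral of
  -- `critKernel` against this `K`.
  set K : ℝ → ℝ := fun L => L * Real.sin (τ * L) - 1.626 * Real.cos (τ * L) with hK
  have hKc : Continuous K := by fun_prop
  have hKb : ∀ L, 0 ≤ L → |K L| ≤ 2 * Real.exp L := by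
    intro L hL
    have e1 := Real.add_one_le_exp L
    have e2 := Real.abs_sin_le_one (τ * L)
    have e3 := Real.abs_cos_le_one (τ * L)
    calc |K L| ≤ |L * Real.sin (τ * L)| + |1.626 * Real.cos (τ * L)| := abs_sub _ _
      _ = L * |Real.sin (τ * L)| + 1.626 * |Real.cos (τ * L)| := by
          rw [abs_mul, abs_mul, abs_of_nonneg hL, abs_of_pos (by norm_num : (0 : ℝ) < 1.626)]
      _ ≤ L * 1 + 1.626 * 1 := by gcongr
      _ ≤ _ := by linarith
  have hlow := le_integral_exp_weight (K := K)
    (ρ := fun L => -0.282 + 0.585 * L + 1.2267 * L ^ 2 - 3.88 * L ^ 4)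
    (ρ' := fun L => 0.585 + 2.4534 * L - 15.52 * L ^ 3) hKc hKb
    (fun L => by
      have := ((((hasDerivAt_id L).const_mul (0.585 : ℝ)).const_add (-0.282)).add
        ((hasDerivAt_pow 2 L).const_mul (1.2267 : ℝ))).sub
        ((hasDerivAt_pow 4 L).const_mul (3.88 : ℝ))
      refine this.congr_deriv ?_
      norm_num
      ring) (by fun_prop) (C := 100)
    (fun L hL => by
      have e := Real.pow_div_factorial_le_exp L hL 4
      have e1 := Real.add_one_le_exp L
      have e2 := Real.pow_div_factorial_le_exp L hL 2
      simp only [Nat.factorial] at e e2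
      norm_num at e e2
      have p2 : 0 ≤ L ^ 2 := by positivity
      have p4 : 0 ≤ L ^ 4 := by positivity
      rw [abs_le]
      constructor <;> linarith)
    (fun L hL => by
      have e1 := comparison_polynomial_nonneg hL
      have e2 := mul_le_mul_of_nonneg_left (trig_kernel_lower hτ1 hτ2 hL) (Real.exp_pos L).le
      simp only [hK]
      linarith)
  have htail := (abs_le.1 (abs_integral_critKernel_sub_le hKc hKb)).1
  have hcos : IntegrableOn (fun L => Real.cos (τ * L) * critKernel L) (Ioi 0) := by
    refine integrableOn_Ioi_of_le_exp_neg (by fun_prop) (C := 6) fun L hL => ?_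
    rw [abs_mul, abs_of_nonneg (critKernel_nonneg hL)]
    calc _ ≤ 1 * (6 * Real.exp (-2 * L)) := by
          gcongr
          · exact critKernel_nonneg hL
          · exact Real.abs_cos_le_one _
          · exact critKernel_le hL
      _ = 6 * Real.exp (-2 * L) := one_mul _
      _ ≤ _ := by gcongr; linarith
  have hKi : IntegrableOn (fun L => critKernel L * K L) (Ioi 0) := by
    refine integrableOn_Ioi_of_le_exp_neg (by fun_prop) (C := 12) fun L hL => ?_
    rw [abs_mul, abs_of_nonneg (critKernel_nonneg hL)]
    calc _ ≤ (6 * Real.exp (-2 * L)) * (2 * Real.exp L) := by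
          gcongr
          · exact critKernel_le hL
          · exact hKb L hL
      _ = 12 * (Real.exp (-2 * L) * Real.exp L) := by ring
      _ = _ := by rw [← Real.exp_add]; ring_nf
  have hsum : 0.813 * (∫ L in Ioi (0 : ℝ), Real.cos (τ * L) * critKernel L) +
      (∫ L in Ioi (0 : ℝ), -(L / 2 * Real.sin (τ * L)) * critKernel L) =
      -(1 / 2) * ∫ L in Ioi (0 : ℝ), critKernel L * K L := by
    have e : ∀ L, -(L / 2 * Real.sin (τ * L)) * critKernel L =
        -(1 / 2) * (critKernel L * K L) - 0.813 * (Real.cos (τ * L) * critKernel L) := by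
      intro L
      simp only [hK]
      ring
    simp only [e]
    rw [integral_sub (hKi.const_mul _) (hcos.const_mul _), integral_const_mul, integral_const_mul]
    ring
  -- The pole part must beat the integral part, which is at most 0.282 e^{-π} + 4 e^{-12} < 0.01227.
  have hf : 0.01233 ≤ 0.813 * (1 / (1 / 4 + t ^ 2)) - 2 * t / (1 / 4 + t ^ 2) ^ 2 := by
    have hd : 0 < 1 / 4 + t ^ 2 := by positivity
    have e : 0.813 * (1 / (1 / 4 + t ^ 2)) - 2 * t / (1 / 4 + t ^ 2) ^ 2 =
        (0.813 * (1 / 4 + t ^ 2) - 2 * t) / (1 / 4 + t ^ 2) ^ 2 := by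
      field_simp
    rw [e, le_div_iff₀ (by positivity)]
    norm_num at h1 h2 ⊢
    have hb : 0 ≤ (t - 1559 / 250) * (793 / 125 - t) := mul_nonneg (by linarith) (by linarith)
    nlinarith [mul_nonneg hb (sq_nonneg t), mul_nonneg hb (by linarith : 0 ≤ t)]
  have h5 := exp_neg_pi_lt
  have h6 := exp_neg_twelve_lt
  simp only [mul_zero, add_zero, ne_eq, OfNat.ofNat_ne_zero, not_false_eq_true, zero_pow,
    sub_zero] at hlow
  rw [critXi]
  norm_num at hlow htail h5 h6 hf hsum ⊢
  linarith

/-! ### ζ and ζ' on the critical line. -/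

theorem critPt_re (t : ℝ) : (critPt t).re = 1 / 2 := by simp [critPt]

theorem critPt_im (t : ℝ) : (critPt t).im = t := by simp [critPt]

theorem critPt_ne_one (t : ℝ) : critPt t ≠ 1 := fun h => by
  have := congrArg Complex.re h
  rw [critPt_re] at this
  norm_num at this

theorem critPt_ne_zero (t : ℝ) : critPt t ≠ 0 := fun h => by
  have := congrArg Complex.re h
  rw [critPt_re] at this
  norm_num at this

theorem hasDerivAt_critPt (t : ℝ) : HasDerivAt critPt Complex.I t := by
  have := (((hasDerivAt_id t).ofReal_comp).const_mul Complex.I).const_add (1 / 2 : ℂ)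
  simp only [id, mul_one, Complex.ofReal_one] at this
  exact this

theorem analyticAt_critPt (t : ℝ) : AnalyticAt ℝ critPt t := by
  have h : AnalyticAt ℝ (fun x : ℝ => (x : ℂ)) t := Complex.ofRealCLM.analyticAt t
  unfold critPt
  fun_prop

theorem critPt_neg (t : ℝ) : critPt (-t) = (starRingEnd ℂ) (critPt t) := by
  apply Complex.ext <;> simp [critPt]

theorem analyticAt_riemannZeta_critPt (t : ℝ) : AnalyticAt ℂ riemannZeta (critPt t) :=
  analyticOn_riemannZeta _ (critPt_ne_one t)

theorem riemannZeta_critPt_neg (t : ℝ) :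
    riemannZeta (critPt (-t)) = (starRingEnd ℂ) (riemannZeta (critPt t)) := by
  rw [critPt_neg, riemannZeta_conj]

theorem deriv_riemannZeta_critPt_neg (t : ℝ) :
    deriv riemannZeta (critPt (-t)) = (starRingEnd ℂ) (deriv riemannZeta (critPt t)) := by
  have h : (starRingEnd ℂ) ∘ riemannZeta ∘ (starRingEnd ℂ) = riemannZeta := by
    funext s
    simp [riemannZeta_conj]
  have := congrFun (deriv_conj_conj (f := riemannZeta)) (critPt (-t))
  rw [h] at this
  rw [this, Function.comp_apply, Function.comp_apply, critPt_neg, Complex.conj_conj]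

open Complex in
theorem hasDerivAt_Gammaℝ {s : ℂ} (hs : 0 < s.re) :
    HasDerivAt Gammaℝ (Gammaℝ s * (-(Real.log Real.pi : ℂ) / 2 + digamma (s / 2) / 2)) s := by
  have hre : 0 < (s / 2).re := by simpa using hs
  have hG : HasDerivAt Gamma (deriv Gamma (s / 2)) (s / 2) := by
    refine (differentiableAt_Gamma _ fun m h => ?_).hasDerivAt
    rw [h] at hre
    simp at hre
    have : (0 : ℝ) ≤ m := m.cast_nonneg
    linarith
  have h1 : HasDerivAt (fun s : ℂ => Gamma (s / 2)) (deriv Gamma (s / 2) * (1 / 2)) s :=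
    hG.comp s ((hasDerivAt_id s).div_const 2)
  have hpi : (Real.pi : ℂ) ≠ 0 := by exact_mod_cast Real.pi_ne_zero
  have h2 : HasDerivAt (fun s : ℂ => (Real.pi : ℂ) ^ (-s / 2))
      ((Real.pi : ℂ) ^ (-s / 2) * log Real.pi * (-1 / 2)) s :=
    (((hasDerivAt_id s).neg).div_const 2).const_cpow (Or.inl hpi)
  have h3 := h2.mul h1
  have hne := Gamma_ne_zero_of_re_pos hre
  refine h3.congr_deriv ?_
  rw [Gammaℝ_def, digamma_def, logDeriv_apply, ofReal_log Real.pi_pos.le]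
  field_simp

open Complex in
theorem Gammaℝ_mul_riemannZeta_critPt (t : ℝ) :
    Gammaℝ (critPt t) * riemannZeta (critPt t) = (critXi t : ℂ) := by
  rw [riemannZeta_def_of_ne_zero (critPt_ne_zero t), completedRiemannZeta_critPt,
    mul_div_cancel₀ _ (Gammaℝ_ne_zero_of_re_pos (by rw [critPt_re]; norm_num))]

open Complex in
/-- The logarithmic derivative of the functional equation on the critical line. -/
theorem normSq_mul_deriv_zeta_mul_conj (t : ℝ) :
    (normSq (Gammaℝ (critPt t)) : ℂ) *
      (deriv riemannZeta (critPt t) * (starRingEnd ℂ) (riemannZeta (critPt t))) =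
    -(I * deriv critXi t * critXi t) -
      (deriv rsTheta t + I * ((digamma (1 / 4 + I * ((t / 2 : ℝ) : ℂ))).im / 2 : ℝ)) *
        critXi t ^ 2 := by
  set s := critPt t with hs
  have hre : 0 < s.re := by rw [hs, critPt_re]; norm_num
  have h1 : HasDerivAt (fun t => (critXi t : ℂ)) ((deriv critXi t : ℝ) : ℂ) t :=
    (hasDerivAt_critXi t).differentiableAt.hasDerivAt.ofReal_comp
  have h2 : HasDerivAt (fun z => Gammaℝ z * riemannZeta z)
      (Gammaℝ s * (-(Real.log Real.pi : ℂ) / 2 + digamma (s / 2) / 2) * riemannZeta s +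
        Gammaℝ s * deriv riemannZeta s) s :=
    (hasDerivAt_Gammaℝ hre).mul (analyticAt_riemannZeta_critPt t).differentiableAt.hasDerivAt
  have h3 : HasDerivAt (fun t => Gammaℝ (critPt t) * riemannZeta (critPt t))
      ((Gammaℝ s * (-(Real.log Real.pi : ℂ) / 2 + digamma (s / 2) / 2) * riemannZeta s +
        Gammaℝ s * deriv riemannZeta s) * I) t := by
    have := h2.scomp t (hasDerivAt_critPt t)
    simpa [Function.comp_def, mul_comm I] using this
  simp only [Gammaℝ_mul_riemannZeta_critPt] at h3
  have h4 := h1.unique h3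
  have h5 := Gammaℝ_mul_riemannZeta_critPt t
  rw [← hs] at h5
  have hg : -(Real.log Real.pi : ℂ) / 2 + digamma (s / 2) / 2 =
      deriv rsTheta t + I * ((digamma (1 / 4 + I * ((t / 2 : ℝ) : ℂ))).im / 2 : ℝ) := by
    have e : s / 2 = 1 / 4 + I * ((t / 2 : ℝ) : ℂ) := by
      rw [hs, critPt]; push_cast; ring
    rw [e, deriv_rsTheta]
    nth_rw 1 [← re_add_im (digamma (1 / 4 + I * ((t / 2 : ℝ) : ℂ)))]
    push_cast
    ring
  rw [hg] at h4
  set g : ℂ := deriv rsTheta t + I * ((digamma (1 / 4 + I * ((t / 2 : ℝ) : ℂ))).im / 2 : ℝ)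
  have h6 : (starRingEnd ℂ) (Gammaℝ s) * (starRingEnd ℂ) (riemannZeta s) = critXi t := by
    rw [← map_mul, h5, conj_ofReal]
  have h7 : Gammaℝ s * deriv riemannZeta s = -(I * deriv critXi t) - g * critXi t := by
    linear_combination I * h4 + (Gammaℝ s * g * riemannZeta s + Gammaℝ s * deriv riemannZeta s) *
      I_sq - g * h5
  rw [normSq_eq_conj_mul_self]
  linear_combination (critXi t : ℂ) * h7 + Gammaℝ s * deriv riemannZeta s * h6

open Complex in
-- Since Ξ is real, the term with Ξ' is purely imaginary and only ϑ' survives. Away from zeros of ζ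
-- this is Re(ζ'/ζ) = -ϑ'.
theorem deriv_zeta_mul_conj_re (t : ℝ) :
    (deriv riemannZeta (critPt t) * (starRingEnd ℂ) (riemannZeta (critPt t))).re =
      -deriv rsTheta t * normSq (riemannZeta (critPt t)) := by
  have h := congrArg re (normSq_mul_deriv_zeta_mul_conj t)
  have hG : 0 < normSq (Gammaℝ (critPt t)) :=
    normSq_pos.2 (Gammaℝ_ne_zero_of_re_pos (by rw [critPt_re]; norm_num))
  have h5 := congrArg normSq (Gammaℝ_mul_riemannZeta_critPt t)
  rw [normSq_mul, normSq_ofReal] at h5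
  rw [re_ofReal_mul] at h
  refine mul_left_cancel₀ hG.ne' (h.trans ?_)
  rw [← ofReal_pow]
  have e : ∀ (L x c d y : ℝ), (-(I * (L : ℂ) * (x : ℂ)) - ((d : ℂ) + I * (c : ℂ)) * (y : ℂ)).re =
      -d * y := by
    intro L x c d y
    simp
  rw [e]
  linear_combination (deriv rsTheta t) * h5

open Complex in
theorem deriv_zeta_mul_conj_im (t : ℝ) :
    normSq (Gammaℝ (critPt t)) *
      (deriv riemannZeta (critPt t) * (starRingEnd ℂ) (riemannZeta (critPt t))).im =
      -critXi t * (deriv critXi t +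
        (digamma (1 / 4 + I * ((t / 2 : ℝ) : ℂ))).im / 2 * critXi t) := by
  have h := congrArg im (normSq_mul_deriv_zeta_mul_conj t)
  rw [im_ofReal_mul] at h
  rw [h, ← ofReal_pow]
  have e : ∀ (L x c d y : ℝ), (-(I * (L : ℂ) * (x : ℂ)) - ((d : ℂ) + I * (c : ℂ)) * (y : ℂ)).im =
      -(L * x) - c * y := by
    intro L x c d y
    simp
  rw [e]
  ring

theorem riemannZeta_critPt_eq_zero_iff (t : ℝ) : riemannZeta (critPt t) = 0 ↔ critXi t = 0 := by
  have h := Gammaℝ_mul_riemannZeta_critPt t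
  have hG : Complex.Gammaℝ (critPt t) ≠ 0 :=
    Complex.Gammaℝ_ne_zero_of_re_pos (by rw [critPt_re]; norm_num)
  rw [← Complex.ofReal_eq_zero, ← h, mul_eq_zero, or_iff_right hG]

theorem riemannZeta_critPt_ne_zero_of_le {t : ℝ} (ht : |t| ≤ 6.344) :
    riemannZeta (critPt t) ≠ 0 := by
  rw [Ne, riemannZeta_critPt_eq_zero_iff]
  exact (critXi_neg_of_le ht).ne

theorem IsThetaCritical.zeta_ne_zero {a t : ℝ} (ha : IsThetaCritical a) (h : |t| ≤ a) :
    riemannZeta (critPt t) ≠ 0 :=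
  riemannZeta_critPt_ne_zero_of_le (h.trans ha.bounds.2.le)

open Complex in
-- The sign for which the numerical estimates are made. With c = Im ψ / 2 ≥ 0.813 and Ξ(a) < 0, one
-- has Ξ' + cΞ ≤ Ξ' + 0.813 Ξ < 0, and multiplying by -Ξ(a) > 0 keeps it negative.
theorem IsThetaCritical.deriv_zeta_mul_conj_im_neg {a : ℝ} (ha : IsThetaCritical a) :
    (deriv riemannZeta (critPt a) * (starRingEnd ℂ) (riemannZeta (critPt a))).im < 0 := by
  obtain ⟨h1, h2⟩ := ha.bounds
  have hG : 0 < normSq (Gammaℝ (critPt a)) :=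
    normSq_pos.2 (Gammaℝ_ne_zero_of_re_pos (by rw [critPt_re]; norm_num))
  have hx : critXi a < 0 := critXi_neg_of_le (by rw [abs_of_pos ha.1]; exact h2.le)
  have hd := critXi_add_deriv_neg h1.le h2.le (hasDerivAt_critXi a).differentiableAt.hasDerivAt
  have hc := digamma_im_lower h1.le h2.le
  have h := deriv_zeta_mul_conj_im a
  have hneg : deriv critXi a + (digamma (1 / 4 + I * ((a / 2 : ℝ) : ℂ))).im / 2 * critXi a < 0 := by
    have : 0.813 ≤ (digamma (1 / 4 + I * ((a / 2 : ℝ) : ℂ))).im / 2 := by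
      norm_num at hc ⊢; linarith
    nlinarith
  by_contra! hcon
  have := mul_nonneg hG.le hcon
  rw [h] at this
  nlinarith

/-- If ζ' = 0, then `deriv_zeta_mul_conj_re` leaves ϑ' = 0 or ζ = 0. The former happens only at ±a,
where the negative imaginary part just found shows ζ' ≠ 0. -/
theorem zeta_eq_zero_of_deriv_eq_zero {t : ℝ} (h : deriv riemannZeta (critPt t) = 0) :
    riemannZeta (critPt t) = 0 := by
  obtain ⟨a, ha, -⟩ := existsUnique_isThetaCritical
  have h1 := deriv_zeta_mul_conj_re t
  rw [h, zero_mul, Complex.zero_re, eq_comm, mul_eq_zero, neg_eq_zero] at h1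
  rcases h1 with h1 | h1
  · exfalso
    have hne : deriv riemannZeta (critPt a) ≠ 0 := fun h0 => by
      have := ha.deriv_zeta_mul_conj_im_neg
      rw [h0] at this
      simp at this
    have habs := ha.abs_eq h1
    rcases abs_choice t with e | e <;> rw [e] at habs
    · exact hne (habs ▸ h)
    · apply hne
      rw [← habs, deriv_riemannZeta_critPt_neg, h, map_zero]
  · exact Complex.normSq_eq_zero.1 h1

/-! ### The Newton quotient ζ/ζ' on the critical line. -/

open Filter Topology in
/-- The Newton quotient `f / f'` extends analytically through the zeros of `f`, where it has a
simple zero with slope the reciprocal of the multiplicity. -/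
theorem AnalyticAt.exists_hasDerivAt_div_deriv {f : ℂ → ℂ} {z : ℂ} (hf : AnalyticAt ℂ f z)
    (h0 : f z = 0) (hne : ¬∀ᶠ w in 𝓝 z, f w = 0) :
    AnalyticAt ℂ (fun w => f w / deriv f w) z ∧
      ∃ m : ℕ, 0 < m ∧ HasDerivAt (fun w => f w / deriv f w) (1 / (m : ℂ)) z := by
  obtain ⟨n, g, hg, hgz, hev⟩ := hf.exists_eventuallyEq_pow_smul_nonzero_iff.2 hne
  have hn : n ≠ 0 := by
    rintro rfl
    have := hev.self_of_nhds
    simp [h0] at this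
    exact hgz this.symm
  obtain ⟨m, rfl⟩ := Nat.exists_eq_succ_of_ne_zero hn
  set D : ℂ → ℂ := fun w => ((m : ℂ) + 1) * g w + (w - z) * deriv g w with hD
  have hm : (m : ℂ) + 1 ≠ 0 := by exact_mod_cast m.succ_ne_zero
  have hDan : AnalyticAt ℂ D z := by
    have := hg.deriv
    fun_prop
  have hDz : D z ≠ 0 := by simp [hD, hm, hgz]
  -- Writing f = (w - z)^{m+1} g gives f' = (w - z)^m D. The identity includes w = z: even when
  -- f'(z) = 0, the convention 0/0 = 0 gives the correct value.
  have hq : (fun w => f w / deriv f w) =ᶠ[𝓝 z] fun w => (w - z) * (g w / D w) := by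
    filter_upwards [hev.eventually_nhds, hg.eventually_analyticAt,
      hDan.continuousAt.eventually_ne hDz] with w hw hgw hDw
    have hd : deriv f w = (w - z) ^ m * D w := by
      have e : f =ᶠ[𝓝 w] fun w => (w - z) ^ (m + 1) * g w := hw
      have h1 : HasDerivAt (fun w : ℂ => (w - z) ^ (m + 1) * g w)
          (((m + 1 : ℕ) : ℂ) * (w - z) ^ m * 1 * g w + (w - z) ^ (m + 1) * deriv g w) w :=
        (((hasDerivAt_id w).sub_const z).pow (m + 1)).mul hgw.differentiableAt.hasDerivAt
      rw [e.deriv_eq, h1.deriv, hD]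
      push_cast
      ring
    rw [hw.self_of_nhds, hd, smul_eq_mul]
    rcases eq_or_ne w z with rfl | hwz
    · simp
    · have : w - z ≠ 0 := sub_ne_zero.2 hwz
      field_simp
      simp only [Nat.succ_eq_add_one]
      ring
  have han : AnalyticAt ℂ (fun w => (w - z) * (g w / D w)) z := by
    have := hg.div hDan hDz
    exact (analyticAt_id.sub analyticAt_const).mul this
  refine ⟨han.congr hq.symm, m + 1, m.succ_pos, ?_⟩
  have h1 := ((hasDerivAt_id z).sub_const z).mul (hg.div hDan hDz).differentiableAt.hasDerivAt
  refine (h1.congr_deriv ?_).congr_of_eventuallyEq hq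
  simp only [id, sub_self, zero_mul, add_zero, one_mul, hD, Pi.div_apply]
  push_cast
  field_simp

theorem not_eventually_riemannZeta_eq_zero (t : ℝ) :
    ¬∀ᶠ w in nhds (critPt t), riemannZeta w = 0 := by
  intro h
  have hpre : IsPreconnected ({1}ᶜ : Set ℂ) :=
    (isConnected_compl_singleton_of_one_lt_rank (by simp) 1).isPreconnected
  have := analyticOn_riemannZeta.eqOn_zero_of_preconnected_of_eventuallyEq_zero hpre
    (critPt_ne_one t) h
  have h2 := this (show (2 : ℂ) ∈ ({1}ᶜ : Set ℂ) by norm_num)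
  exact riemannZeta_ne_zero_of_one_le_re (s := 2) (by norm_num) h2

/-- The Newton quotient `ζ / ζ'` on the critical line. -/
noncomputable def zetaNewton (t : ℝ) : ℂ :=
  riemannZeta (critPt t) / deriv riemannZeta (critPt t)

/-- A zero of ζ' on the line is a zero of ζ, and there the convention 0/0 = 0 agrees with the
analytic continuation. No point has to be excluded. -/
theorem analyticAt_zetaNewton (t : ℝ) : AnalyticAt ℝ zetaNewton t := by
  have hz := analyticAt_riemannZeta_critPt t
  have h : AnalyticAt ℂ (fun w => riemannZeta w / deriv riemannZeta w) (critPt t) := by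
    by_cases h0 : deriv riemannZeta (critPt t) = 0
    · exact (hz.exists_hasDerivAt_div_deriv (zeta_eq_zero_of_deriv_eq_zero h0)
        (not_eventually_riemannZeta_eq_zero t)).1
    · exact hz.div hz.deriv h0
  exact (h.restrictScalars (𝕜 := ℝ)).comp (analyticAt_critPt t)

open Filter Topology in
-- The slope 1/m of ζ/ζ' is multiplied by i along the line, so the imaginary part has derivative 1/m
-- > 0 at p, whatever the multiplicity.
theorem sign_zetaNewton_im {p : ℝ} (hp : riemannZeta (critPt p) = 0) :
    ∀ᶠ t in 𝓝 p, SignType.sign (zetaNewton t).im = SignType.sign (t - p) := by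
  obtain ⟨-, m, hm, hd⟩ := (analyticAt_riemannZeta_critPt p).exists_hasDerivAt_div_deriv hp
    (not_eventually_riemannZeta_eq_zero p)
  have h1 : HasDerivAt zetaNewton (Complex.I • (1 / (m : ℂ))) p :=
    hd.scomp p (hasDerivAt_critPt p)
  have h2 : HasDerivAt (fun t => (zetaNewton t).im) (1 / (m : ℝ)) p := by
    have := Complex.imCLM.hasFDerivAt.comp_hasDerivAt p h1
    refine this.congr_deriv ?_
    have e : (1 : ℂ) / (m : ℂ) = ((1 / (m : ℝ) : ℝ) : ℂ) := by push_cast; rfl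
    rw [e]
    simp
  refine eventually_nhdsWithin_sign_eq_of_deriv_pos ?_ ?_
  · rw [h2.deriv]
    positivity
  · simp [zetaNewton, hp]

/-! ### The phase, and existence, uniqueness and symmetry of κ. -/

/-- The right-hand side of the defining relation of `κ`. -/
noncomputable def kappaPhase (t : ℝ) : ℂ := 1 + 2 * ((deriv rsTheta t : ℝ) : ℂ) * zetaNewton t

theorem analyticAt_kappaPhase (t : ℝ) : AnalyticAt ℝ kappaPhase t := by
  have h1 : AnalyticAt ℝ (fun t => ((deriv rsTheta t : ℝ) : ℂ)) t :=
    (Complex.ofRealCLM.analyticAt _).comp (analyticAt_deriv_rsTheta t)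
  have h2 := analyticAt_zetaNewton t
  unfold kappaPhase
  fun_prop

/-- With d = ϑ', |ζ' + 2dζ|² - |ζ'|² = 4d (Re(ζ' conj ζ) + d|ζ|²), which vanishes by
`deriv_zeta_mul_conj_re`. -/
theorem norm_kappaPhase (t : ℝ) : ‖kappaPhase t‖ = 1 := by
  rw [kappaPhase, zetaNewton]
  set z := riemannZeta (critPt t) with hz
  set z' := deriv riemannZeta (critPt t) with hz'
  set d := deriv rsTheta t with hd
  rcases eq_or_ne z' 0 with h | h
  · simp [h]
  · have e : 1 + 2 * (d : ℂ) * (z / z') = (z' + 2 * d * z) / z' := by field_simp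
    have hn : Complex.normSq (z' + 2 * d * z) = Complex.normSq z' := by
      have h1 := deriv_zeta_mul_conj_re t
      rw [← hz, ← hz', ← hd] at h1
      simp only [Complex.mul_re, Complex.conj_re, Complex.conj_im, Complex.normSq_apply] at h1 ⊢
      simp
      linear_combination 4 * d * h1
    rw [e, norm_div, Complex.norm_def, Complex.norm_def, hn, div_self]
    rw [← Complex.norm_def]
    exact norm_ne_zero_iff.2 h

/-- At t = 0 conjugation symmetry makes ζ and ζ' real, so the real-part identity reads ζ' = -ϑ'ζ and
the phase is 1 - 2. -/
theorem kappaPhase_zero : kappaPhase 0 = -1 := by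
  have hz : riemannZeta (critPt 0) ≠ 0 := riemannZeta_critPt_ne_zero_of_le (by norm_num)
  have hz' : deriv riemannZeta (critPt 0) ≠ 0 := fun h => hz (zeta_eq_zero_of_deriv_eq_zero h)
  have h1 := deriv_zeta_mul_conj_re 0
  have e1 := riemannZeta_critPt_neg 0
  have e2 := deriv_riemannZeta_critPt_neg 0
  rw [neg_zero] at e1 e2
  obtain ⟨x, hx⟩ := Complex.conj_eq_iff_real.1 e1.symm
  obtain ⟨y, hy⟩ := Complex.conj_eq_iff_real.1 e2.symm
  rw [kappaPhase, zetaNewton]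
  rw [hx] at h1 hz ⊢
  rw [hy] at h1 hz' ⊢
  rw [Complex.conj_ofReal, ← Complex.ofReal_mul, Complex.ofReal_re, Complex.normSq_ofReal] at h1
  have hx0 : x ≠ 0 := by exact_mod_cast hz
  have hyd : y = -deriv rsTheta 0 * x := mul_right_cancel₀ hx0 (by rw [h1]; ring)
  have hd : deriv rsTheta 0 * x = -y := by rw [hyd]; ring
  have hc : ((deriv rsTheta 0 : ℝ) : ℂ) * (x : ℂ) = -(y : ℂ) := by exact_mod_cast hd
  field_simp
  linear_combination 2 * hc

theorem kappaPhase_neg (t : ℝ) : kappaPhase (-t) = (starRingEnd ℂ) (kappaPhase t) := by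
  simp only [kappaPhase, zetaNewton, riemannZeta_critPt_neg, deriv_riemannZeta_critPt_neg,
    deriv_rsTheta_neg, map_add, map_mul, map_div₀, map_one, Complex.conj_ofReal, map_ofNat]

open Filter Topology in
/-- A real analytic map from the line to the unit circle has a real analytic logarithm. -/
theorem exists_analytic_circle_lift {u : ℝ → ℂ} (hu : ∀ t, AnalyticAt ℝ u t)
    (hn : ∀ t, ‖u t‖ = 1) {c : ℝ}
    (h0 : Complex.exp (2 * Real.pi * Complex.I * (c : ℂ)) = u 0) :
    ∃ κ : ℝ → ℝ, (∀ t, AnalyticAt ℝ κ t) ∧ κ 0 = c ∧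
      ∀ t, Complex.exp (2 * Real.pi * Complex.I * (κ t : ℂ)) = u t := by
  have hne : ∀ t, u t ≠ 0 := fun t h => by have := hn t; rw [h, norm_zero] at this; norm_num at this
  have hud : ∀ t, HasDerivAt u (deriv u t) t := fun t => (hu t).differentiableAt.hasDerivAt
  -- The lift is the integral of the logarithmic derivative. Its real part vanishes because |u| = 1.
  set D : ℝ → ℂ := fun t => deriv u t / u t with hD
  have hDc : Continuous D := continuous_iff_continuousAt.2 fun t =>
    ((hu t).deriv.div (hu t) (hne t)).continuousAt
  set J : ℝ → ℂ := fun t => ∫ x in (0 : ℝ)..t, D x with hJ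
  have hJd : ∀ t, HasDerivAt J (D t) t := fun t =>
    intervalIntegral.integral_hasDerivAt_right (hDc.intervalIntegrable _ _)
      (hDc.stronglyMeasurableAtFilter _ _) hDc.continuousAt
  have hJ0 : J 0 = 0 := by simp [hJ]
  have hexp : ∀ t, u t = u 0 * Complex.exp (J t) := by
    intro t
    have hder : ∀ x, HasDerivAt (fun x => u x * Complex.exp (-J x)) 0 x := by
      intro x
      refine ((hud x).mul (hJd x).neg.cexp).congr_deriv ?_
      have : D x * u x = deriv u x := div_mul_cancel₀ _ (hne x)
      simp only [Pi.neg_apply]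
      rw [← this]
      ring
    have hc := is_const_of_deriv_eq_zero (fun x => (hder x).differentiableAt)
      (fun x => (hder x).deriv) t 0
    simp only [hJ0, neg_zero, Complex.exp_zero, mul_one] at hc
    rw [← hc, mul_assoc, ← Complex.exp_add]
    simp
  have hJre : ∀ t, (J t).re = 0 := by
    intro t
    have := congrArg norm (hexp t)
    rw [norm_mul, hn, hn, one_mul, Complex.norm_exp] at this
    exact (Real.exp_eq_one_iff _).1 this.symm
  have hpi : (2 * Real.pi) ≠ 0 := by positivity
  set κ : ℝ → ℝ := fun t => c + (J t).im / (2 * Real.pi) with hκ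
  have hκe : ∀ t, Complex.exp (2 * Real.pi * Complex.I * (κ t : ℂ)) = u t := by
    intro t
    rw [hexp t, ← h0, ← Complex.exp_add]
    congr 1
    have e : J t = ((J t).im : ℂ) * Complex.I := by
      apply Complex.ext <;> simp [hJre t]
    have hpi' : (Real.pi : ℂ) ≠ 0 := by exact_mod_cast Real.pi_ne_zero
    simp only [hκ]
    conv_rhs => rw [e]
    push_cast
    field_simp
  refine ⟨κ, fun t₀ => ?_, by simp [hκ, hJ0], hκe⟩
  -- Near t₀ the integral agrees with J(t₀) + log(u/u(t₀)) on the principal branch, since both have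
  -- derivative u'/u. This local form is visibly analytic.
  have hJan : AnalyticAt ℝ J t₀ := by
    set g : ℝ → ℂ := fun t => J t₀ + Complex.log (u t / u t₀) with hg
    have h1 : AnalyticAt ℝ (fun t => u t / u t₀) t₀ := (hu t₀).div analyticAt_const (hne t₀)
    have hslit : u t₀ / u t₀ ∈ Complex.slitPlane := by
      rw [div_self (hne t₀)]; exact Complex.one_mem_slitPlane
    have hgan : AnalyticAt ℝ g t₀ := by
      have := (analyticAt_clog hslit).restrictScalars (𝕜 := ℝ)
      exact analyticAt_const.add (this.comp (f := fun t => u t / u t₀) h1)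
    have hev : ∀ᶠ t in 𝓝 t₀, u t / u t₀ ∈ Complex.slitPlane :=
      h1.continuousAt.eventually (Complex.isOpen_slitPlane.mem_nhds hslit)
    obtain ⟨ε, hε, hball⟩ := Metric.eventually_nhds_iff_ball.1 hev
    refine hgan.congr ?_
    filter_upwards [Metric.ball_mem_nhds t₀ hε] with t ht
    have hder : ∀ x ∈ Metric.ball t₀ ε, HasDerivAt (fun x => g x - J x) 0 x := by
      intro x hx
      have h2 := (((hud x).div_const (u t₀)).clog_real (hball x hx)).const_add (J t₀)
      refine (h2.sub (hJd x)).congr_deriv ?_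
      have := hne x
      have := hne t₀
      simp only [hD]
      field_simp
      ring
    have hconst := IsOpen.is_const_of_deriv_eq_zero Metric.isOpen_ball
      (convex_ball t₀ ε).isPreconnected
      (fun x hx => (hder x hx).differentiableAt.differentiableWithinAt)
      (fun x hx => (hder x hx).deriv) ht (Metric.mem_ball_self hε)
    simp only [hg, div_self (hne t₀), Complex.log_one, add_zero, sub_self] at hconst
    exact sub_eq_zero.1 hconst
  exact analyticAt_const.add (((Complex.imCLM.analyticAt _).comp hJan).div analyticAt_const hpi)

theorem exists_isKappa : ∃ κ : ℝ → ℝ, IsKappa κ := by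
  have h0 : Complex.exp (2 * Real.pi * Complex.I * ((-(1 / 2) : ℝ) : ℂ)) = kappaPhase 0 := by
    rw [kappaPhase_zero]
    have : (2 * Real.pi * Complex.I * ((-(1 / 2) : ℝ) : ℂ)) = -(Real.pi * Complex.I) := by
      push_cast; ring
    rw [this, Complex.exp_neg, Complex.exp_pi_mul_I]
    norm_num
  obtain ⟨κ, h1, h2, h3⟩ := exists_analytic_circle_lift analyticAt_kappaPhase norm_kappaPhase h0
  exact ⟨κ, h1, h2, fun t _ => h3 t⟩

open Filter Topology in
theorem eventually_deriv_zeta_critPt_ne_zero (t : ℝ) :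
    ∀ᶠ x in 𝓝[≠] t, deriv riemannZeta (critPt x) ≠ 0 := by
  have han : AnalyticOnNhd ℝ (fun x => deriv riemannZeta (critPt x)) Set.univ := fun x _ =>
    ((analyticAt_riemannZeta_critPt x).deriv.restrictScalars (𝕜 := ℝ)).comp (analyticAt_critPt x)
  rcases (han t trivial).eventually_eq_zero_or_eventually_ne_zero with h | h
  · exfalso
    have h0 := han.eqOn_zero_of_preconnected_of_eventuallyEq_zero isPreconnected_univ trivial h
      (Set.mem_univ 0)
    exact riemannZeta_critPt_ne_zero_of_le (t := 0) (by norm_num) (zeta_eq_zero_of_deriv_eq_zero h0)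
  · exact h

open Filter Topology in
-- The zeros of ζ' on the line are isolated and both sides are continuous, so the relation extends
-- to all t.
theorem IsKappa.exp_eq {κ : ℝ → ℝ} (h : IsKappa κ) (t : ℝ) :
    Complex.exp (2 * Real.pi * Complex.I * (κ t : ℂ)) = kappaPhase t := by
  have hc1 : ContinuousAt (fun t => Complex.exp (2 * Real.pi * Complex.I * (κ t : ℂ))) t := by
    have := (h.1 t).continuousAt
    fun_prop
  have hc2 : ContinuousAt kappaPhase t := (analyticAt_kappaPhase t).continuousAt
  refine tendsto_nhds_unique_of_eventuallyEq (hc1.tendsto.mono_left nhdsWithin_le_nhds)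
    (hc2.tendsto.mono_left nhdsWithin_le_nhds) (l := 𝓝[≠] t) ?_
  filter_upwards [eventually_deriv_zeta_critPt_ne_zero t] with x hx using h.2.2 x hx

/-- The difference is continuous and integer-valued, hence constant. -/
theorem eq_of_exp_eq_of_continuous {κ₁ κ₂ : ℝ → ℝ} (h₁ : Continuous κ₁) (h₂ : Continuous κ₂)
    (h0 : κ₁ 0 = κ₂ 0) (h : ∀ t, Complex.exp (2 * Real.pi * Complex.I * (κ₁ t : ℂ)) =
      Complex.exp (2 * Real.pi * Complex.I * (κ₂ t : ℂ))) : κ₁ = κ₂ := by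
  have hint : ∀ t, ∃ n : ℤ, κ₁ t - κ₂ t = n := by
    intro t
    obtain ⟨n, hn⟩ := Complex.exp_eq_exp_iff_exists_int.1 (h t)
    refine ⟨n, ?_⟩
    have : (2 * Real.pi * Complex.I) * ((κ₁ t : ℂ) - κ₂ t) = (2 * Real.pi * Complex.I) * n := by
      linear_combination hn
    have := mul_left_cancel₀ Complex.two_pi_I_ne_zero this
    exact_mod_cast this
  choose n hn using hint
  have hnc : Continuous n := by
    have : Continuous fun t => (n t : ℝ) := by
      simp only [← hn]
      exact h₁.sub h₂
    exact Int.isClosedEmbedding_coe_real.isEmbedding.continuous_iff.2 this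
  have hconst : ∀ t, n t = n 0 := fun t =>
    IsPreconnected.constant (isPreconnected_univ (α := ℝ)) hnc.continuousOn trivial trivial
  funext t
  have e0 := hn 0
  have et := hn t
  rw [hconst t] at et
  linarith

theorem IsKappa.continuous {κ : ℝ → ℝ} (h : IsKappa κ) : Continuous κ :=
  continuous_iff_continuousAt.2 fun t => (h.1 t).continuousAt

theorem existsUnique_isKappa : ∃! κ : ℝ → ℝ, IsKappa κ := by
  obtain ⟨κ, hκ⟩ := exists_isKappa
  refine ⟨κ, hκ, fun κ' hκ' => ?_⟩
  refine eq_of_exp_eq_of_continuous hκ'.continuous hκ.continuous (hκ'.2.1.trans hκ.2.1.symm) ?_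
  intro t
  rw [hκ.exp_eq, hκ'.exp_eq]

/-- Both sides lift the conjugate phase, and they agree at 0 because κ(0) = -1/2. -/
theorem IsKappa.neg {κ : ℝ → ℝ} (h : IsKappa κ) (t : ℝ) : κ (-t) = -κ t - 1 := by
  have hc := h.continuous
  refine congrFun (eq_of_exp_eq_of_continuous (κ₁ := fun t => κ (-t)) (κ₂ := fun t => -κ t - 1)
    (by fun_prop) (by fun_prop) ?_ fun t => ?_) t
  · simp only [neg_zero, h.2.1]
    norm_num
  · rw [h.exp_eq, kappaPhase_neg, ← h.exp_eq, ← Complex.exp_conj]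
    have e : (2 * Real.pi * Complex.I * ((-κ t - 1 : ℝ) : ℂ)) =
        (starRingEnd ℂ) (2 * Real.pi * Complex.I * (κ t : ℂ)) - 2 * Real.pi * Complex.I := by
      simp only [map_mul, map_ofNat, Complex.conj_ofReal, Complex.conj_I]
      push_cast
      ring
    rw [e, Complex.exp_periodic.sub_eq]

/-! ### Hardy's theorem: the theta kernel as a Fourier transform of Ξ in a strip. -/

open Complex MeasureTheory Set Filter Topology in
/-- The integral of a holomorphic function that decays exponentially in a horizontal strip does not
depend on the horizontal line of integration. -/
theorem integral_horizontal_line_eq {f : ℂ → ℂ} {φ C b : ℝ} (hb : 0 < b)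
    (hf : DifferentiableOn ℂ f {z | |z.im| ≤ |φ|})
    (hC : ∀ x y : ℝ, |y| ≤ |φ| → ‖f (x + y * I)‖ ≤ C * Real.exp (-(b * |x|))) :
    Integrable (fun x : ℝ => f (x + φ * I)) ∧ ∫ x : ℝ, f (x + φ * I) = ∫ x : ℝ, f x := by
  have hint : ∀ y : ℝ, |y| ≤ |φ| → Integrable (fun x : ℝ => f (x + y * I)) := by
    intro y hy
    refine Integrable.mono' ((integrable_exp_neg_mul_abs hb).const_mul C)
      (Continuous.aestronglyMeasurable ?_) (Eventually.of_forall fun x => hC x y hy)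
    exact hf.continuousOn.comp_continuous (by fun_prop) fun x => by simpa using hy
  refine ⟨hint φ le_rfl, ?_⟩
  have h0 := hint 0 (by simp)
  simp only [ofReal_zero, zero_mul, add_zero] at h0
  have hlim := (intervalIntegral_tendsto_integral h0 tendsto_neg_atTop_atBot tendsto_id).sub
    (intervalIntegral_tendsto_integral (hint φ le_rfl) tendsto_neg_atTop_atBot tendsto_id)
  simp only [id] at hlim
  have hrect : ∀ T : ℝ, (∫ x : ℝ in -T..T, f x) - ∫ x : ℝ in -T..T, f (x + φ * I) =
      I * (∫ y : ℝ in (0 : ℝ)..φ, f (-T + y * I)) - I * ∫ y : ℝ in (0 : ℝ)..φ, f (T + y * I) := by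
    intro T
    have := integral_boundary_rect_eq_zero_of_differentiableOn f (-T) (T + φ * I) (by
      refine hf.mono fun z hz => ?_
      have h2 := (mem_reProdIm.1 hz).2
      simp only [neg_im, ofReal_im, neg_zero, add_im, mul_im, ofReal_re, I_im, mul_one, I_re,
        mul_zero, add_zero, zero_add] at h2
      simpa using abs_sub_left_of_mem_uIcc h2)
    simp only [neg_im, ofReal_im, neg_zero, ofReal_zero, zero_mul, add_zero, neg_re,
      ofReal_re, add_re, mul_re, I_re, mul_zero, I_im, sub_zero, add_im, mul_im,
      mul_one, zero_add, smul_eq_mul, ofReal_neg] at this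
    linear_combination this
  have hbound : ∀ T : ℝ, ‖(∫ x : ℝ in -T..T, f x) - ∫ x : ℝ in -T..T, f (x + φ * I)‖ ≤
      2 * (C * |φ| * Real.exp (-(b * |T|))) := by
    intro T
    have hv : ∀ T : ℝ, ‖∫ y : ℝ in (0 : ℝ)..φ, f (T + y * I)‖ ≤
        C * |φ| * Real.exp (-(b * |T|)) := by
      intro T
      have := intervalIntegral.norm_integral_le_of_norm_le_const (a := 0) (b := φ)
        (f := fun y : ℝ => f (T + y * I)) (C := C * Real.exp (-(b * |T|))) fun y hy =>
          hC T y (by simpa using abs_sub_left_of_mem_uIcc (uIoc_subset_uIcc hy))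
      rw [sub_zero] at this
      linarith
    have h1 := hv (-T)
    have h2 := hv T
    rw [abs_neg] at h1
    push_cast at h1
    rw [hrect]
    refine (norm_sub_le _ _).trans ?_
    simp only [norm_mul, norm_I, one_mul]
    linarith
  have hzero : Tendsto (fun T : ℝ => 2 * (C * |φ| * Real.exp (-(b * |T|)))) atTop (𝓝 0) := by
    have h1 : Tendsto (fun T : ℝ => Real.exp (-(b * |T|))) atTop (𝓝 0) :=
      Real.tendsto_exp_neg_atTop_nhds_zero.comp (tendsto_abs_atTop_atTop.const_mul_atTop hb)
    simpa using (h1.const_mul (C * |φ|)).const_mul 2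
  have := tendsto_nhds_unique hlim (squeeze_zero_norm hbound hzero)
  exact (sub_eq_zero.1 this).symm

open Complex in
theorem norm_jacobiTheta_sub_one_le_inv {τ : ℂ} (hτ : 0 < τ.im) :
    ‖jacobiTheta τ - 1‖ ≤ 1 / τ.im := by
  refine (norm_jacobiTheta_sub_one_le hτ).trans ?_
  set u := Real.pi * τ.im with hu
  have hu0 : 0 < u := by positivity
  have h1 : 1 + u ≤ Real.exp u := by linarith [Real.add_one_le_exp u]
  have e : -Real.pi * τ.im = -u := by ring
  rw [e, Real.exp_neg]
  have h2 : 0 < Real.exp u := Real.exp_pos u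
  have h3 : 2 / (1 - (Real.exp u)⁻¹) * (Real.exp u)⁻¹ = 2 / (Real.exp u - 1) := by
    have : Real.exp u - 1 ≠ 0 := by linarith
    field_simp
  rw [h3, div_le_div_iff₀ (by linarith) hτ]
  nlinarith [Real.pi_gt_three]

open Complex in
theorem jacobiTheta_eq_inv_cpow_mul (τ : ℂ) :
    jacobiTheta τ = 1 / (-I * τ) ^ (1 / 2 : ℂ) * jacobiTheta (-1 / τ) := by
  have := jacobiTheta₂_functional_equation 0 τ
  simpa [jacobiTheta_eq_jacobiTheta₂] using this

/-- The holomorphic kernel whose Fourier transform is the completed zeta function on the critical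
line. -/
noncomputable def thetaKernel (z : ℂ) : ℂ :=
  (Complex.exp (z / 4) * jacobiTheta (Complex.I * Complex.exp z) - Complex.exp (z / 4) -
    Complex.exp (-z / 4)) / 2

open Complex in
theorem I_mul_exp_im (z : ℂ) : (I * exp z).im = Real.exp z.re * Real.cos z.im := by
  simp [exp_re]

open Complex in
theorem I_mul_exp_im_pos {z : ℂ} (hz : |z.im| < Real.pi / 2) : 0 < (I * exp z).im := by
  rw [I_mul_exp_im]
  have := abs_lt.1 hz
  exact mul_pos (Real.exp_pos _) (Real.cos_pos_of_mem_Ioo ⟨this.1, this.2⟩)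

open Complex in
-- Evenness is Jacobi's functional equation at τ = i e^z. The strip |Im z| < π/2 is where τ lies in
-- the upper half-plane.
theorem thetaKernel_neg {z : ℂ} (hz : |z.im| < Real.pi / 2) :
    thetaKernel (-z) = thetaKernel z := by
  have h := jacobiTheta_eq_inv_cpow_mul (I * exp z)
  have e1 : -I * (I * exp z) = exp z := by rw [← mul_assoc, neg_mul, I_mul_I, neg_neg, one_mul]
  have e2 : -1 / (I * exp z) = I * exp (-z) := by
    rw [exp_neg]
    have := exp_ne_zero z
    field_simp
    rw [I_sq]
  have hz' := abs_lt.1 hz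
  have e3 : (exp z) ^ (1 / 2 : ℂ) = exp (z / 2) := by
    rw [cpow_def_of_ne_zero (exp_ne_zero z), log_exp (by linarith [Real.pi_pos])
      (by linarith [Real.pi_pos])]
    ring_nf
  rw [e1, e2, e3] at h
  have e4 : exp (z / 4) = exp (-z / 4) * exp (z / 2) := by rw [← exp_add]; ring_nf
  have h5 : exp (z / 4) * jacobiTheta (I * exp z) = exp (-z / 4) * jacobiTheta (I * exp (-z)) := by
    rw [h, e4]
    have := exp_ne_zero (z / 2)
    field_simp
  rw [thetaKernel, thetaKernel, neg_neg, h5]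
  ring

open Complex in
theorem differentiableAt_thetaKernel {z : ℂ} (hz : |z.im| < Real.pi / 2) :
    DifferentiableAt ℂ thetaKernel z := by
  have h1 : DifferentiableAt ℂ (fun z => jacobiTheta (I * exp z)) z :=
    (differentiableAt_jacobiTheta (I_mul_exp_im_pos hz)).comp (f := fun z => I * exp z) z
      (by fun_prop)
  unfold thetaKernel
  fun_prop

open Complex in
-- For x ≥ 0 the bound |θ - 1| ≤ e^{-x}/cos φ beats the factor e^{x/4}, and the other term is
-- e^{-x/4}. Evenness covers x < 0.
theorem norm_thetaKernel_le {φ : ℝ} (hφ : φ < Real.pi / 2) {x y : ℝ} (hy : |y| ≤ φ) :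
    ‖thetaKernel (x + y * I)‖ ≤ (1 + 1 / Real.cos φ) * Real.exp (-(1 / 4 * |x|)) := by
  wlog hx : 0 ≤ x generalizing x y
  · have := this (x := -x) (y := -y) (by rwa [abs_neg]) (by linarith)
    rw [abs_neg] at this
    rw [← thetaKernel_neg (by simpa using hy.trans_lt hφ)]
    convert this using 3
    push_cast
    ring
  have hφ0 : 0 ≤ φ := (abs_nonneg y).trans hy
  have hc : 0 < Real.cos φ := Real.cos_pos_of_mem_Ioo ⟨by linarith, hφ⟩
  have hcy : Real.cos φ ≤ Real.cos y := by
    rw [← Real.cos_abs y]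
    exact Real.cos_le_cos_of_nonneg_of_le_pi (abs_nonneg y) (by linarith [Real.pi_pos]) hy
  set z : ℂ := x + y * I with hz
  have hre : z.re = x := by simp [hz]
  have him : z.im = y := by simp [hz]
  have h1 := norm_jacobiTheta_sub_one_le_inv (I_mul_exp_im_pos (z := z) (by
    rw [him]; exact hy.trans_lt hφ))
  rw [I_mul_exp_im, hre, him] at h1
  have hex := Real.exp_pos x
  have h2 : ‖jacobiTheta (I * exp z) - 1‖ ≤ Real.exp (-x) / Real.cos φ := by
    refine h1.trans ?_
    rw [Real.exp_neg, inv_eq_one_div, div_div]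
    exact one_div_le_one_div_of_le (by positivity) (by gcongr)
  have n1 : ‖exp (z / 4)‖ = Real.exp (x / 4) := by rw [norm_exp]; simp [hz]
  have n2 : ‖exp (-z / 4)‖ = Real.exp (-(x / 4)) := by rw [norm_exp]; simp [hz, neg_div]
  have e : thetaKernel z = (exp (z / 4) * (jacobiTheta (I * exp z) - 1) - exp (-z / 4)) / 2 := by
    rw [thetaKernel]; ring
  have h3 : Real.exp (x / 4) * Real.exp (-x) ≤ Real.exp (-(x / 4)) := by
    rw [← Real.exp_add]
    exact Real.exp_le_exp.2 (by linarith)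
  have h4 : -(1 / 4 * |x|) = -(x / 4) := by rw [abs_of_nonneg hx]; ring
  rw [e, norm_div, h4]
  have h5 : ‖exp (z / 4) * (jacobiTheta (I * exp z) - 1) - exp (-z / 4)‖ ≤
      Real.exp (x / 4) * (Real.exp (-x) / Real.cos φ) + Real.exp (-(x / 4)) := by
    refine (norm_sub_le _ _).trans ?_
    rw [norm_mul, n1, n2]
    gcongr
  have h6 : Real.exp (x / 4) * (Real.exp (-x) / Real.cos φ) ≤
      Real.exp (-(x / 4)) / Real.cos φ := by
    rw [← mul_div_assoc]
    gcongr
  have h7 : 0 ≤ Real.exp (-(x / 4)) / Real.cos φ := by positivity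
  rw [show ‖(2 : ℂ)‖ = 2 by simp]
  have h8 : (1 + 1 / Real.cos φ) * Real.exp (-(x / 4)) =
      Real.exp (-(x / 4)) + Real.exp (-(x / 4)) / Real.cos φ := by ring
  rw [h8]
  have := Real.exp_pos (-(x / 4))
  linarith

open Complex in
theorem thetaKernel_ofReal (L : ℝ) :
    thetaKernel L = (((critKernel |L| - Real.exp (-(1 / 4 * |L|))) / 2 : ℝ) : ℂ) := by
  have hpos : ∀ L : ℝ, thetaKernel L = (((critKernel L - Real.exp (-(1 / 4 * L))) / 2 : ℝ) : ℂ) := by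
    intro L
    rw [thetaKernel, critKernel]
    push_cast
    rw [evenKernel_zero_eq_jacobiTheta]
    push_cast
    rw [show -(L : ℂ) / 4 = -(1 / 4 * L) by ring]
    ring
  rcases abs_choice L with h | h
  · rw [h]; exact hpos L
  · rw [h, ← hpos, ofReal_neg, thetaKernel_neg (by simp [Real.pi_pos])]

open Complex MeasureTheory Set Filter in
theorem integral_exp_mul_comp_abs {g : ℝ → ℝ} (hg : Integrable fun u : ℝ => g |u|) (τ : ℝ) :
    ∫ u : ℝ, exp (((τ * u : ℝ) : ℂ) * I) * ((g |u| : ℝ) : ℂ) =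
      ((2 * ∫ u in Ioi (0 : ℝ), Real.cos (τ * u) * g u : ℝ) : ℂ) := by
  have hint : Integrable (fun u : ℝ => exp (((τ * u : ℝ) : ℂ) * I) * ((g |u| : ℝ) : ℂ)) := by
    refine Integrable.bdd_mul (c := 1) hg.ofReal ?_ ?_
    · exact Continuous.aestronglyMeasurable (by fun_prop)
    · exact Eventually.of_forall fun u => by rw [norm_exp_ofReal_mul_I]
  have hadd := integral_add hint hint.comp_neg
  rw [integral_neg_eq_self (fun u : ℝ => exp (((τ * u : ℝ) : ℂ) * I) * ((g |u| : ℝ) : ℂ)),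
    ← two_mul] at hadd
  have hcos : ∀ u : ℝ, exp (((τ * u : ℝ) : ℂ) * I) * ((g |u| : ℝ) : ℂ) +
      exp (((τ * -u : ℝ) : ℂ) * I) * ((g |(-u)| : ℝ) : ℂ) =
      ((2 * (Real.cos (τ * |u|) * g |u|) : ℝ) : ℂ) := by
    intro u
    have hc : Real.cos (τ * |u|) = Real.cos (τ * u) := by
      rcases abs_choice u with e | e <;> rw [e]
      rw [mul_neg, Real.cos_neg]
    rw [abs_neg, ← add_mul, hc]
    push_cast
    rw [Complex.cos]
    ring_nf
  simp only [hcos] at hadd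
  rw [integral_complex_ofReal, integral_const_mul,
    integral_comp_abs (f := fun u => Real.cos (τ * u) * g u)] at hadd
  push_cast at hadd ⊢
  linear_combination -hadd / 2

open MeasureTheory Set in
theorem integral_cos_mul_exp_neg (τ : ℝ) :
    ∫ u in Ioi (0 : ℝ), Real.cos (τ * u) * Real.exp (-(1 / 4 * u)) = 1 / 4 / (1 / 16 + τ ^ 2) := by
  have ha : (-(1 / 4) + τ * Complex.I : ℂ).re < 0 := by simp
  have h := integral_exp_mul_complex_Ioi ha 0
  have hi := integrableOn_exp_mul_complex_Ioi ha 0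
  have h2 := congrArg Complex.re h
  rw [← Complex.reCLM_apply, ← ContinuousLinearMap.integral_comp_comm _ hi] at h2
  have e : ∀ u : ℝ, Complex.reCLM (Complex.exp ((-(1 / 4) + τ * Complex.I) * u)) =
      Real.cos (τ * u) * Real.exp (-(1 / 4 * u)) := by
    intro u
    rw [Complex.reCLM_apply, Complex.exp_re]
    simp
    ring
  simp only [e] at h2
  rw [h2]
  simp [Complex.div_re, Complex.normSq]
  field_simp
  ring

open Complex MeasureTheory Set in
-- On the real line the kernel contains -e^{-|L|/4}/2, whose transform is exactly the pole term
-- -1/(1/4 + t²). So the result is Ξ itself and not only its entire part.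
theorem integral_exp_mul_thetaKernel (τ : ℝ) :
    ∫ L : ℝ, exp (((τ * L : ℝ) : ℂ) * I) * thetaKernel L = (critXi (2 * τ) : ℂ) := by
  have hi : Integrable fun u : ℝ => (critKernel |u| - Real.exp (-(1 / 4 * |u|))) / 2 :=
    (integrable_critKernel_abs.sub (integrable_exp_neg_mul_abs (by norm_num))).div_const 2
  simp only [thetaKernel_ofReal]
  rw [integral_exp_mul_comp_abs
    (g := fun u => (critKernel u - Real.exp (-(1 / 4 * u))) / 2) hi τ, critXi]
  congr 1
  have i1 : IntegrableOn (fun u => Real.cos (τ * u) * critKernel u) (Ioi 0) := by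
    refine integrableOn_Ioi_of_le_exp_neg (by have := continuous_critKernel; fun_prop) (C := 6) ?_
    intro L hL
    rw [abs_mul, abs_of_nonneg (critKernel_nonneg hL)]
    calc _ ≤ 1 * critKernel L := by
          gcongr
          · exact critKernel_nonneg hL
          · exact Real.abs_cos_le_one _
      _ ≤ 6 * Real.exp (-2 * L) := by rw [one_mul]; exact critKernel_le hL
      _ ≤ _ := by gcongr; linarith
  have i2 : IntegrableOn (fun u => Real.cos (τ * u) * Real.exp (-(1 / 4 * u))) (Ioi 0) := by
    have := exp_neg_integrableOn_Ioi 0 (show (0 : ℝ) < 1 / 4 by norm_num)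
    simp only [neg_mul] at this
    refine Integrable.bdd_mul (c := 1) this ?_ ?_
    · exact Continuous.aestronglyMeasurable (by fun_prop)
    · exact Filter.Eventually.of_forall fun u => Real.abs_cos_le_one _
  have e : ∀ u, Real.cos (τ * u) * ((critKernel u - Real.exp (-(1 / 4 * u))) / 2) =
      (1 / 2) * (Real.cos (τ * u) * critKernel u - Real.cos (τ * u) * Real.exp (-(1 / 4 * u))) := by
    intro u; ring
  simp only [e]
  rw [integral_const_mul, integral_sub i1 i2, integral_cos_mul_exp_neg]
  have e2 : 1 / (1 / 4 + (2 * τ) ^ 2) = 1 / 4 / (1 / 16 + τ ^ 2) := by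
    field_simp; ring
  rw [e2, show 2 * τ / 2 = τ by ring]
  ring

open Complex MeasureTheory Set Filter FourierTransform in
-- Shifting the line of integration to height φ multiplies the transform by e^{-2πwφ}.
theorem fourier_thetaKernel {φ : ℝ} (hφ : |φ| < Real.pi / 2) :
    Integrable (fun x : ℝ => thetaKernel (x + φ * I)) ∧
    ∀ w : ℝ, 𝓕 (fun x : ℝ => thetaKernel (x + φ * I)) w =
      ((Real.exp (-(2 * Real.pi * w * φ)) * critXi (4 * Real.pi * w) : ℝ) : ℂ) := by
  have hdiff : DifferentiableOn ℂ thetaKernel {z | |z.im| ≤ |φ|} := fun z hz =>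
    (differentiableAt_thetaKernel (lt_of_le_of_lt hz hφ)).differentiableWithinAt
  refine ⟨(integral_horizontal_line_eq (b := 1 / 4) (by norm_num) hdiff
    fun x y hy => norm_thetaKernel_le hφ hy).1, fun w => ?_⟩
  have h := (integral_horizontal_line_eq (φ := φ) (b := 1 / 4)
    (C := Real.exp (2 * Real.pi * |w| * |φ|) * (1 + 1 / Real.cos |φ|))
    (f := fun z => exp (-2 * Real.pi * w * I * z) * thetaKernel z) (by norm_num)
    (DifferentiableOn.mul (Differentiable.differentiableOn (by fun_prop)) hdiff) ?_).2
  · have e1 : ∀ x : ℝ, exp (-2 * Real.pi * w * I * (x + φ * I)) * thetaKernel (x + φ * I) =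
        exp (2 * Real.pi * w * φ) *
          (exp ((-2 * Real.pi * x * w : ℝ) * I) • thetaKernel (x + φ * I)) := by
      intro x
      rw [smul_eq_mul, ← mul_assoc, ← exp_add]
      congr 2
      push_cast
      linear_combination (-2 * Real.pi * w * φ : ℂ) * I_sq
    have e2 : ∀ x : ℝ, exp (-2 * Real.pi * w * I * x) * thetaKernel x =
        exp (((-2 * Real.pi * w * x : ℝ) : ℂ) * I) * thetaKernel x := by
      intro x
      congr 2
      push_cast
      ring
    simp only [e1, e2] at h
    rw [integral_const_mul, integral_exp_mul_thetaKernel, ← Real.fourier_real_eq_integral_exp_smul,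
      show 2 * (-2 * Real.pi * w) = -(4 * Real.pi * w) by ring, critXi_neg] at h
    push_cast
    rw [← h, ← mul_assoc, ← exp_add]
    simp
  · intro x y hy
    rw [norm_mul, mul_assoc (Real.exp _)]
    refine mul_le_mul ?_ (norm_thetaKernel_le hφ hy) (norm_nonneg _) (Real.exp_pos _).le
    rw [norm_exp]
    refine Real.exp_le_exp.2 ?_
    have : (-2 * Real.pi * w * I * (x + y * I) : ℂ).re = 2 * Real.pi * (w * y) := by
      simp
      ring
    rw [this, mul_assoc (2 * Real.pi)]
    have h3 : w * y ≤ |w| * |φ| := (le_abs_self _).trans (by rw [abs_mul]; gcongr)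
    have := Real.pi_pos
    gcongr

theorem continuous_critXi : Continuous critXi :=
  continuous_iff_continuousAt.2 fun t => (hasDerivAt_critXi t).continuousAt

open Complex MeasureTheory in
-- A Fourier transform is bounded by the L¹ norm. At -|w| the exponential factor is large, so Ξ must
-- be correspondingly small, and Ξ is even.
theorem exists_abs_critXi_le {φ : ℝ} (hφ0 : 0 ≤ φ) (hφ : φ < Real.pi / 2) :
    ∃ C, ∀ w : ℝ, |critXi (4 * Real.pi * w)| ≤ C * Real.exp (-(2 * Real.pi * φ * |w|)) := by
  have hφ' : |φ| < Real.pi / 2 := by rwa [abs_of_nonneg hφ0]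
  obtain ⟨-, hF⟩ := fourier_thetaKernel hφ'
  refine ⟨∫ x : ℝ, ‖thetaKernel (x + φ * I)‖, fun w => ?_⟩
  have hw : |critXi (4 * Real.pi * w)| = |critXi (4 * Real.pi * (-|w|))| := by
    rcases abs_choice w with h | h <;> rw [h]
    · rw [mul_neg, critXi_neg]
    · rw [neg_neg]
  have h1 := hF (-|w|)
  rw [Real.fourier_real_eq_integral_exp_smul] at h1
  have h2 := norm_integral_le_integral_norm
    (fun v : ℝ => exp ((-2 * Real.pi * v * -|w| : ℝ) * I) • thetaKernel (v + φ * I))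
    (μ := volume)
  rw [h1, norm_real, Real.norm_eq_abs, abs_mul, Real.abs_exp, ← hw] at h2
  simp only [norm_smul, norm_exp_ofReal_mul_I, one_mul] at h2
  rw [Real.exp_neg, ← div_eq_mul_inv, le_div_iff₀ (Real.exp_pos _), mul_comm]
  rwa [show -(2 * Real.pi * -|w| * φ) = 2 * Real.pi * φ * |w| by ring] at h2

open MeasureTheory in
theorem integrable_exp_mul_critXi {φ : ℝ} (hφ : |φ| < Real.pi / 2) :
    Integrable fun w : ℝ => Real.exp (-(2 * Real.pi * w * φ)) * critXi (4 * Real.pi * w) := by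
  have h0 := abs_nonneg φ
  -- The midpoint between |φ| and π/2 leaves exponential decay after multiplication by e^{-2πwφ}.
  obtain ⟨C, hC⟩ := exists_abs_critXi_le (φ := (|φ| + Real.pi / 2) / 2) (by linarith) (by linarith)
  have hb : 0 < 2 * Real.pi * ((Real.pi / 2 - |φ|) / 2) := by
    have := Real.pi_pos
    have : 0 < Real.pi / 2 - |φ| := by linarith
    positivity
  refine Integrable.mono' ((integrable_exp_neg_mul_abs hb).const_mul C) ?_
    (Filter.Eventually.of_forall fun w => ?_)
  · have := continuous_critXi
    exact Continuous.aestronglyMeasurable (by fun_prop)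
  · rw [norm_mul, Real.norm_eq_abs, Real.abs_exp, Real.norm_eq_abs]
    have h1 : -(2 * Real.pi * w * φ) ≤ 2 * Real.pi * |φ| * |w| := by
      have : -(w * φ) ≤ |φ| * |w| := by
        rw [mul_comm |φ|, ← abs_mul]
        exact neg_le_abs _
      nlinarith [Real.pi_pos]
    calc _ ≤ Real.exp (2 * Real.pi * |φ| * |w|) *
          (C * Real.exp (-(2 * Real.pi * ((|φ| + Real.pi / 2) / 2) * |w|))) := by
          gcongr
          exact hC w
      _ = C * (Real.exp (2 * Real.pi * |φ| * |w|) *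
          Real.exp (-(2 * Real.pi * ((|φ| + Real.pi / 2) / 2) * |w|))) := by ring
      _ = _ := by
          rw [← Real.exp_add]
          congr 2
          ring

open Complex MeasureTheory FourierTransform in
theorem thetaKernel_eq_integral {φ : ℝ} (hφ : |φ| < Real.pi / 2) (L : ℝ) :
    thetaKernel (L + φ * I) = ∫ w : ℝ, exp (((2 * Real.pi * (w * L) : ℝ) : ℂ) * I) *
      ((Real.exp (-(2 * Real.pi * w * φ)) * critXi (4 * Real.pi * w) : ℝ) : ℂ) := by
  obtain ⟨hi, hF⟩ := fourier_thetaKernel hφ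
  have hF' : 𝓕 (fun x : ℝ => thetaKernel (x + φ * I)) = fun w : ℝ =>
      ((Real.exp (-(2 * Real.pi * w * φ)) * critXi (4 * Real.pi * w) : ℝ) : ℂ) := funext hF
  have hc : ContinuousAt (fun x : ℝ => thetaKernel (x + φ * I)) L := by
    refine ContinuousAt.comp (f := fun x : ℝ => (x + φ * I : ℂ)) (g := thetaKernel)
      (differentiableAt_thetaKernel ?_).continuousAt (by fun_prop)
    simpa using hφ
  have h := hi.fourierInv_fourier_eq (by rw [hF']; exact (integrable_exp_mul_critXi hφ).ofReal) hc
  rw [hF', Real.fourierInv_eq'] at h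
  rw [← h]
  refine integral_congr_ae (Filter.Eventually.of_forall fun w => ?_)
  simp only [smul_eq_mul]
  congr 5
  simp [mul_comm]

open Complex MeasureTheory Set in
/-- If the completed zeta function has constant sign far out on the critical line, then the values of
`thetaKernel` at `iφ` control its values on the line through `iφ`, uniformly in `φ`. -/
theorem exists_norm_thetaKernel_le_add {T σ : ℝ} (hσ : σ = 1 ∨ σ = -1)
    (hT : ∀ w : ℝ, T < |w| → 0 ≤ σ * critXi (4 * Real.pi * w)) :
    ∃ C, ∀ φ : ℝ, |φ| < Real.pi / 2 → ∀ L : ℝ,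
      ‖thetaKernel (L + φ * I)‖ ≤ ‖thetaKernel (φ * I)‖ + C := by
  -- `k` pays for the wrong sign on [-T, T], where |Y| - σY ≤ 2|Y| and |2πwφ| ≤ π²T. It does not
  -- depend on φ.
  set k : ℝ → ℝ := indicator (Icc (-T) T) fun w =>
    2 * Real.exp (Real.pi ^ 2 * T) * |critXi (4 * Real.pi * w)| with hk
  have hki : Integrable k := by
    rw [hk, integrable_indicator_iff measurableSet_Icc]
    have := continuous_critXi
    exact (Continuous.continuousOn (by fun_prop)).integrableOn_compact isCompact_Icc
  refine ⟨∫ w, k w, fun φ hφ L => ?_⟩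
  set Y : ℝ → ℝ := fun w => Real.exp (-(2 * Real.pi * w * φ)) * critXi (4 * Real.pi * w) with hY
  have hYi : Integrable Y := integrable_exp_mul_critXi hφ
  have h1 : ‖thetaKernel (L + φ * I)‖ ≤ ∫ w, |Y w| := by
    rw [thetaKernel_eq_integral hφ]
    refine (norm_integral_le_integral_norm _).trans (le_of_eq ?_)
    refine integral_congr_ae (Filter.Eventually.of_forall fun w => ?_)
    simp only [norm_mul, norm_exp_ofReal_mul_I, one_mul, norm_real, Real.norm_eq_abs, hY, abs_mul]
  have h2 : |∫ w, Y w| = ‖thetaKernel (φ * I)‖ := by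
    have := thetaKernel_eq_integral hφ 0
    simp only [ofReal_zero, zero_add, mul_zero, zero_mul, exp_zero, one_mul] at this
    rw [this, integral_complex_ofReal, norm_real, Real.norm_eq_abs]
  have h3 : ∀ w, |Y w| ≤ σ * Y w + k w := by
    intro w
    have hexp := Real.exp_pos (-(2 * Real.pi * w * φ))
    by_cases hw : T < |w|
    · have hk0 : k w = 0 := by
        rw [hk, indicator_of_notMem]
        rintro ⟨ha, hb⟩
        exact absurd (abs_le.2 ⟨ha, hb⟩) (not_le.2 hw)
      have h4 : 0 ≤ σ * Y w := by
        have := mul_nonneg hexp.le (hT w hw)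
        rw [hY]; linarith
      rw [hk0, add_zero, ← abs_of_nonneg h4, abs_mul σ]
      rcases hσ with rfl | rfl <;> simp only [abs_neg, abs_one, one_mul, le_refl]
    · rw [not_lt] at hw
      have hkw : k w = 2 * Real.exp (Real.pi ^ 2 * T) * |critXi (4 * Real.pi * w)| := by
        rw [hk, indicator_of_mem (mem_Icc.2 (abs_le.1 hw))]
      have h5 : |Y w| ≤ Real.exp (Real.pi ^ 2 * T) * |critXi (4 * Real.pi * w)| := by
        rw [hY, abs_mul, Real.abs_exp]
        gcongr
        have h6 : |w * φ| ≤ T * (Real.pi / 2) := by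
          rw [abs_mul]
          exact mul_le_mul hw hφ.le (abs_nonneg _) ((abs_nonneg _).trans hw)
        have := neg_abs_le (w * φ)
        nlinarith [Real.pi_pos]
      have h7 : -|Y w| ≤ σ * Y w := by
        rcases hσ with rfl | rfl
        · linarith [neg_abs_le (Y w)]
        · linarith [le_abs_self (Y w)]
      rw [hkw]
      linarith
  have h8 : ∫ w, |Y w| ≤ σ * (∫ w, Y w) + ∫ w, k w := by
    rw [← integral_const_mul, ← integral_add (hYi.const_mul σ) hki]
    exact integral_mono hYi.abs ((hYi.const_mul σ).add hki) h3
  have h9 : σ * (∫ w, Y w) ≤ ‖thetaKernel (φ * I)‖ := by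
    rw [← h2]
    rcases hσ with rfl | rfl
    · linarith [le_abs_self (∫ w, Y w)]
    · linarith [neg_le_abs (∫ w, Y w)]
  linarith

/-! ### The theta function at the cusps -1 and -2, and infinitely many zeros. -/

open Complex in
theorem norm_cpow_half (z : ℂ) : ‖z ^ (1 / 2 : ℂ)‖ = Real.sqrt ‖z‖ := by
  have : (1 / 2 : ℂ) = ((1 / 2 : ℝ) : ℂ) := by push_cast; rfl
  rw [this, norm_cpow_real, Real.sqrt_eq_rpow]

open Complex in
-- Translation by -1 multiplies the n-th term by (-1)^n. Adding θ(w) cancels the odd n and doubles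
-- the even ones, which form θ(4w).
theorem jacobiTheta_neg_one_add {w : ℂ} (hw : 0 < w.im) :
    jacobiTheta (-1 + w) = 2 * jacobiTheta (4 * w) - jacobiTheta w := by
  have h : ∀ {τ : ℂ}, 0 < τ.im →
      HasSum (fun n : ℤ => exp (Real.pi * I * (n : ℂ) ^ 2 * τ)) (jacobiTheta τ) := by
    intro τ hτ
    have := hasSum_jacobiTheta₂_term 0 hτ
    simpa only [jacobiTheta₂_term, mul_zero, zero_add, ← jacobiTheta_eq_jacobiTheta₂] using this
  have h1 := (h (τ := -1 + w) (by simpa using hw)).add (h hw)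
  have h2 := (h (τ := 4 * w) (by simpa using hw)).mul_left 2
  have hinj : Function.Injective fun m : ℤ => 2 * m := mul_right_injective₀ two_ne_zero
  have hexp : ∀ n : ℤ, exp (Real.pi * I * (n : ℂ) ^ 2 * (-1 + w)) =
      exp (Real.pi * I * (n : ℂ) ^ 2 * w) * (exp (Real.pi * I * (n : ℂ) ^ 2))⁻¹ := by
    intro n
    rw [← exp_neg, ← exp_add]
    congr 1
    ring
  have hodd : ∀ n : ℤ, n ∉ Set.range (fun m : ℤ => 2 * m) →
      exp (Real.pi * I * (n : ℂ) ^ 2 * (-1 + w)) + exp (Real.pi * I * (n : ℂ) ^ 2 * w) = 0 := by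
    intro n hn
    have hn' : Odd n := by
      rw [← Int.not_even_iff_odd]
      rintro ⟨m, hm⟩
      exact hn ⟨m, by simp only; omega⟩
    obtain ⟨m, hm⟩ := hn'.pow (n := 2)
    have hm' : (n : ℂ) ^ 2 = 2 * m + 1 := by exact_mod_cast hm
    have : exp (Real.pi * I * (n : ℂ) ^ 2) = -1 := by
      rw [hm', show (Real.pi * I * (2 * m + 1) : ℂ) = m * (2 * Real.pi * I) + Real.pi * I by ring,
        exp_add, exp_int_mul_two_pi_mul_I, exp_pi_mul_I, one_mul]
    rw [hexp, this]
    norm_num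
  have h3 := (hinj.hasSum_iff hodd).2 h1
  have h4 : (fun n : ℤ => exp (Real.pi * I * (n : ℂ) ^ 2 * (-1 + w)) +
      exp (Real.pi * I * (n : ℂ) ^ 2 * w)) ∘ (fun m : ℤ => 2 * m) =
      fun m : ℤ => 2 * exp (Real.pi * I * (m : ℂ) ^ 2 * (4 * w)) := by
    funext m
    have : exp (Real.pi * I * ((2 * m : ℤ) : ℂ) ^ 2) = 1 := by
      rw [show (Real.pi * I * ((2 * m : ℤ) : ℂ) ^ 2 : ℂ) = ((2 * m ^ 2 : ℤ) : ℂ) *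
        (2 * Real.pi * I) by push_cast; ring, exp_int_mul_two_pi_mul_I]
    simp only [Function.comp_apply, hexp, this]
    rw [inv_one, mul_one, ← two_mul]
    congr 2
    push_cast
    ring
  rw [h4] at h3
  linear_combination h3.unique h2

open Complex in
theorem jacobiTheta_neg_two_add (w : ℂ) : jacobiTheta (-2 + w) = jacobiTheta w := by
  rw [← jacobiTheta_two_add (-2 + w)]
  congr 1
  ring

open Complex in
theorem neg_one_div_im (w : ℂ) : (-1 / w).im = w.im / ‖w‖ ^ 2 := by
  rw [neg_div, neg_im, one_div, inv_im, neg_div, neg_neg, normSq_eq_norm_sq]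

open Complex in
/-- The theta function is bounded at the cusp `-1`. -/
theorem norm_jacobiTheta_neg_one_add_le {w : ℂ} (hw : ‖w‖ ≤ 2 * w.im) (hw0 : 0 < w.im)
    (hw1 : ‖w‖ ≤ 1) : ‖jacobiTheta (-1 + w)‖ ≤ 10 := by
  have hn : 0 < ‖w‖ := norm_pos_iff.2 fun h => by simp [h] at hw0
  have h4 : (-I * (4 * w)) ^ (1 / 2 : ℂ) = 2 * (-I * w) ^ (1 / 2 : ℂ) := by
    have hIw : -I * w ≠ 0 := mul_ne_zero (neg_ne_zero.2 I_ne_zero) (norm_pos_iff.1 hn)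
    have e : -I * (4 * w) = ((4 : ℝ) : ℂ) * (-I * w) := by push_cast; ring
    have h42 : (Real.log 4 : ℝ) = 2 * Real.log 2 := by
      rw [show (4 : ℝ) = 2 ^ 2 by norm_num, Real.log_pow]; norm_num
    rw [e, cpow_def_of_ne_zero (mul_ne_zero (by norm_num) hIw), cpow_def_of_ne_zero hIw,
      log_ofReal_mul (by norm_num) hIw, add_mul, exp_add, h42]
    congr 1
    push_cast
    rw [show (2 * (Real.log 2 : ℂ)) * (1 / 2) = ((Real.log 2 : ℝ) : ℂ) by ring, ← ofReal_exp,
      Real.exp_log two_pos]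
    norm_num
  -- The functional equation applied to 2θ(4w) - θ(w) produces equal leading terms that cancel. This
  -- is why θ stays bounded at this cusp.
  have key : jacobiTheta (-1 + w) = 1 / (-I * w) ^ (1 / 2 : ℂ) *
      ((jacobiTheta (-1 / (4 * w)) - 1) - (jacobiTheta (-1 / w) - 1)) := by
    rw [jacobiTheta_neg_one_add hw0, jacobiTheta_eq_inv_cpow_mul (4 * w),
      jacobiTheta_eq_inv_cpow_mul w, h4]
    ring
  have i1 : (-1 / (4 * w)).im = w.im / (4 * ‖w‖ ^ 2) := by
    rw [neg_one_div_im, norm_mul]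
    simp
    field_simp
  have b1 := norm_jacobiTheta_sub_one_le_inv (τ := -1 / (4 * w)) (by rw [i1]; positivity)
  have b2 := norm_jacobiTheta_sub_one_le_inv (τ := -1 / w) (by rw [neg_one_div_im]; positivity)
  rw [i1, one_div_div] at b1
  rw [neg_one_div_im, one_div_div] at b2
  have c1 : 4 * ‖w‖ ^ 2 / w.im ≤ 8 * ‖w‖ := by
    rw [div_le_iff₀ hw0]; nlinarith
  have c2 : ‖w‖ ^ 2 / w.im ≤ 2 * ‖w‖ := by
    rw [div_le_iff₀ hw0]; nlinarith
  have hs : 0 < Real.sqrt ‖w‖ := Real.sqrt_pos.2 hn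
  have hs1 : Real.sqrt ‖w‖ ≤ 1 := Real.sqrt_le_one.2 hw1
  have hss : Real.sqrt ‖w‖ ^ 2 = ‖w‖ := Real.sq_sqrt hn.le
  rw [key, norm_mul, norm_div, norm_cpow_half, norm_mul, norm_neg, norm_I, norm_one, one_mul,
    one_div, inv_mul_le_iff₀ hs]
  refine (norm_sub_le _ _).trans ?_
  nlinarith

open Complex in
-- By 2-periodicity the cusp -2 behaves like 0, where the functional equation shows growth of order
-- |w|^{-1/2}.
theorem norm_jacobiTheta_neg_two_add_ge {w : ℂ} (hw : ‖w‖ ≤ 2 * w.im) (hw0 : 0 < w.im)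
    (hw1 : ‖w‖ ≤ 1 / 4) : 1 / (2 * Real.sqrt ‖w‖) ≤ ‖jacobiTheta (-2 + w)‖ := by
  have hn : 0 < ‖w‖ := norm_pos_iff.2 fun h => by simp [h] at hw0
  have hs : 0 < Real.sqrt ‖w‖ := Real.sqrt_pos.2 hn
  rw [jacobiTheta_neg_two_add, jacobiTheta_eq_inv_cpow_mul, norm_mul, norm_div, norm_cpow_half,
    norm_mul, norm_neg, norm_I, norm_one, one_mul]
  have b2 := norm_jacobiTheta_sub_one_le_inv (τ := -1 / w) (by rw [neg_one_div_im]; positivity)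
  rw [neg_one_div_im, one_div_div] at b2
  have c2 : ‖w‖ ^ 2 / w.im ≤ 2 * ‖w‖ := by
    rw [div_le_iff₀ hw0]; nlinarith
  have h1 : 1 / 2 ≤ ‖jacobiTheta (-1 / w)‖ := by
    have := norm_sub_norm_le (1 : ℂ) (1 - jacobiTheta (-1 / w))
    rw [norm_sub_rev 1 (jacobiTheta (-1 / w)), sub_sub_cancel, norm_one] at this
    linarith
  calc 1 / (2 * Real.sqrt ‖w‖) = 1 / Real.sqrt ‖w‖ * (1 / 2) := by field_simp
    _ ≤ _ := by gcongr

open Complex in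
theorem norm_jacobiTheta_le_two_mul_norm_thetaKernel {z : ℂ} (hz : 0 ≤ z.re) :
    ‖jacobiTheta (I * exp z)‖ ≤ 2 * ‖thetaKernel z‖ + 2 := by
  have n1 : 1 ≤ ‖exp (z / 4)‖ := by
    rw [norm_exp]
    exact Real.one_le_exp (by simp; linarith)
  have n2 : ‖exp (-z / 4)‖ ≤ 1 := by
    rw [norm_exp]
    exact Real.exp_le_one_iff.2 (by simp; linarith)
  have e : exp (z / 4) * (jacobiTheta (I * exp z) - 1) = 2 * thetaKernel z + exp (-z / 4) := by
    rw [thetaKernel]; ring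
  have h1 : ‖exp (z / 4)‖ * ‖jacobiTheta (I * exp z) - 1‖ ≤ 2 * ‖thetaKernel z‖ + 1 := by
    rw [← norm_mul, e]
    refine (norm_add_le _ _).trans ?_
    rw [norm_mul, Complex.norm_two]
    gcongr
  have h2 := le_mul_of_one_le_left (norm_nonneg (jacobiTheta (I * exp z) - 1)) n1
  have h3 := norm_add_le (jacobiTheta (I * exp z) - 1) 1
  rw [sub_add_cancel, norm_one] at h3
  linarith

open Complex in
theorem norm_thetaKernel_le_norm_jacobiTheta {z : ℂ} (hz : z.re = 0) :
    ‖thetaKernel z‖ ≤ (‖jacobiTheta (I * exp z)‖ + 2) / 2 := by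
  have n1 : ‖exp (z / 4)‖ = 1 := by rw [norm_exp]; simp [hz]
  have n2 : ‖exp (-z / 4)‖ = 1 := by rw [norm_exp]; simp [hz]
  rw [thetaKernel, norm_div, Complex.norm_two]
  gcongr
  refine (norm_sub_le _ _).trans ?_
  rw [n2]
  have := norm_sub_le (exp (z / 4) * jacobiTheta (I * exp z)) (exp (z / 4))
  rw [norm_mul, n1] at this
  linarith

open Complex in
-- As φ → π/2 the point i e^{iφ} tends to the cusp -1, where θ is bounded, while for L = log 2 the
-- point i e^{L+iφ} tends to -2, where θ is unbounded.
theorem not_norm_thetaKernel_le_add (C : ℝ) :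
    ¬∀ φ : ℝ, |φ| < Real.pi / 2 → ∀ L : ℝ,
      ‖thetaKernel (L + φ * I)‖ ≤ ‖thetaKernel (φ * I)‖ + C := by
  intro h
  -- The assumed inequality would give |θ| ≤ M near -2, since the kernel is at most (10 + 2)/2 = 6
  -- at iφ. The choice of ε forces |θ| ≥ 2M there.
  set M : ℝ := 2 * (6 + |C|) + 2 with hM
  have hM14 : 14 ≤ M := by have := abs_nonneg C; linarith
  set ε : ℝ := 1 / (32 * M ^ 2) with hε
  have hε0 : 0 < ε := by positivity
  have hε1 : ε ≤ 1 / 8 := by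
    rw [hε]
    exact one_div_le_one_div_of_le (by norm_num) (by nlinarith)
  -- This makes |i e^{iφ} + 1|² = 2 - 2 sin φ equal to ε².
  set φ := Real.arcsin (1 - ε ^ 2 / 2) with hφ
  have hs : Real.sin φ = 1 - ε ^ 2 / 2 := Real.sin_arcsin (by nlinarith) (by nlinarith)
  have hφ2 : |φ| < Real.pi / 2 := by
    rw [abs_lt]
    exact ⟨Real.neg_pi_div_two_lt_arcsin.2 (by nlinarith), Real.arcsin_lt_pi_div_two.2 (by nlinarith)⟩
  have hc : 0 < Real.cos φ := Real.cos_pos_of_mem_Ioo ⟨(abs_lt.1 hφ2).1, (abs_lt.1 hφ2).2⟩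
  have hsc := Real.sin_sq_add_cos_sq φ
  set w : ℂ := ((1 - Real.sin φ : ℝ) : ℂ) + (Real.cos φ : ℝ) * I with hw
  have hwim : w.im = Real.cos φ := by simp [hw, cos_ofReal_re]
  have hwre : w.re = 1 - Real.sin φ := by simp [hw, sin_ofReal_re]
  have hwn : ‖w‖ = ε := by
    have h1 : ‖w‖ ^ 2 = ε ^ 2 := by
      rw [← normSq_eq_norm_sq, normSq_apply, hwim, hwre]
      nlinarith
    exact (pow_left_inj₀ (norm_nonneg _) hε0.le two_ne_zero).1 h1
  have hcε : ε ≤ 2 * Real.cos φ := by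
    refine le_of_sq_le_sq ?_ (by linarith)
    have hc2 : Real.cos φ ^ 2 = ε ^ 2 - ε ^ 4 / 4 := by
      rw [hs] at hsc
      linear_combination hsc
    have : ε ^ 4 ≤ ε ^ 2 := pow_le_pow_of_le_one hε0.le (by linarith) (by norm_num)
    have := sq_nonneg ε
    rw [mul_pow, hc2]
    linarith
  have hE : I * exp (φ * I) = -1 + w := by
    rw [exp_mul_I, ← ofReal_cos, ← ofReal_sin, hw]
    push_cast
    linear_combination (sin φ : ℂ) * I_sq
  have hE2 : I * exp ((Real.log 2 : ℝ) + φ * I) = -2 + 2 * w := by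
    rw [exp_add, ← ofReal_exp, Real.exp_log two_pos]
    push_cast
    linear_combination 2 * hE
  have hup := norm_jacobiTheta_neg_one_add_le (w := w) (by rw [hwn, hwim]; exact hcε)
    (by rw [hwim]; exact hc) (by rw [hwn]; linarith)
  have h2n : ‖2 * w‖ = 2 * ε := by rw [norm_mul, Complex.norm_two, hwn]
  have h2im : (2 * w).im = 2 * Real.cos φ := by rw [← hwim]; simp
  have hlow := norm_jacobiTheta_neg_two_add_ge (w := 2 * w) (by rw [h2n, h2im]; linarith)
    (by rw [h2im]; linarith) (by rw [h2n]; linarith)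
  have h2ε : Real.sqrt (2 * ε) = 1 / (4 * M) := by
    rw [Real.sqrt_eq_iff_mul_self_eq (by positivity) (by positivity), hε]
    field_simp
    norm_num
  rw [h2n, h2ε, ← hE2] at hlow
  rw [← hE] at hup
  have h1 := norm_jacobiTheta_le_two_mul_norm_thetaKernel (z := (Real.log 2 : ℝ) + φ * I)
    (by
      rw [add_re, ofReal_re, re_ofReal_mul, I_re, mul_zero, add_zero]
      exact Real.log_nonneg one_le_two)
  have h2 := norm_thetaKernel_le_norm_jacobiTheta (z := φ * I) (by simp)
  have h3 := h φ hφ2 (Real.log 2)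
  have h4 : 1 / (2 * (1 / (4 * M))) = 2 * M := by field_simp; norm_num
  have := le_abs_self C
  linarith

/-- The completed zeta function has arbitrarily large zeros on the critical line. -/
theorem exists_critXi_eq_zero_gt (T : ℝ) : ∃ t, T < t ∧ critXi t = 0 := by
  wlog hT0 : 0 ≤ T generalizing T
  · obtain ⟨t, ht, h⟩ := this 0 le_rfl
    exact ⟨t, by linarith, h⟩
  by_contra! hne
  obtain ⟨σ, hσ, hpos⟩ : ∃ σ : ℝ, (σ = 1 ∨ σ = -1) ∧ 0 < σ * critXi (T + 1) := by
    rcases lt_or_gt_of_ne (hne (T + 1) (by linarith)) with h | h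
    · exact ⟨-1, Or.inr rfl, by linarith⟩
    · exact ⟨1, Or.inl rfl, by linarith⟩
  have hsign : ∀ t, T < t → 0 ≤ σ * critXi t := by
    intro t ht
    by_contra! hneg
    have hcont : Continuous fun t => σ * critXi t := continuous_const.mul continuous_critXi
    obtain ⟨c, hc, hc0⟩ := intermediate_value_uIcc (a := t) (b := T + 1) hcont.continuousOn
      (Set.mem_uIcc.2 (Or.inl ⟨hneg.le, hpos.le⟩))
    have hTc : T < c := lt_of_lt_of_le (lt_min ht (by linarith)) hc.1
    have hσ0 : σ ≠ 0 := by rcases hσ with rfl | rfl <;> norm_num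
    exact (mul_ne_zero hσ0 (hne c hTc)) hc0
  obtain ⟨C, hC⟩ := exists_norm_thetaKernel_le_add (T := T) hσ fun w hw => by
    have h1 : critXi (4 * Real.pi * w) = critXi (4 * Real.pi * |w|) := by
      rcases abs_choice w with h | h <;> rw [h]
      rw [mul_neg, critXi_neg]
    rw [h1]
    refine hsign _ ?_
    have := abs_nonneg w
    nlinarith [Real.pi_gt_three]
  exact not_norm_thetaKernel_le_add C hC

/-! ### Enumeration of the ordinates of the zeros. -/

open Set in
/-- An unbounded set of reals that is finite below every bound has exactly one increasing
enumeration. -/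
theorem existsUnique_strictMono_range_eq {S : Set ℝ} (hinf : ∀ T : ℝ, ∃ t ∈ S, T < t)
    (hfin : ∀ T : ℝ, (S ∩ Iic T).Finite) : ∃! ξ : ℕ+ → ℝ, StrictMono ξ ∧ range ξ = S := by
  have hleast : ∀ U : Set ℝ, U ⊆ S → U.Nonempty → ∃ m, IsLeast U m := by
    rintro U hU ⟨t, ht⟩
    obtain ⟨m, hm, hmin⟩ := exists_min_image (U ∩ Iic t) id
      ((hfin t).subset (inter_subset_inter_left _ hU)) ⟨t, ht, mem_Iic.2 le_rfl⟩
    refine ⟨m, hm.1, fun s hs => ?_⟩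
    rcases le_total s t with h | h
    · exact hmin s ⟨hs, h⟩
    · exact (mem_Iic.1 hm.2).trans h
  obtain ⟨m₀, hm₀⟩ := hleast S Subset.rfl (let ⟨t, ht, _⟩ := hinf 0; ⟨t, ht⟩)
  choose next hnext using fun T => hleast (S ∩ Ioi T) inter_subset_left (hinf T)
  set f : ℕ → ℝ := fun n => n.rec m₀ fun _ x => next x with hf
  have hsucc : ∀ n, IsLeast (S ∩ Ioi (f n)) (f (n + 1)) := fun n => hnext (f n)
  have hmono : StrictMono f := strictMono_nat_of_lt_succ fun n => (hsucc n).1.2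
  have hfS : ∀ n, f n ∈ S := fun n => by
    cases n with
    | zero => exact hm₀.1
    | succ n => exact (hsucc n).1.1
  have hrange : range f = S := by
    refine Subset.antisymm (range_subset_iff.2 hfS) fun t ht => ?_
    have hex : ∃ n, t < f n := by
      by_contra! h
      exact infinite_range_of_injective hmono.injective
        ((hfin t).subset (range_subset_iff.2 fun n => ⟨hfS n, h n⟩))
    have hspec := Nat.find_spec hex
    have hmin := fun m => Nat.find_min hex (m := m)
    rcases hn : Nat.find hex with _ | k
    · rw [hn] at hspec
      exact absurd (hm₀.2 ht) (not_le.2 hspec)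
    · rw [hn] at hspec hmin
      refine ⟨k, le_antisymm (not_lt.1 (hmin k k.lt_succ_self)) ?_⟩
      by_contra! h
      exact absurd ((hsucc k).2 ⟨ht, h⟩) (not_le.2 hspec)
  refine ⟨fun n => f n.natPred, ⟨hmono.comp PNat.natPred_strictMono, ?_⟩, fun ξ hξ => ?_⟩
  · rw [← hrange]
    exact Equiv.pnatEquivNat.surjective.range_comp f
  · refine (StrictMono.range_inj hξ.1 (hmono.comp PNat.natPred_strictMono)).1 ?_
    rw [hξ.2, ← hrange]
    exact (Equiv.pnatEquivNat.surjective.range_comp f).symm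

open Filter Topology in
theorem eventually_zeta_critPt_ne_zero (t : ℝ) :
    ∀ᶠ x in 𝓝[≠] t, riemannZeta (critPt x) ≠ 0 := by
  have han : AnalyticOnNhd ℝ (fun x => riemannZeta (critPt x)) Set.univ := fun x _ =>
    ((analyticAt_riemannZeta_critPt x).restrictScalars (𝕜 := ℝ)).comp (analyticAt_critPt x)
  refine (han t trivial).eventually_eq_zero_or_eventually_ne_zero.resolve_left fun h => ?_
  have h0 := han.eqOn_zero_of_preconnected_of_eventuallyEq_zero isPreconnected_univ trivial h
    (Set.mem_univ 0)
  exact riemannZeta_critPt_ne_zero_of_le (t := 0) (by norm_num) h0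

open Set Filter Topology in
-- Hardy's theorem makes the set unbounded. Isolation of zeros makes it finite below every bound,
-- since an infinite bounded subset would accumulate.
theorem existsUnique_isCriticalLineOrdinates : ∃! ξ : ℕ+ → ℝ, IsCriticalLineOrdinates ξ := by
  refine existsUnique_strictMono_range_eq (fun T => ?_) fun T => ?_
  · obtain ⟨t, ht, h0⟩ := exists_critXi_eq_zero_gt (max T 0)
    exact ⟨t, ⟨(le_max_right _ _).trans_lt ht, (riemannZeta_critPt_eq_zero_iff t).2 h0⟩,
      (le_max_left _ _).trans_lt ht⟩
  · by_contra hinf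
    obtain ⟨x, -, hx⟩ := Set.Infinite.exists_accPt_of_subset_isCompact hinf
      (isCompact_Icc (a := 0) (b := T)) fun t ht => ⟨ht.1.1.le, ht.2⟩
    rw [accPt_iff_frequently_nhdsNE] at hx
    exact hx ((eventually_zeta_critPt_ne_zero x).mono fun y hy hy' => hy hy'.1.2)

/-! ### Integer values of κ and its upward crossings. -/

theorem IsKappa.kappaPhase_eq_one_iff {κ : ℝ → ℝ} (h : IsKappa κ) (t : ℝ) :
    kappaPhase t = 1 ↔ ∃ m : ℤ, κ t = m := by
  rw [← h.exp_eq, Complex.exp_eq_one_iff]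
  refine exists_congr fun m => ?_
  rw [mul_comm, mul_left_inj' Complex.two_pi_I_ne_zero]
  norm_cast

theorem IsThetaCritical.kappaPhase_eq_one_iff {a t : ℝ} (ha : IsThetaCritical a) :
    kappaPhase t = 1 ↔ |t| = a ∨ riemannZeta (critPt t) = 0 := by
  rw [kappaPhase, zetaNewton, add_eq_left]
  constructor
  · intro h
    rcases mul_eq_zero.1 h with h | h
    · rw [mul_eq_zero, or_iff_right two_ne_zero, Complex.ofReal_eq_zero] at h
      exact Or.inl (ha.abs_eq h)
    · exact Or.inr ((div_eq_zero_iff.1 h).elim id zeta_eq_zero_of_deriv_eq_zero)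
  · rintro (h | h)
    · have : deriv rsTheta t = 0 := by
        rcases abs_choice t with e | e
        · rw [← e, h, ha.2]
        · rw [← neg_neg t, deriv_rsTheta_neg, ← e, h, ha.2]
      simp [this]
    · simp [h]

theorem kappaPhase_im (t : ℝ) : (kappaPhase t).im = 2 * deriv rsTheta t * (zetaNewton t).im := by
  rw [kappaPhase]
  simp

theorem IsKappa.sin_eq {κ : ℝ → ℝ} (h : IsKappa κ) (t : ℝ) :
    Real.sin (2 * Real.pi * κ t) = 2 * deriv rsTheta t * (zetaNewton t).im := by
  rw [← kappaPhase_im, ← h.exp_eq]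
  have e : 2 * Real.pi * Complex.I * (κ t : ℂ) = ((2 * Real.pi * κ t : ℝ) : ℂ) * Complex.I := by
    push_cast; ring
  rw [e, Complex.exp_ofReal_mul_I_im]

open Filter Topology in
/-- A continuous function with an integer value at `p`, for which `sin (2πκ)` is negative to the left
of `p`, increases to that value from the left. -/
theorem eventually_lt_of_sin_neg {κ : ℝ → ℝ} {p : ℝ} {m : ℤ} (hc : ContinuousAt κ p) (hp : κ p = m)
    (hs : ∀ᶠ t in 𝓝[<] p, Real.sin (2 * Real.pi * κ t) < 0) : ∀ᶠ t in 𝓝[<] p, κ t < m := by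
  have h1 : ∀ᶠ t in 𝓝[<] p, κ t < m + 1 / 2 :=
    (hc.eventually (gt_mem_nhds (by rw [hp]; linarith))).filter_mono nhdsWithin_le_nhds
  filter_upwards [h1, hs] with t h1 h2
  by_contra! hm
  have h3 : Real.sin (2 * Real.pi * κ t) = Real.sin (2 * Real.pi * (κ t - m)) := by
    rw [mul_sub, mul_comm (2 * Real.pi) (m : ℝ), Real.sin_sub_int_mul_two_pi]
  have hpi := Real.pi_pos
  have h4 := Real.sin_nonneg_of_nonneg_of_le_pi (x := 2 * Real.pi * (κ t - m))
    (mul_nonneg (by positivity) (by linarith)) (by nlinarith)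
  linarith

open Filter Topology in
theorem eventually_gt_of_sin_pos {κ : ℝ → ℝ} {p : ℝ} {m : ℤ} (hc : ContinuousAt κ p) (hp : κ p = m)
    (hs : ∀ᶠ t in 𝓝[>] p, 0 < Real.sin (2 * Real.pi * κ t)) : ∀ᶠ t in 𝓝[>] p, (m : ℝ) < κ t := by
  have h1 : ∀ᶠ t in 𝓝[>] p, m - 1 / 2 < κ t :=
    (hc.eventually (lt_mem_nhds (by rw [hp]; linarith))).filter_mono nhdsWithin_le_nhds
  filter_upwards [h1, hs] with t h1 h2
  by_contra! hm
  have h3 : Real.sin (2 * Real.pi * κ t) = Real.sin (2 * Real.pi * (κ t - m)) := by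
    rw [mul_sub, mul_comm (2 * Real.pi) (m : ℝ), Real.sin_sub_int_mul_two_pi]
  have hpi := Real.pi_pos
  have h4 := Real.sin_nonpos_of_nonpos_of_neg_pi_le (x := 2 * Real.pi * (κ t - m))
    (mul_nonpos_of_nonneg_of_nonpos (by positivity) (by linarith)) (by nlinarith)
  linarith

open Filter Topology Set in
/-- A continuous function without integer values on `[r, q)` that starts in `(m, m + 1)` and reaches
an integer at `q` from below reaches `m + 1`. -/
theorem eq_add_one_of_forall_ne_int {κ : ℝ → ℝ} (hc : Continuous κ) {r q : ℝ} {m n : ℤ} (hrq : r < q)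
    (h1 : (m : ℝ) < κ r) (h2 : κ r < m + 1) (hne : ∀ t ∈ Ico r q, ∀ k : ℤ, κ t ≠ k)
    (hq : κ q = n) (hleft : ∀ᶠ t in 𝓝[<] q, κ t < n) : κ q = m + 1 := by
  have hmem : ∀ t ∈ Ico r q, (m : ℝ) < κ t ∧ κ t < m + 1 := by
    intro t ht
    have hsub : uIcc r t ⊆ Ico r q := by
      rw [uIcc_of_le ht.1]
      exact fun s hs => ⟨hs.1, hs.2.trans_lt ht.2⟩
    constructor
    · by_contra! h
      obtain ⟨s, hs, hsm⟩ := intermediate_value_uIcc hc.continuousOn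
        (mem_uIcc.2 (Or.inr ⟨h, h1.le⟩) : (m : ℝ) ∈ uIcc (κ r) (κ t))
      exact hne s (hsub hs) m hsm
    · by_contra! h
      obtain ⟨s, hs, hsm⟩ := intermediate_value_uIcc hc.continuousOn
        (mem_uIcc.2 (Or.inl ⟨h2.le, h⟩) : (m + 1 : ℝ) ∈ uIcc (κ r) (κ t))
      exact hne s (hsub hs) (m + 1) (by rw [hsm]; push_cast; rfl)
  have hev : ∀ᶠ t in 𝓝[<] q, t ∈ Ico r q := Ico_mem_nhdsLT hrq
  have hlim : Tendsto κ (𝓝[<] q) (𝓝 (κ q)) := hc.continuousAt.tendsto.mono_left nhdsWithin_le_nhds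
  have hle : κ q ≤ m + 1 := le_of_tendsto hlim (hev.mono fun t ht => (hmem t ht).2.le)
  -- The value at q could so far be m or m + 1. Approaching it from below, with values above m,
  -- rules out a return to m.
  obtain ⟨t, ht, htn⟩ := (hev.and hleft).exists
  have hlt := (hmem t ht).1.trans htn
  rw [hq] at hle ⊢
  have e1 : n ≤ m + 1 := by exact_mod_cast hle
  have e2 : m < n := by exact_mod_cast hlt
  have : n = m + 1 := by omega
  exact_mod_cast this

open Filter Topology in
-- Im(ζ/ζ') = -Im(ζ' conj ζ)/|ζ'|², which is positive at a by the numerical estimate and nearby by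
-- continuity.
theorem IsThetaCritical.eventually_zetaNewton_im_pos {a : ℝ} (ha : IsThetaCritical a) :
    ∀ᶠ t in 𝓝 a, 0 < (zetaNewton t).im := by
  have hc : ContinuousAt (fun t => (zetaNewton t).im) a :=
    Complex.continuous_im.continuousAt.comp (analyticAt_zetaNewton a).continuousAt
  refine hc.eventually (lt_mem_nhds ?_)
  have h := ha.deriv_zeta_mul_conj_im_neg
  set z := riemannZeta (critPt a)
  set z' := deriv riemannZeta (critPt a) with hz'
  have hz0 : z' ≠ 0 := fun h0 => by rw [h0] at h; simp at h
  have hn := Complex.normSq_pos.2 hz0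
  have e : (zetaNewton a).im = -(z' * (starRingEnd ℂ) z).im / Complex.normSq z' := by
    change (z / z').im = _
    rw [Complex.div_im, Complex.mul_im, Complex.conj_re, Complex.conj_im]
    field_simp
    ring
  change 0 < (zetaNewton a).im
  rw [e]
  exact div_pos (by linarith) hn

open Filter Topology in
-- In the product ϑ' Im(ζ/ζ') one factor changes sign and the other is positive: ϑ' changes sign at
-- a, and Im(ζ/ζ') at an ordinate, which always lies beyond a.
theorem IsKappa.eventually_sin_neg_and_pos {κ : ℝ → ℝ} (h : IsKappa κ) {a p : ℝ}
    (ha : IsThetaCritical a) (hp : p = a ∨ 0 < p ∧ riemannZeta (critPt p) = 0) :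
    (∀ᶠ t in 𝓝[<] p, Real.sin (2 * Real.pi * κ t) < 0) ∧
      ∀ᶠ t in 𝓝[>] p, 0 < Real.sin (2 * Real.pi * κ t) := by
  simp only [h.sin_eq]
  rcases hp with rfl | ⟨hp0, hp⟩
  · have hN := ha.eventually_zetaNewton_im_pos
    have h0 : ∀ᶠ t in 𝓝 p, 0 < t := lt_mem_nhds ha.1
    constructor
    · filter_upwards [hN.filter_mono nhdsWithin_le_nhds, h0.filter_mono nhdsWithin_le_nhds,
        self_mem_nhdsWithin] with t h1 h2 h3
      have := ha.deriv_neg (t := t) (by rw [abs_of_pos h2]; exact h3)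
      exact mul_neg_of_neg_of_pos (by linarith) h1
    · filter_upwards [hN.filter_mono nhdsWithin_le_nhds, h0.filter_mono nhdsWithin_le_nhds,
        self_mem_nhdsWithin] with t h1 h2 h3
      have := ha.deriv_pos (t := t) (by rw [abs_of_pos h2]; exact h3)
      exact mul_pos (by linarith) h1
  · have hap : a < p := by
      by_contra! hle
      exact ha.zeta_ne_zero (t := p) (by rw [abs_of_pos hp0]; exact hle) hp
    have hN := sign_zetaNewton_im hp
    have hd : ∀ᶠ t in 𝓝 p, 0 < deriv rsTheta t := by
      filter_upwards [lt_mem_nhds hap] with t ht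
      exact ha.deriv_pos (ht.trans_le (le_abs_self t))
    constructor
    · filter_upwards [hN.filter_mono nhdsWithin_le_nhds, hd.filter_mono nhdsWithin_le_nhds,
        self_mem_nhdsWithin] with t h1 h2 h3
      rw [sign_neg (sub_neg.2 h3), sign_eq_neg_one_iff] at h1
      exact mul_neg_of_pos_of_neg (by linarith) h1
    · filter_upwards [hN.filter_mono nhdsWithin_le_nhds, hd.filter_mono nhdsWithin_le_nhds,
        self_mem_nhdsWithin] with t h1 h2 h3
      rw [sign_pos (sub_pos.2 h3), sign_eq_one_iff] at h1
      exact mul_pos (by linarith) h1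

theorem IsCriticalLineOrdinates.pos {ξ : ℕ+ → ℝ} (hξ : IsCriticalLineOrdinates ξ) (n : ℕ+) :
    0 < ξ n ∧ riemannZeta (critPt (ξ n)) = 0 := by
  have : ξ n ∈ Set.range ξ := Set.mem_range_self n
  rwa [hξ.2] at this

theorem IsCriticalLineOrdinates.exists_eq {ξ : ℕ+ → ℝ} (hξ : IsCriticalLineOrdinates ξ) {t : ℝ}
    (ht : 0 < t) (h0 : riemannZeta (critPt t) = 0) : ∃ n, t = ξ n := by
  have : t ∈ Set.range ξ := by rw [hξ.2]; exact ⟨ht, h0⟩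
  obtain ⟨n, hn⟩ := this
  exact ⟨n, hn.symm⟩

theorem IsThetaCritical.lt_ordinate {a : ℝ} {ξ : ℕ+ → ℝ} (ha : IsThetaCritical a)
    (hξ : IsCriticalLineOrdinates ξ) (n : ℕ+) : a < ξ n := by
  by_contra! hle
  obtain ⟨h1, h2⟩ := hξ.pos n
  exact ha.zeta_ne_zero (by rwa [abs_of_pos h1]) h2

section

variable {κ : ℝ → ℝ} {a : ℝ} {ξ : ℕ+ → ℝ}

theorem IsKappa.eq_of_int_value (hκ : IsKappa κ) (ha : IsThetaCritical a)
    (hξ : IsCriticalLineOrdinates ξ) {t : ℝ} (h : ∃ m : ℤ, κ t = m) :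
    |t| = a ∨ ∃ n, |t| = ξ n := by
  rw [← hκ.kappaPhase_eq_one_iff, ha.kappaPhase_eq_one_iff] at h
  refine h.imp_right fun h0 => ?_
  have h1 : riemannZeta (critPt |t|) = 0 := by
    rcases abs_choice t with e | e <;> rw [e]
    · exact h0
    · rw [riemannZeta_critPt_neg, h0, map_zero]
  refine hξ.exists_eq (lt_of_not_ge fun hle => ?_) h1
  exact ha.zeta_ne_zero (t := |t|) (by rw [abs_abs]; linarith [ha.1]) h1

theorem IsKappa.apply_thetaCritical (hκ : IsKappa κ) (ha : IsThetaCritical a)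
    (hξ : IsCriticalLineOrdinates ξ) : κ a = 0 := by
  obtain ⟨k, hk⟩ := (hκ.kappaPhase_eq_one_iff a).1
    (ha.kappaPhase_eq_one_iff.2 (Or.inl (abs_of_pos ha.1)))
  have hleft := eventually_lt_of_sin_neg hκ.continuous.continuousAt hk
    (hκ.eventually_sin_neg_and_pos ha (Or.inl rfl)).1
  -- κ starts at -1/2, strictly between -1 and 0, and meets no integer on [0, a).
  have := eq_add_one_of_forall_ne_int hκ.continuous (m := -1) ha.1 (by rw [hκ.2.1]; norm_num)
    (by rw [hκ.2.1]; norm_num) (fun t ht m hm => ?_) hk hleft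
  · rw [this]; norm_num
  · have h1 := abs_of_nonneg ht.1
    rcases hκ.eq_of_int_value ha hξ ⟨m, hm⟩ with h | ⟨n, h⟩
    · exact ht.2.ne (by rw [← h, h1])
    · have := ha.lt_ordinate hξ n
      have := ht.2
      linarith

open Filter Topology in
/-- Between consecutive points of `{a, ξ₁, ξ₂, …}` the function `κ` increases by one. -/
theorem IsKappa.apply_next (hκ : IsKappa κ) (ha : IsThetaCritical a)
    (hξ : IsCriticalLineOrdinates ξ) {p : ℝ} {n : ℕ+} {m : ℤ}
    (hp : p = a ∨ 0 < p ∧ riemannZeta (critPt p) = 0) (hpm : κ p = m) (hpn : p < ξ n)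
    (hne : ∀ k, p < ξ k → ξ n ≤ ξ k) : κ (ξ n) = m + 1 := by
  obtain ⟨h1, h2⟩ := hξ.pos n
  have hap : a ≤ p := by
    rcases hp with rfl | ⟨h3, h4⟩
    · exact le_rfl
    · by_contra! hle
      exact ha.zeta_ne_zero (by rw [abs_of_pos h3]; exact hle.le) h4
  obtain ⟨k, hk⟩ := (hκ.kappaPhase_eq_one_iff (ξ n)).1 (ha.kappaPhase_eq_one_iff.2 (Or.inr h2))
  have hleft := eventually_lt_of_sin_neg hκ.continuous.continuousAt hk
    (hκ.eventually_sin_neg_and_pos ha (Or.inr ⟨h1, h2⟩)).1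
  have hright := eventually_gt_of_sin_pos hκ.continuous.continuousAt hpm
    (hκ.eventually_sin_neg_and_pos ha hp).2
  have hlt : ∀ᶠ t in 𝓝[>] p, κ t < m + 1 :=
    (hκ.continuous.continuousAt.eventually (gt_mem_nhds (by rw [hpm]; linarith))).filter_mono
      nhdsWithin_le_nhds
  obtain ⟨r, hr1, hr2, hr3⟩ := (hright.and (hlt.and (Ioo_mem_nhdsGT hpn))).exists
  refine eq_add_one_of_forall_ne_int hκ.continuous hr3.2 hr1 hr2 (fun t ht j hj => ?_) hk hleft
  have hpt : p < t := hr3.1.trans_le ht.1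
  have ht0 : |t| = t := abs_of_pos (by linarith [ha.1])
  rcases hκ.eq_of_int_value ha hξ ⟨j, hj⟩ with h | ⟨i, h⟩
  · linarith
  · have := hne i (by linarith)
    have := ht.2
    linarith

theorem IsKappa.apply_ordinate (hκ : IsKappa κ) (ha : IsThetaCritical a)
    (hξ : IsCriticalLineOrdinates ξ) (n : ℕ+) : κ (ξ n) = (n : ℕ) := by
  induction n using PNat.recOn with
  | one =>
    have := hκ.apply_next ha hξ (m := 0) (n := 1) (Or.inl rfl)
      (by rw [hκ.apply_thetaCritical ha hξ]; norm_num) (ha.lt_ordinate hξ 1)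
      fun k _ => hξ.1.monotone one_le
    rw [this]
    norm_num
  | succ n ih =>
    have := hκ.apply_next ha hξ (m := (n : ℕ)) (n := n + 1) (Or.inr (hξ.pos n))
      (by rw [ih]; norm_cast) (hξ.1 (PNat.lt_add_right n 1))
      fun k hk => hξ.1.monotone (PNat.add_one_le_iff.2 (hξ.1.lt_iff_lt.1 hk))
    rw [this]
    push_cast
    rfl

/-- Integers are taken only at ±a and ±ξ k. The symmetry κ(-t) = -κ(t) - 1 makes the values at -a
and -ξ k negative, and κ(a) = 0. -/
theorem IsKappa.eq_natCast_iff (hκ : IsKappa κ) (ha : IsThetaCritical a)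
    (hξ : IsCriticalLineOrdinates ξ) (n : ℕ+) (t : ℝ) : κ t = ((n : ℕ) : ℝ) ↔ t = ξ n := by
  refine ⟨fun h => ?_, fun h => h ▸ hκ.apply_ordinate ha hξ n⟩
  have hn : (0 : ℝ) < (n : ℕ) := by exact_mod_cast n.pos
  have ha0 := hκ.apply_thetaCritical ha hξ
  have habs : t = |t| ∨ t = -|t| := by
    rcases abs_choice t with e | e <;> rw [e] <;> simp
  rcases hκ.eq_of_int_value ha hξ ⟨(n : ℕ), by rw [h]; norm_cast⟩ with e | ⟨k, e⟩ <;>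
    rw [e] at habs
  · rcases habs with e | e
    · rw [e, ha0] at h
      linarith
    · rw [e, hκ.neg, ha0] at h
      linarith
  · have hk := hκ.apply_ordinate ha hξ k
    rcases habs with e | e
    · rw [e, hk] at h
      rw [e, PNat.coe_injective (Nat.cast_injective h)]
    · rw [e, hκ.neg, hk] at h
      have : (0 : ℝ) ≤ (k : ℕ) := Nat.cast_nonneg _
      linarith

end

/-! ### The zeros in the upper half-plane under the Riemann hypothesis and simplicity. -/

theorem eq_critPt_of_riemannHypothesis (hRH : RiemannHypothesis) {z : ℂ} (hz : 0 < z.im)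
    (h0 : riemannZeta z = 0) : z = critPt z.im := by
  have hre : z.re = 1 / 2 := hRH z h0 (fun ⟨n, hn⟩ => by
    have : z.im = 0 := by rw [hn]; simp
    linarith) (fun h1 => by rw [h1] at hz; simp at hz)
  exact Complex.ext (by rw [hre, critPt_re]) (by rw [critPt_im])

theorem analyticOrderAt_riemannZeta_eq_zero_iff {z : ℂ} (hz : 0 < z.im) :
    analyticOrderAt riemannZeta z = 0 ↔ riemannZeta z ≠ 0 := by
  have hz1 : z ≠ 1 := fun h => by rw [h] at hz; simp at hz
  exact (analyticOn_riemannZeta z hz1).analyticOrderAt_eq_zero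

/-- Supplies the existence of the sequence ρ, so that the conditional statement is not vacuous. -/
theorem IsCriticalLineOrdinates.isUpperZeros {ξ : ℕ+ → ℝ} (hξ : IsCriticalLineOrdinates ξ)
    (hRH : RiemannHypothesis) (hS : SimpleUpperZeros) : IsUpperZeros fun n => critPt (ξ n) := by
  refine ⟨fun n => ?_, ?_, fun z hz => ?_⟩
  · rw [critPt_im]
    exact (hξ.pos n).1
  · simp only [critPt_im]
    exact hξ.1.monotone
  · by_cases h0 : riemannZeta z = 0
    · rw [hS z hz h0]
      have hzc := eq_critPt_of_riemannHypothesis hRH hz h0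
      obtain ⟨n, hn⟩ := hξ.exists_eq hz (by rw [← hzc]; exact h0)
      have : {m : ℕ+ | critPt (ξ m) = z} = {n} := by
        ext m
        simp only [Set.mem_ofPred_eq, Set.mem_singleton_iff]
        constructor
        · intro h
          apply hξ.1.injective
          rw [← hn, ← h, critPt_im]
        · rintro rfl
          rw [← hn, ← hzc]
      rw [this, Set.encard_singleton]
    · rw [(analyticOrderAt_riemannZeta_eq_zero_iff hz).2 h0, Set.encard_eq_zero,
        Set.eq_empty_iff_forall_notMem]
      intro n hn
      exact h0 (by rw [← hn.out]; exact (hξ.pos n).2)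

/-- The Riemann hypothesis recovers each zero from its ordinate, and simplicity excludes
repetitions. So the monotone sequence of ordinates is strictly increasing, and the unconditional
result applies to it directly. -/
theorem IsUpperZeros.isCriticalLineOrdinates {ρ : ℕ+ → ℂ} (hρ : IsUpperZeros ρ)
    (hRH : RiemannHypothesis) (hS : SimpleUpperZeros) :
    IsCriticalLineOrdinates fun n => (ρ n).im := by
  obtain ⟨hpos, hmono, hcard⟩ := hρ
  have hzero : ∀ n, riemannZeta (ρ n) = 0 := by
    intro n
    by_contra h0
    have := hcard (ρ n) (hpos n)
    rw [(analyticOrderAt_riemannZeta_eq_zero_iff (hpos n)).2 h0, Set.encard_eq_zero] at this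
    exact this.subset (show n ∈ {m | ρ m = ρ n} from rfl)
  have hcrit : ∀ n, ρ n = critPt (ρ n).im := fun n =>
    eq_critPt_of_riemannHypothesis hRH (hpos n) (hzero n)
  have hinj : Function.Injective fun n => (ρ n).im := by
    intro m n hmn
    have hmn' : ρ m = ρ n := by
      rw [hcrit m, hcrit n]
      exact congrArg critPt hmn
    have h1 := hcard (ρ n) (hpos n)
    rw [hS _ (hpos n) (hzero n)] at h1
    exact (Set.encard_le_one_iff.1 h1.le) m n hmn' rfl
  refine ⟨hmono.strictMono_of_injective hinj, Set.Subset.antisymm ?_ fun t ht => ?_⟩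
  · rintro _ ⟨n, rfl⟩
    exact ⟨hpos n, by rw [← hcrit]; exact hzero n⟩
  · have him : 0 < (critPt t).im := by rw [critPt_im]; exact ht.1
    have h1 := hcard (critPt t) him
    rw [hS _ him ht.2] at h1
    obtain ⟨n, hn⟩ := Set.encard_eq_one.1 h1
    have : ρ n = critPt t := by
      have : n ∈ {m | ρ m = critPt t} := by rw [hn]; rfl
      exact this
    exact ⟨n, by simp only [this, critPt_im]⟩

theorem corollary18 :
    (∃! κ : ℝ → ℝ, IsKappa κ) ∧
    (∃! a : ℝ, IsThetaCritical a) ∧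
    (∃! ξ : ℕ+ → ℝ, IsCriticalLineOrdinates ξ) ∧
    ∀ (κ : ℝ → ℝ) (a : ℝ) (ξ : ℕ+ → ℝ),
      IsKappa κ → IsThetaCritical a → IsCriticalLineOrdinates ξ →
      -- the values of `κ` at the listed points
      (κ a = 0 ∧ κ (-a) = -1 ∧
        ∀ n : ℕ+, κ (ξ n) = ((n : ℕ) : ℝ) ∧ κ (-ξ n) = -((n : ℕ) : ℝ) - 1) ∧
      -- `κ` takes integer values nowhere else
      (∀ t : ℝ, (∃ m : ℤ, κ t = (m : ℝ)) →
        t = a ∨ t = -a ∨ ∃ n : ℕ+, t = ξ n ∨ t = -ξ n) ∧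
      -- `ξ n` is the unique solution of `κ t = n`
      (∀ (n : ℕ+) (t : ℝ), κ t = ((n : ℕ) : ℝ) ↔ t = ξ n) ∧
      -- under RH and simplicity, so is the ordinate of the `n`-th zero
      (RiemannHypothesis → SimpleUpperZeros →
        (∃ ρ : ℕ+ → ℂ, IsUpperZeros ρ) ∧
        ∀ ρ : ℕ+ → ℂ, IsUpperZeros ρ →
          ∀ (n : ℕ+) (t : ℝ), κ t = ((n : ℕ) : ℝ) ↔ t = (ρ n).im) := by
  refine ⟨existsUnique_isKappa, existsUnique_isThetaCritical,
    existsUnique_isCriticalLineOrdinates, fun κ a ξ hκ ha hξ => ⟨⟨?_, ?_, fun n => ⟨?_, ?_⟩⟩,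
      fun t ht => ?_, hκ.eq_natCast_iff ha hξ, fun hRH hS =>
        ⟨⟨_, hξ.isUpperZeros hRH hS⟩, fun ρ hρ =>
          hκ.eq_natCast_iff ha (hρ.isCriticalLineOrdinates hRH hS)⟩⟩⟩
  · exact hκ.apply_thetaCritical ha hξ
  · rw [hκ.neg, hκ.apply_thetaCritical ha hξ]
    norm_num
  · exact hκ.apply_ordinate ha hξ n
  · rw [hκ.neg, hκ.apply_ordinate ha hξ n]
  · rcases hκ.eq_of_int_value ha hξ ht with h | ⟨n, h⟩
    · rcases eq_or_eq_neg_of_abs_eq h with h | h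
      · exact Or.inl h
      · exact Or.inr (Or.inl h)
    · exact Or.inr (Or.inr ⟨n, eq_or_eq_neg_of_abs_eq h⟩)
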